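/- Let $n\ge 3$. For $E\subset\mathbf R^n$ put $$\mathbf C(E)=\inf\Big\{\int_{\mathbf R^n}|D^2\psi|^{(n+2)/4}\,dx:\ \psi\in C_0^\infty(B(0,2)),\ \psi\ge 1 \text{ on } E\Big\},$$ where $C_0^\infty(B(0,2))$ is the set of real smooth functions on $\mathbf R^n$ whose support is a compact subset of the open ball $B(0,2)$, and $|D^2\psi|$ is the Euclidean (Frobenius) norm of the Hessian matrix. There is a constant $C(n)>0$ depending only on $n$, and for every real $m\ge\frac{n+2}{2}$ a constant $C(m,n)>0$ depending only on $m$ and $n$, with the following property. Let $K$ be a compact subset of the open unit ball $B(0,1)\subset\mathbf R^n$, and let $u\in C^2(\mathbf R^n\setminus K)$ satisfy $$u>0,\qquad \Delta u=u^{(n+2)/(n-2)}\qquad\text{in } \mathbf R^n\setminus K.$$ Then there is a function $\varphi\in C_0^\infty(B(0,2))$ with $0\le\varphi\le 1$ and $\varphi=1$ in an open neighbourhood of $K$, such that $$\int_{B(0,2)}|D^2\varphi|^{(n+2)/4}\,dx\le C(n)\,\mathbf C(K),$$ and such that for $\eta=(1-\varphi)^m$ the inequalities $$\int_{\mathbf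 R^n}u\,\big(|D\eta|+|\Delta\eta|\big)\,dx\le C(m,n)\,\mathbf C(K),\qquad \int_{\mathbf R^n}u^{(n+2)/(n-2)}\,\eta\,dx\le C(m,n)\,\mathbf C(K)$$ hold, where the integrands are understood to be $0$ on $K$ (near $K$ one has $\eta=0$). -/

import Mathlib

open MeasureTheory Metric
open scoped ENNReal NNReal ContDiff

/-- `ψ ∈ C₀^∞(U)`: a smooth function on `ℝⁿ` whose support is a compact subset of `U`. -/
structure IsTestFunctionOn {n : ℕ} (U : Set (EuclideanSpace ℝ (Fin n)))
    (ψ : EuclideanSpace ℝ (Fin n) → ℝ) : Prop where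
  contDiff : ContDiff ℝ ∞ ψ
  hasCompactSupport : HasCompactSupport ψ
  tsupport_subset : tsupport ψ ⊆ U

/-- The second partial derivative `∂ᵢ∂ⱼ f (x)`. -/
noncomputable def secondPartial {n : ℕ} (f : EuclideanSpace ℝ (Fin n) → ℝ) (i j : Fin n)
    (x : EuclideanSpace ℝ (Fin n)) : ℝ :=
  iteratedFDeriv ℝ 2 f x ![EuclideanSpace.single i (1 : ℝ), EuclideanSpace.single j (1 : ℝ)]

/-- The Euclidean (Frobenius) norm `|D²f(x)|` of the Hessian matrix. -/
noncomputable def hessianNorm {n : ℕ} (f : EuclideanSpace ℝ (Fin n) → ℝ)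
    (x : EuclideanSpace ℝ (Fin n)) : ℝ :=
  Real.sqrt (∑ i : Fin n, ∑ j : Fin n, secondPartial f i j x ^ 2)

/-- The Bessel capacity
`C(E) = inf { ∫_{ℝⁿ} |D²ψ|^((n+2)/4) dx : ψ ∈ C₀^∞(B(0,2)), ψ ≥ 1 on E }`. -/
noncomputable def besselCapacity {n : ℕ} (E : Set (EuclideanSpace ℝ (Fin n))) : ℝ≥0∞ :=
  ⨅ (ψ : EuclideanSpace ℝ (Fin n) → ℝ) (_ : IsTestFunctionOn (ball 0 2) ψ)
    (_ : ∀ x ∈ E, 1 ≤ ψ x),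
    ∫⁻ x, ENNReal.ofReal (hessianNorm ψ x ^ (((n : ℝ) + 2) / 4))

/-- `u` is a classical positive solution of `Δu = u^((n+2)/(n-2))` in the open set `O`. -/
structure IsPositiveSolutionOn {n : ℕ} (O : Set (EuclideanSpace ℝ (Fin n)))
    (u : EuclideanSpace ℝ (Fin n) → ℝ) : Prop where
  contDiffOn : ContDiffOn ℝ 2 u O
  pos : ∀ x ∈ O, 0 < u x
  equation : ∀ x ∈ O, Laplacian.laplacian u x = u x ^ (((n : ℝ) + 2) / ((n : ℝ) - 2))

/-! ### Coordinate calculus: Hessian, Laplacian, Green's identity. -/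

section Calculus

variable {n : ℕ}

local notation "𝔼[" n "]" => EuclideanSpace ℝ (Fin n)

/-! Put p = (n+2)/4 and q = (n+2)/(n-2); these are conjugate exponents. The proof has two halves,
which meet in a single function: a majorant `B` of |D²φ|, |∇φ| and |∇φ|² whose p-th power integral
is comparable to the capacity.

Construction of φ. A nearly extremal ψ cannot simply be truncated: the Hessian of H(ψ) contains
|∇ψ|², which D²ψ does not control pointwise. So ψ is replaced by a nonlinear potential. On a fine
finite net of K, minimise the dyadic energy Σ_k ∫ M_k^q of a measure μ, where M_k(x) = 2^{k(n-2)}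
μ(B(x, 2^{-k}/8)). The Euler-Lagrange conditions say that, after rescaling, the associated potential
is at least 1 at the net points and the energy equals the mass of μ (`exists_equilibrium`). Testing
ψ ≥ 1 against a regularised fundamental solution, then using Hölder and Wolff's inequality, bounds
this mass by C ∫ |Δψ|^p (`exists_net_equilibrium`). The potential is finally smoothed by kernels at
scale 2^{-k} and truncated by H. The kernels are squares, so at points where the potential is at
most 1 its squared gradient is bounded by the same positive operator that bounds the second
derivatives (`exists_truncation`). That operator is Σ_k M_k^{q-1} with slightly larger balls, and
the dual form of `exists_wolff` bounds its p-norm by the energy (`exists_smooth_truncation`).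

Energy estimate. For a test function f supported off K, Green's identity gives ∫ u^q f = ∫ u Δf. If
Δf ≤ f^{1/q} G, Hölder gives X ≤ X^{1/q} ‖G‖_p for X = ∫ u^q f, and since X is finite, X ≤ ∫ G^p.
The power η = (1-φ)^m has such a bound with G a multiple of `B` exactly because m ≥ 2p. A second
factor W must cut off at infinity. A dilated bump on B(0,R) would cost about R^{n-2p} = R^{(n-2)/2},
which grows. Instead W follows a regularised fundamental solution, which is superharmonic, and is
cut off only at a very low level; its error in L^p is arbitrarily small
(`exists_superharmonic_cutoff`). Letting the error tend to 0 and the radius to infinity gives the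
bound on ∫ u^q η, and one more Hölder inequality bounds the derivative terms
(`exists_energy_bound`).

A ψ with energy below twice the capacity exists only if the capacity is finite and nonzero.
Nonvanishing comes from the solution itself: outside B(0,2) one has η = 1, so the energy of every
admissible ψ is bounded below by a multiple of the mass of u^q there (`besselCapacity_pos`). -/

theorem secondPartial_eq_fderiv (f : 𝔼[n] → ℝ) (i j : Fin n) (x : 𝔼[n]) :
    secondPartial f i j x =
      fderiv ℝ (fderiv ℝ f) x (EuclideanSpace.single i 1) (EuclideanSpace.single j 1) := by
  simp [secondPartial, iteratedFDeriv_two_apply]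

theorem laplacian_eq_sum_secondPartial (f : 𝔼[n] → ℝ) (x : 𝔼[n]) :
    Laplacian.laplacian f x = ∑ i, secondPartial f i i x := by
  have h := congrFun (InnerProductSpace.laplacian_eq_iteratedFDeriv_orthonormalBasis f
    (EuclideanSpace.basisFun (Fin n) ℝ)) x
  rw [h]
  simp [secondPartial]

theorem norm_gradient_eq (f : 𝔼[n] → ℝ) (x : 𝔼[n]) : ‖gradient f x‖ = ‖fderiv ℝ f x‖ := by
  simp [gradient]

theorem hessianNorm_nonneg (f : 𝔼[n] → ℝ) (x : 𝔼[n]) : 0 ≤ hessianNorm f x := Real.sqrt_nonneg _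

theorem abs_secondPartial_le_hessianNorm (f : 𝔼[n] → ℝ) (i j : Fin n) (x : 𝔼[n]) :
    |secondPartial f i j x| ≤ hessianNorm f x := by
  rw [hessianNorm]
  apply Real.abs_le_sqrt
  refine le_trans ?_ (Finset.single_le_sum (f := fun i => ∑ j, secondPartial f i j x ^ 2)
    (fun i _ => Finset.sum_nonneg fun j _ => sq_nonneg _) (Finset.mem_univ i))
  exact Finset.single_le_sum (f := fun j => secondPartial f i j x ^ 2)
    (fun j _ => sq_nonneg _) (Finset.mem_univ j)

theorem abs_laplacian_le (f : 𝔼[n] → ℝ) (x : 𝔼[n]) :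
    |Laplacian.laplacian f x| ≤ n * hessianNorm f x := by
  rw [laplacian_eq_sum_secondPartial]
  refine (Finset.abs_sum_le_sum_abs _ _).trans ?_
  refine (Finset.sum_le_sum fun i _ => abs_secondPartial_le_hessianNorm f i i x).trans ?_
  simp

theorem hessianNorm_le {f : 𝔼[n] → ℝ} {x : 𝔼[n]} {B : ℝ} (hB : 0 ≤ B)
    (h : ∀ i j, |secondPartial f i j x| ≤ B) : hessianNorm f x ≤ n * B := by
  rw [hessianNorm]
  apply Real.sqrt_le_iff.2 ⟨by positivity, ?_⟩
  calc ∑ i, ∑ j, secondPartial f i j x ^ 2 ≤ ∑ _i : Fin n, ∑ _j : Fin n, B ^ 2 := by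
        refine Finset.sum_le_sum fun i _ => Finset.sum_le_sum fun j _ => ?_
        exact sq_le_sq' (abs_le.1 (h i j)).1 (abs_le.1 (h i j)).2
    _ = (n * B) ^ 2 := by simp; ring

/-- Second derivative of a composition with a function of one variable. -/
theorem fderiv_fderiv_comp {E : Type*} [NormedAddCommGroup E] [NormedSpace ℝ E]
    {h h₁ : ℝ → ℝ} {h₂ : ℝ} {f : E → ℝ} {x : E}
    (hf : ContDiffAt ℝ 2 f x)
    (hh : ∀ᶠ t in nhds (f x), HasDerivAt h (h₁ t) t) (hh₁ : HasDerivAt h₁ h₂ (f x)) (v w : E) :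
    fderiv ℝ (fun y => h (f y)) x v = h₁ (f x) * fderiv ℝ f x v ∧
    fderiv ℝ (fderiv ℝ fun y => h (f y)) x v w =
      h₁ (f x) * fderiv ℝ (fderiv ℝ f) x v w + h₂ * (fderiv ℝ f x v * fderiv ℝ f x w) := by
  have hd : ∀ᶠ y in nhds x, DifferentiableAt ℝ f y :=
    (hf.eventually (by simp)).mono fun y hy => hy.differentiableAt (by simp)
  have hc : ∀ᶠ y in nhds x, HasDerivAt h (h₁ (f y)) (f y) := hf.continuousAt.eventually hh
  have key : fderiv ℝ (fun y => h (f y)) =ᶠ[nhds x] fun y => h₁ (f y) • fderiv ℝ f y := by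
    filter_upwards [hd, hc] with y hy hy'
    exact (hy'.comp_hasFDerivAt y hy.hasFDerivAt).fderiv
  have hf2 : DifferentiableAt ℝ (fderiv ℝ f) x :=
    (hf.fderiv_right (m := 1) (by norm_num)).differentiableAt (by simp)
  refine ⟨by rw [key.eq_of_nhds]; simp, ?_⟩
  rw [key.fderiv_eq]
  have h1 : HasFDerivAt (fun y => h₁ (f y)) (h₂ • fderiv ℝ f x) x :=
    hh₁.comp_hasFDerivAt x hd.self_of_nhds.hasFDerivAt
  rw [(h1.fun_smul hf2.hasFDerivAt).fderiv]
  simp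
  ring

/-- Second derivative of a product. -/
theorem fderiv_fderiv_mul {E : Type*} [NormedAddCommGroup E] [NormedSpace ℝ E]
    {f g : E → ℝ} {x : E} (hf : ContDiffAt ℝ 2 f x) (hg : ContDiffAt ℝ 2 g x) (v w : E) :
    fderiv ℝ (fderiv ℝ fun y => f y * g y) x v w =
      f x * fderiv ℝ (fderiv ℝ g) x v w + g x * fderiv ℝ (fderiv ℝ f) x v w +
      (fderiv ℝ f x v * fderiv ℝ g x w + fderiv ℝ g x v * fderiv ℝ f x w) := by
  have hd : ∀ᶠ y in nhds x, DifferentiableAt ℝ f y :=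
    (hf.eventually (by simp)).mono fun y hy => hy.differentiableAt (by simp)
  have hd' : ∀ᶠ y in nhds x, DifferentiableAt ℝ g y :=
    (hg.eventually (by simp)).mono fun y hy => hy.differentiableAt (by simp)
  have key : fderiv ℝ (fun y => f y * g y) =ᶠ[nhds x]
      fun y => f y • fderiv ℝ g y + g y • fderiv ℝ f y := by
    filter_upwards [hd, hd'] with y hy hy'
    exact (hy.hasFDerivAt.mul hy'.hasFDerivAt).fderiv
  have hf2 : DifferentiableAt ℝ (fderiv ℝ f) x :=
    (hf.fderiv_right (m := 1) (by norm_num)).differentiableAt (by simp)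
  have hg2 : DifferentiableAt ℝ (fderiv ℝ g) x :=
    (hg.fderiv_right (m := 1) (by norm_num)).differentiableAt (by simp)
  rw [key.fderiv_eq]
  rw [((hd.self_of_nhds.hasFDerivAt.fun_smul hg2.hasFDerivAt).fun_add
    (hd'.self_of_nhds.hasFDerivAt.fun_smul hf2.hasFDerivAt)).fderiv]
  simp
  ring

theorem sum_fderiv_single_sq (L : 𝔼[n] →L[ℝ] ℝ) :
    ∑ i, L (EuclideanSpace.single i 1) ^ 2 = ‖L‖ ^ 2 := by
  obtain ⟨v, rfl⟩ := (InnerProductSpace.toDual ℝ 𝔼[n]).surjective L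
  simp [EuclideanSpace.norm_sq_eq, EuclideanSpace.inner_single_right]

theorem laplacian_comp {h h₁ : ℝ → ℝ} {h₂ : ℝ} {f : 𝔼[n] → ℝ} {x : 𝔼[n]}
    (hf : ContDiffAt ℝ 2 f x)
    (hh : ∀ᶠ t in nhds (f x), HasDerivAt h (h₁ t) t) (hh₁ : HasDerivAt h₁ h₂ (f x)) :
    Laplacian.laplacian (fun y => h (f y)) x =
      h₁ (f x) * Laplacian.laplacian f x + h₂ * ‖fderiv ℝ f x‖ ^ 2 := by
  rw [laplacian_eq_sum_secondPartial, laplacian_eq_sum_secondPartial, ← sum_fderiv_single_sq,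
    Finset.mul_sum, Finset.mul_sum, ← Finset.sum_add_distrib]
  refine Finset.sum_congr rfl fun i _ => ?_
  rw [secondPartial_eq_fderiv, secondPartial_eq_fderiv, (fderiv_fderiv_comp hf hh hh₁ _ _).2]
  ring

theorem norm_fderiv_comp {h h₁ : ℝ → ℝ} {f : 𝔼[n] → ℝ} {x : 𝔼[n]} (hf : DifferentiableAt ℝ f x)
    (hh : HasDerivAt h (h₁ (f x)) (f x)) :
    ‖fderiv ℝ (fun y => h (f y)) x‖ = |h₁ (f x)| * ‖fderiv ℝ f x‖ := by
  have : fderiv ℝ (fun y => h (f y)) x = h₁ (f x) • fderiv ℝ f x :=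
    (hh.comp_hasFDerivAt x hf.hasFDerivAt).fderiv
  rw [this, norm_smul, Real.norm_eq_abs]

/-- Each of the n cross terms 2 ∂ᵢf ∂ᵢg is bounded by the full norms. This loses a factor n against
Cauchy-Schwarz, which is harmless because only an upper bound with a dimensional constant is needed.
-/
theorem laplacian_mul_le {f g : 𝔼[n] → ℝ} {x : 𝔼[n]} (hf : ContDiffAt ℝ 2 f x)
    (hg : ContDiffAt ℝ 2 g x) :
    Laplacian.laplacian (fun y => f y * g y) x ≤
      f x * Laplacian.laplacian g x + g x * Laplacian.laplacian f x +
        2 * n * (‖fderiv ℝ f x‖ * ‖fderiv ℝ g x‖) := by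
  rw [laplacian_eq_sum_secondPartial, laplacian_eq_sum_secondPartial,
    laplacian_eq_sum_secondPartial, Finset.mul_sum, Finset.mul_sum, ← Finset.sum_add_distrib]
  have : 2 * n * (‖fderiv ℝ f x‖ * ‖fderiv ℝ g x‖) =
      ∑ _i : Fin n, 2 * (‖fderiv ℝ f x‖ * ‖fderiv ℝ g x‖) := by simp; ring
  rw [this, ← Finset.sum_add_distrib]
  refine Finset.sum_le_sum fun i _ => ?_
  rw [secondPartial_eq_fderiv, secondPartial_eq_fderiv, secondPartial_eq_fderiv,
    fderiv_fderiv_mul hf hg]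
  set v : 𝔼[n] := EuclideanSpace.single i 1
  have hv : ‖v‖ = 1 := by simp [v]
  have h1 : |fderiv ℝ f x v| ≤ ‖fderiv ℝ f x‖ := by
    simpa [hv] using (fderiv ℝ f x).le_opNorm v
  have h2 : |fderiv ℝ g x v| ≤ ‖fderiv ℝ g x‖ := by
    simpa [hv] using (fderiv ℝ g x).le_opNorm v
  have h3 : fderiv ℝ f x v * fderiv ℝ g x v ≤ ‖fderiv ℝ f x‖ * ‖fderiv ℝ g x‖ := by
    refine (le_abs_self _).trans ?_
    rw [abs_mul]
    gcongr
  linarith [mul_comm (fderiv ℝ f x v) (fderiv ℝ g x v)]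

/-- This is what allows u, arbitrary on K, to appear in integrals over the whole space: the cutoff
vanishes in a neighbourhood of the bad set. -/
theorem continuous_mul_of_tsupport_subset {E : Type*} [TopologicalSpace E] {O : Set E}
    (hO : IsOpen O) {f g : E → ℝ} (hf : ContinuousOn f O) (hg : Continuous g)
    (hgO : tsupport g ⊆ O) : Continuous fun x => f x * g x := by
  have hs : tsupport (fun x => f x * g x) ⊆ tsupport g := tsupport_mul_subset_right
  refine continuous_of_tsupport fun x hx => ?_
  exact (hf.continuousAt (hO.mem_nhds (hgO (hs hx)))).mul hg.continuousAt

/-- The product of a function continuous on an open set with a continuous function compactly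
supported in that set is integrable. -/
theorem integrable_mul_of_tsupport_subset {E : Type*} [NormedAddCommGroup E] [MeasurableSpace E]
    [BorelSpace E] {μ : Measure E} [IsFiniteMeasureOnCompacts μ] {O : Set E} (hO : IsOpen O)
    {f g : E → ℝ} (hf : ContinuousOn f O) (hg : Continuous g)
    (hgc : HasCompactSupport g) (hgO : tsupport g ⊆ O) : Integrable (fun x => f x * g x) μ :=
  (continuous_mul_of_tsupport_subset hO hf hg hgO).integrable_of_hasCompactSupport hgc.mul_left

/-- **Green's identity** against a compactly supported function. -/
theorem integral_mul_laplacian_comm {O : Set 𝔼[n]} (hO : IsOpen O) {f g : 𝔼[n] → ℝ}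
    (hf : ContDiffOn ℝ 2 f O) (hg : ContDiff ℝ 2 g) (hgc : HasCompactSupport g)
    (hgO : tsupport g ⊆ O) :
    ∫ x, g x * Laplacian.laplacian f x = ∫ x, f x * Laplacian.laplacian g x := by
  have hf1 : ContDiffOn ℝ 1 (fderiv ℝ f) O := hf.fderiv_of_isOpen hO (by norm_num)
  have hg1 : ContDiff ℝ 1 (fderiv ℝ g) := hg.fderiv_right (by norm_num)
  have hf2 : ContinuousOn (fderiv ℝ (fderiv ℝ f)) O :=
    hf1.continuousOn_fderiv_of_isOpen hO (by norm_num)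
  have hg2 : Continuous (fderiv ℝ (fderiv ℝ g)) := hg1.continuous_fderiv (by norm_num)
  have hev : ∀ (v : 𝔼[n]), Continuous fun x => fderiv ℝ g x v := fun v =>
    hg1.continuous.clm_apply continuous_const
  have key : ∀ v : 𝔼[n], Integrable (fun x => g x * fderiv ℝ (fderiv ℝ f) x v v) ∧
      Integrable (fun x => f x * fderiv ℝ (fderiv ℝ g) x v v) ∧
      ∫ x, g x * fderiv ℝ (fderiv ℝ f) x v v = ∫ x, f x * fderiv ℝ (fderiv ℝ g) x v v := by
    intro v
    have e1 : ∀ x ∈ O, fderiv ℝ (fun y => fderiv ℝ f y v) x v = fderiv ℝ (fderiv ℝ f) x v v := by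
      intro x hx
      have : DifferentiableAt ℝ (fderiv ℝ f) x :=
        (hf1.contDiffAt (hO.mem_nhds hx)).differentiableAt (by simp)
      rw [fderiv_clm_apply this (by fun_prop)]
      simp
    have e2 : ∀ x, fderiv ℝ (fun y => fderiv ℝ g y v) x v = fderiv ℝ (fderiv ℝ g) x v v := by
      intro x
      have : DifferentiableAt ℝ (fderiv ℝ g) x := (hg1.differentiable (by simp)) x
      rw [fderiv_clm_apply this (by fun_prop)]
      simp
    have ts1 := tsupport_fderiv_apply_subset ℝ (f := g) v
    have ts2 := (tsupport_fderiv_apply_subset ℝ (f := fun x => fderiv ℝ g x v) v).trans ts1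
    have c1 : HasCompactSupport fun x => fderiv ℝ g x v :=
      hgc.of_isClosed_subset (isClosed_tsupport _) ts1
    have c2 : HasCompactSupport fun x => fderiv ℝ (fun y => fderiv ℝ g y v) x v :=
      hgc.of_isClosed_subset (isClosed_tsupport _) ts2
    have I1 : Integrable (fun x => fderiv ℝ (fderiv ℝ f) x v v * g x) :=
      integrable_mul_of_tsupport_subset hO
        ((hf2.clm_apply continuousOn_const).clm_apply continuousOn_const) hg.continuous hgc hgO
    have I2 : Integrable (fun x => fderiv ℝ f x v * fderiv ℝ g x v) :=
      integrable_mul_of_tsupport_subset hO (hf1.continuousOn.clm_apply continuousOn_const)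
        (hev v) c1 (ts1.trans hgO)
    have I3 : Integrable (fun x => f x * fderiv ℝ (fun y => fderiv ℝ g y v) x v) :=
      integrable_mul_of_tsupport_subset hO hf.continuousOn (by
        simp_rw [e2]; exact (hg2.clm_apply continuous_const).clm_apply continuous_const)
        c2 (ts2.trans hgO)
    have I4 : Integrable (fun x => f x * fderiv ℝ g x v) :=
      integrable_mul_of_tsupport_subset hO hf.continuousOn (hev v) c1 (ts1.trans hgO)
    have I5 : Integrable (fun x => fderiv ℝ f x v * g x) :=
      integrable_mul_of_tsupport_subset hO (hf1.continuousOn.clm_apply continuousOn_const)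
        hg.continuous hgc hgO
    have z1 : ∀ x, g x * fderiv ℝ (fun y => fderiv ℝ f y v) x v =
        fderiv ℝ (fderiv ℝ f) x v v * g x := by
      intro x
      by_cases hx : x ∈ tsupport g
      · rw [e1 x (hgO hx)]; ring
      · simp [image_eq_zero_of_notMem_tsupport hx]
    -- Two integrations by parts in the direction v. Differentiability of each factor is needed only
    -- on the support of the other, which lies in `O`.
    have J1 := integral_mul_fderiv_eq_neg_fderiv_mul_of_integrable (μ := volume) (v := v)
      (f := g) (g := fun y => fderiv ℝ f y v)
      (by simpa only [mul_comm] using I2) (by simp_rw [z1]; exact I1)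
      (by simpa only [mul_comm] using I5)
      (fun x _ => hg.differentiable (by simp) x)
      (fun x hx => (((hf1.contDiffAt (hO.mem_nhds (hgO hx))).differentiableAt
        (by simp)).clm_apply (by fun_prop)))
    have J2 := integral_mul_fderiv_eq_neg_fderiv_mul_of_integrable (μ := volume) (v := v)
      (f := f) (g := fun y => fderiv ℝ g y v) I2 I3 I4
      (fun x hx => (hf.contDiffAt (hO.mem_nhds (hgO (ts1 hx)))).differentiableAt (by simp))
      (fun x _ => ((hg1.differentiable (by simp)) x).clm_apply (by fun_prop))
    refine ⟨by simpa only [mul_comm] using I1, by simpa only [e2] using I3, ?_⟩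
    simp_rw [e2] at J2
    simp_rw [z1] at J1
    rw [J2, ← integral_congr_ae (Filter.Eventually.of_forall fun x => mul_comm _ _), J1]
    simp_rw [mul_comm]
  simp_rw [laplacian_eq_sum_secondPartial, secondPartial_eq_fderiv, Finset.mul_sum]
  rw [integral_finsetSum _ fun i _ => (key _).1, integral_finsetSum _ fun i _ => (key _).2.1]
  exact Finset.sum_congr rfl fun i _ => (key _).2.2

end Calculus

/-! ### Powers of sums against geometrically weighted products. -/

section DyadicSums

/-- Tangent line inequality for the convex function t^r at a + b, obtained from Bernoulli's
inequality with increment -b/(a+b). -/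
theorem NNReal.add_rpow_le_rpow_add_mul {r : ℝ} (hr : 1 ≤ r) (a b : ℝ≥0) :
    (a + b) ^ r ≤ a ^ r + Real.toNNReal r * (b * (a + b) ^ (r - 1)) := by
  rcases eq_or_ne (a + b) 0 with h | h
  · rw [h, NNReal.zero_rpow (by linarith)]; exact zero_le
  have hpos : 0 < (a + b : ℝ) := by
    have : 0 < a + b := pos_iff_ne_zero.2 h
    exact_mod_cast this
  rw [← NNReal.coe_le_coe]
  push_cast
  rw [Real.coe_toNNReal r (by linarith)]
  have hb := one_add_mul_self_le_rpow_one_add (s := -((b : ℝ) / (a + b))) (p := r)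
    (by
      rw [neg_le_neg_iff, div_le_one hpos]
      linarith [a.coe_nonneg]) hr
  have e : 1 + -((b : ℝ) / (a + b)) = a / (a + b) := by field_simp; ring
  rw [e, Real.div_rpow a.coe_nonneg hpos.le] at hb
  have hp := Real.rpow_pos_of_pos hpos r
  rw [le_div_iff₀ hp] at hb
  have e2 : ((a : ℝ) + b) ^ r = (a + b) ^ (r - 1) * (a + b) := by
    rw [Real.rpow_sub_one hpos.ne']; field_simp
  have e3 : (1 + r * -((b : ℝ) / (a + b))) * ((a : ℝ) + b) ^ r =
      (a + b) ^ r - r * (b * (a + b) ^ (r - 1)) := by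
    rw [e2]; field_simp; ring
  rw [e3] at hb
  linarith

/-- A discrete form of S^r = r ∫ S^{r-1} dS: adding the terms in increasing order of index, each one
raises the power by at most r times itself times the current partial sum to the r-1. -/
theorem NNReal.sum_rpow_le_sum_mul_partial_sum {κ : Type*} [LinearOrder κ] {r : ℝ} (hr : 1 ≤ r)
    (J : Finset κ) (x : κ → ℝ≥0) :
    (∑ k ∈ J, x k) ^ r ≤
      Real.toNNReal r * ∑ k ∈ J, x k * (∑ j ∈ J with j ≤ k, x j) ^ (r - 1) := by
  induction J using Finset.induction_on_max with
  | empty => simp [NNReal.zero_rpow (show r ≠ 0 by linarith)]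
  | insert a J ha ih =>
    have hna : a ∉ J := fun h => lt_irrefl _ (ha a h)
    have f1 : {j ∈ insert a J | j ≤ a} = insert a J := by
      ext j; simp only [Finset.mem_filter, Finset.mem_insert, and_iff_left_iff_imp]
      rintro (rfl | h)
      exacts [le_rfl, (ha j h).le]
    have f2 : ∀ k ∈ J, {j ∈ insert a J | j ≤ k} = {j ∈ J | j ≤ k} := by
      intro k hk; ext j; simp only [Finset.mem_filter, Finset.mem_insert]
      constructor
      · rintro ⟨rfl | h, h'⟩
        exacts [absurd (ha k hk) (not_lt.2 h'), ⟨h, h'⟩]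
      · rintro ⟨h, h'⟩; exact ⟨Or.inr h, h'⟩
    rw [Finset.sum_insert hna, Finset.sum_insert hna, f1, Finset.sum_insert hna]
    have f3 : ∀ k ∈ J, x k * (∑ j ∈ insert a J with j ≤ k, x j) ^ (r - 1) =
        x k * (∑ j ∈ J with j ≤ k, x j) ^ (r - 1) := fun k hk => by rw [f2 k hk]
    rw [Finset.sum_congr rfl f3]
    have := NNReal.add_rpow_le_rpow_add_mul hr (∑ k ∈ J, x k) (x a)
    rw [add_comm (x a), mul_add]
    refine this.trans ?_
    rw [add_comm]
    gcongr

/-- Every term is dominated by the largest weighted one times a geometric factor, so the sum is a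
convergent geometric series times that term. This treats s < 1 and s ≥ 1 together. -/
theorem NNReal.sum_rpow_le_sum_two_pow_mul {s : ℝ} (hs : 0 < s) :
    ∃ C : ℝ≥0, ∀ {κ : Type} (J : Finset κ) (e : κ → ℕ) (x : κ → ℝ≥0), Set.InjOn e J →
      (∑ j ∈ J, x j) ^ s ≤ C * ∑ j ∈ J, 2 ^ e j * x j ^ s := by
  -- Chosen so that θ^s = 1/2.
  set θ : ℝ≥0 := 2⁻¹ ^ (1 / s) with hθ
  have hθ1 : θ < 1 := NNReal.rpow_lt_one (by
    rw [← NNReal.coe_lt_coe]; norm_num) (by positivity)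
  refine ⟨(∑' l : ℕ, θ ^ l) ^ s, fun {κ} J e x he => ?_⟩
  rcases J.eq_empty_or_nonempty with rfl | hJ
  · simp [NNReal.zero_rpow hs.ne']
  obtain ⟨j₀, hj₀, hmax⟩ := J.exists_max_image (fun j => 2 ^ e j * x j ^ s) hJ
  have hθs : ∀ l : ℕ, (θ ^ l) ^ s = (2 ^ l)⁻¹ := by
    intro l
    rw [hθ, ← NNReal.rpow_natCast, ← NNReal.rpow_mul, ← NNReal.rpow_mul,
      show 1 / s * (l * s) = l by field_simp, NNReal.rpow_natCast, inv_pow]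
  have hx : ∀ j ∈ J, x j ≤ θ ^ e j * (2 ^ e j₀ * x j₀ ^ s) ^ (1 / s) := by
    intro j hj
    have h2 : x j ^ s ≤ (2 ^ e j)⁻¹ * (2 ^ e j₀ * x j₀ ^ s) := by
      rw [le_inv_mul_iff₀ (by positivity)]
      exact hmax j hj
    rw [← NNReal.rpow_le_rpow_iff hs, NNReal.mul_rpow, hθs, ← NNReal.rpow_mul,
      one_div_mul_cancel hs.ne', NNReal.rpow_one]
    exact h2
  calc (∑ j ∈ J, x j) ^ s
      ≤ (∑ j ∈ J, θ ^ e j * (2 ^ e j₀ * x j₀ ^ s) ^ (1 / s)) ^ s := by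
        gcongr with j hj; exact hx j hj
    _ = (∑ j ∈ J, θ ^ e j) ^ s * (2 ^ e j₀ * x j₀ ^ s) := by
        rw [← Finset.sum_mul, NNReal.mul_rpow, ← NNReal.rpow_mul,
          one_div_mul_cancel hs.ne', NNReal.rpow_one]
    _ ≤ (∑' l : ℕ, θ ^ l) ^ s * (2 ^ e j₀ * x j₀ ^ s) := by
        gcongr
        rw [← Finset.sum_image (f := fun l => θ ^ l) he]
        exact (NNReal.summable_geometric hθ1).sum_le_tsum _ fun _ _ => zero_le
    _ ≤ _ := by
        gcongr
        exact Finset.single_le_sum (f := fun j => 2 ^ e j * x j ^ s) (fun _ _ => zero_le) hj₀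

/-- A power of a sum is controlled by geometrically weighted off-diagonal products. -/
theorem NNReal.exists_sum_rpow_le {r : ℝ} (hr : 1 < r) :
    ∃ C : ℝ≥0, ∀ (J : Finset ℕ) (x : ℕ → ℝ≥0),
      (∑ k ∈ J, x k) ^ r ≤
        C * ∑ k ∈ J, ∑ j ∈ J with j ≤ k, 2 ^ (k - j) * (x k * x j ^ (r - 1)) ∧
      (∑ k ∈ J, x k) ^ r ≤
        C * ∑ k ∈ J, ∑ j ∈ J with k ≤ j, 2 ^ (j - k) * (x k * x j ^ (r - 1)) := by
  obtain ⟨C, hC⟩ := NNReal.sum_rpow_le_sum_two_pow_mul (s := r - 1) (by linarith)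
  refine ⟨Real.toNNReal r * C, fun J x => ⟨?_, ?_⟩⟩
  · refine (NNReal.sum_rpow_le_sum_mul_partial_sum hr.le J x).trans ?_
    rw [mul_assoc, Finset.mul_sum (a := C)]
    refine mul_le_mul_right (Finset.sum_le_sum fun k hk => ?_) _
    have := hC {j ∈ J | j ≤ k} (fun j => k - j) x (by
      intro a ha b hb hab
      simp at ha hb hab
      omega)
    calc _ ≤ x k * (C * ∑ j ∈ J with j ≤ k, 2 ^ (k - j) * x j ^ (r - 1)) := by gcongr
      _ = _ := by
        rw [mul_left_comm, Finset.mul_sum (a := x k)]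
        exact congrArg (C * ·) (Finset.sum_congr rfl fun _ _ => by ring)
  -- Reversing the order of the indices turns initial partial sums into tails, which gives the dual
  -- inequality.
  · have h := NNReal.sum_rpow_le_sum_mul_partial_sum (κ := ℕᵒᵈ) hr.le J x
    change _ ≤ Real.toNNReal r * ∑ k ∈ J, x k * (∑ j ∈ J with k ≤ j, x j) ^ (r - 1) at h
    refine le_trans h ?_
    rw [mul_assoc, Finset.mul_sum (a := C)]
    refine mul_le_mul_right (Finset.sum_le_sum fun k hk => ?_) _
    have := hC {j ∈ J | k ≤ j} (fun j => j - k) x (by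
      intro a ha b hb hab
      simp at ha hb hab
      omega)
    calc _ ≤ x k * (C * ∑ j ∈ J with k ≤ j, 2 ^ (j - k) * x j ^ (r - 1)) := by gcongr
      _ = _ := by
        rw [mul_left_comm, Finset.mul_sum (a := x k)]
        exact congrArg (C * ·) (Finset.sum_congr rfl fun _ _ => by ring)

theorem ENNReal.exists_sum_rpow_le {r : ℝ} (hr : 1 < r) :
    ∃ C : ℝ≥0, ∀ (J : Finset ℕ) (x : ℕ → ℝ≥0∞), (∀ k, x k ≠ ⊤) →
      (∑ k ∈ J, x k) ^ r ≤
        C * ∑ k ∈ J, ∑ j ∈ J with j ≤ k, 2 ^ (k - j) * (x k * x j ^ (r - 1)) ∧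
      (∑ k ∈ J, x k) ^ r ≤
        C * ∑ k ∈ J, ∑ j ∈ J with k ≤ j, 2 ^ (j - k) * (x k * x j ^ (r - 1)) := by
  obtain ⟨C, hC⟩ := NNReal.exists_sum_rpow_le hr
  refine ⟨C, fun J x hx => ?_⟩
  lift x to ℕ → ℝ≥0 using hx
  have e : ∀ j, ((x j : ℝ≥0∞)) ^ (r - 1) = ((x j ^ (r - 1) : ℝ≥0) : ℝ≥0∞) := fun j =>
    (ENNReal.coe_rpow_of_nonneg _ (by linarith)).symm
  simp_rw [e]
  rw [← ENNReal.ofNNReal_finsetSum, ← ENNReal.coe_rpow_of_nonneg _ (by linarith)]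
  exact_mod_cast hC J x

theorem ENNReal.sum_inv_two_pow_le {κ : Type*} (J : Finset κ) (e : κ → ℕ) (he : Set.InjOn e J) :
    ∑ j ∈ J, (2⁻¹ : ℝ≥0∞) ^ e j ≤ 2 := by
  rw [← Finset.sum_image (f := fun l => (2⁻¹ : ℝ≥0∞) ^ l) he]
  refine (ENNReal.sum_le_tsum _).trans ?_
  rw [ENNReal.tsum_geometric, ENNReal.one_sub_inv_two, inv_inv]

end DyadicSums

/-! ### Wolff's inequality for atomic measures. -/

section Wolff

variable {n : ℕ} {ι : Type*} [Fintype ι]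

local notation "𝔼[" n "]" => EuclideanSpace ℝ (Fin n)

/-- The mass that the atomic measure `∑ μᵢ δ_{zᵢ}` gives to the ball `B(x, r)`. -/
noncomputable def ballMass (μ : ι → ℝ≥0∞) (z : ι → 𝔼[n]) (r : ℝ) (x : 𝔼[n]) : ℝ≥0∞ :=
  ∑ i, (ball (z i) r).indicator (fun _ => μ i) x

/-- The scaled mass `2^{k(n-2)} μ(B(x, A 2^{-k}))`. -/
noncomputable def dyadicMass (μ : ι → ℝ≥0∞) (z : ι → 𝔼[n]) (A : ℝ) (k : ℕ) (x : 𝔼[n]) : ℝ≥0∞ :=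
  2 ^ (k * (n - 2)) * ballMass μ z (A / 2 ^ k) x

variable (μ : ι → ℝ≥0∞) (z : ι → 𝔼[n])

@[fun_prop]
theorem measurable_ballMass (r : ℝ) : Measurable (ballMass μ z r) :=
  Finset.measurable_fun_sum _ fun _ _ => measurable_const.indicator measurableSet_ball

@[fun_prop]
theorem measurable_dyadicMass (A : ℝ) (k : ℕ) : Measurable (dyadicMass μ z A k) :=
  (measurable_ballMass μ z _).const_mul _

theorem ballMass_ne_top {μ : ι → ℝ≥0∞} (hμ : ∀ i, μ i ≠ ⊤) (r : ℝ) (x : 𝔼[n]) :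
    ballMass μ z r x ≠ ⊤ := by
  refine ENNReal.sum_ne_top.2 fun i _ => ?_
  by_cases h : x ∈ ball (z i) r <;> simp [h, hμ]

theorem dyadicMass_ne_top {μ : ι → ℝ≥0∞} (hμ : ∀ i, μ i ≠ ⊤) (A : ℝ) (k : ℕ) (x : 𝔼[n]) :
    dyadicMass μ z A k x ≠ ⊤ :=
  ENNReal.mul_ne_top (by simp) (ballMass_ne_top z hμ _ _)

theorem ballMass_le_of_dist {r t R : ℝ} {x y : 𝔼[n]} (h : dist x y ≤ t) (hR : r + t ≤ R) :
    ballMass μ z r x ≤ ballMass μ z R y := by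
  refine Finset.sum_le_sum fun i _ => ?_
  by_cases hx : x ∈ ball (z i) r
  · have : y ∈ ball (z i) R := by
      rw [mem_ball] at hx ⊢
      linarith [dist_triangle y x (z i), dist_comm x y]
    simp [hx, this]
  · simp [hx]

theorem lintegral_ballMass_mul (r : ℝ) {f : 𝔼[n] → ℝ≥0∞} (hf : Measurable f) :
    ∫⁻ x, ballMass μ z r x * f x = ∑ i, μ i * ∫⁻ x in ball (z i) r, f x := by
  simp_rw [ballMass, Finset.sum_mul]
  rw [lintegral_finsetSum _ fun i _ => by
    exact (measurable_const.indicator measurableSet_ball).mul hf]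
  refine Finset.sum_congr rfl fun i _ => ?_
  rw [← lintegral_const_mul _ hf, ← lintegral_indicator measurableSet_ball]
  refine lintegral_congr fun x => ?_
  by_cases hx : x ∈ ball (z i) r <;> simp [hx]

/-- The factor 4^{-k} = 2^{k(n-2)} 2^{-kn} expresses that the potentials have order two; it pays for
two derivatives at scale 2^{-k}. -/
theorem two_pow_mul_volume_ball (hn : 2 ≤ n) {A : ℝ} (hA : 0 < A) (k : ℕ) (x : 𝔼[n]) :
    2 ^ (k * (n - 2)) * volume (ball x (A / 2 ^ k)) = 4⁻¹ ^ k * volume (ball (0 : 𝔼[n]) A) := by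
  have : Nonempty (Fin n) := ⟨⟨0, by omega⟩⟩
  rw [Measure.addHaar_ball _ _ (by positivity), Measure.addHaar_ball _ _ hA.le, ← mul_assoc,
    ← mul_assoc]
  congr 1
  have e : (2 : ℝ≥0∞) ^ (k * (n - 2)) = ENNReal.ofReal (2 ^ (k * (n - 2))) := by
    rw [ENNReal.ofReal_pow (by norm_num)]; simp
  have e' : (4⁻¹ : ℝ≥0∞) ^ k = ENNReal.ofReal (4⁻¹ ^ k) := by
    rw [ENNReal.ofReal_pow (by norm_num), ENNReal.ofReal_inv_of_pos (by norm_num)]; simp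
  rw [e, e', ← ENNReal.ofReal_mul (by positivity), ← ENNReal.ofReal_mul (by positivity)]
  congr 1
  rw [finrank_euclideanSpace_fin, div_pow, inv_pow, ← pow_mul]
  have h4 : (2 : ℝ) ^ (k * n) = 2 ^ (k * (n - 2)) * 4 ^ k := by
    rw [show (4 : ℝ) = 2 ^ 2 by norm_num, ← pow_mul, ← pow_add]
    congr 1
    obtain ⟨d, rfl⟩ := Nat.exists_eq_add_of_le hn
    simp; ring
  rw [h4]
  field_simp

/-- Both integrals are compared with Σ μᵢ Tᵢ, where Tᵢ is the coarse mass at zᵢ with radius factor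
2A. It dominates the coarse mass with factor A near zᵢ and is dominated by the one with factor 3A,
so only the volumes of the two balls around zᵢ remain, and their ratio after scaling is 4^{-(k-j)}.
-/
theorem lintegral_dyadicMass_mul_rpow_le (hn : 2 ≤ n) {A s : ℝ} (hA : 0 < A) (hs : 0 ≤ s)
    {j k : ℕ} (hjk : j ≤ k) :
    ∫⁻ x, dyadicMass μ z A k x * dyadicMass μ z A j x ^ s ≤
      4⁻¹ ^ (k - j) * ∫⁻ x, dyadicMass μ z (3 * A) j x ^ (s + 1) := by
  set T : ι → ℝ≥0∞ := fun i => (2 ^ (j * (n - 2)) * ballMass μ z (2 * A / 2 ^ j) (z i)) ^ s with hT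
  set V := volume (ball (0 : 𝔼[n]) A) with hV
  have hle : A / 2 ^ k ≤ A / 2 ^ j := by gcongr; norm_num
  have upper : ∫⁻ x, dyadicMass μ z A k x * dyadicMass μ z A j x ^ s ≤
      4⁻¹ ^ k * V * ∑ i, μ i * T i := by
    simp_rw [show ∀ x, dyadicMass μ z A k x = 2 ^ (k * (n - 2)) * ballMass μ z (A / 2 ^ k) x from
      fun _ => rfl, mul_assoc]
    rw [lintegral_const_mul _ (by fun_prop), lintegral_ballMass_mul _ _ _ (by fun_prop),
      Finset.mul_sum, Finset.mul_sum, Finset.mul_sum]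
    refine Finset.sum_le_sum fun i _ => ?_
    have : ∫⁻ x in ball (z i) (A / 2 ^ k), dyadicMass μ z A j x ^ s ≤
        volume (ball (z i) (A / 2 ^ k)) * T i := by
      rw [mul_comm, ← setLIntegral_const]
      refine setLIntegral_mono measurable_const fun x hx => ?_
      simp only [hT, dyadicMass]
      gcongr
      refine ballMass_le_of_dist μ z (mem_ball.1 hx).le ?_
      have : 2 * A / 2 ^ j = A / 2 ^ j + A / 2 ^ j := by ring
      linarith
    calc _ ≤ 2 ^ (k * (n - 2)) * (μ i * (volume (ball (z i) (A / 2 ^ k)) * T i)) := by gcongr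
      _ = (2 ^ (k * (n - 2)) * volume (ball (z i) (A / 2 ^ k))) * (μ i * T i) := by ring
      _ = _ := by rw [two_pow_mul_volume_ball hn hA]; ring
  have lower : 4⁻¹ ^ j * V * ∑ i, μ i * T i ≤ ∫⁻ x, dyadicMass μ z (3 * A) j x ^ (s + 1) := by
    calc 4⁻¹ ^ j * V * ∑ i, μ i * T i
        ≤ ∫⁻ x, dyadicMass μ z A j x * dyadicMass μ z (3 * A) j x ^ s := by
          simp_rw [show ∀ x, dyadicMass μ z A j x = 2 ^ (j * (n - 2)) * ballMass μ z (A / 2 ^ j) x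
            from fun _ => rfl, mul_assoc]
          rw [lintegral_const_mul _ (by fun_prop), lintegral_ballMass_mul _ _ _ (by fun_prop),
            Finset.mul_sum, Finset.mul_sum, Finset.mul_sum]
          refine Finset.sum_le_sum fun i _ => ?_
          have : volume (ball (z i) (A / 2 ^ j)) * T i ≤
              ∫⁻ x in ball (z i) (A / 2 ^ j), dyadicMass μ z (3 * A) j x ^ s := by
            rw [mul_comm, ← setLIntegral_const]
            refine setLIntegral_mono (by fun_prop) fun x hx => ?_
            simp only [hT, dyadicMass]
            gcongr
            refine ballMass_le_of_dist μ z (t := A / 2 ^ j) ?_ ?_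
            · rw [dist_comm]; exact (mem_ball.1 hx).le
            · apply le_of_eq; ring
          calc 4⁻¹ ^ j * (V * (μ i * T i))
              = (2 ^ (j * (n - 2)) * volume (ball (z i) (A / 2 ^ j))) * (μ i * T i) := by
                rw [two_pow_mul_volume_ball hn hA]; ring
            _ = 2 ^ (j * (n - 2)) * (μ i * (volume (ball (z i) (A / 2 ^ j)) * T i)) := by ring
            _ ≤ _ := by gcongr
      _ ≤ _ := by
          refine lintegral_mono fun x => ?_
          rw [ENNReal.rpow_add_of_nonneg _ _ hs zero_le_one, ENNReal.rpow_one, mul_comm]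
          gcongr
          unfold dyadicMass
          gcongr
          refine ballMass_le_of_dist μ z (t := 0) (by simp) ?_
          rw [add_zero]
          gcongr
          linarith
  calc _ ≤ 4⁻¹ ^ k * V * ∑ i, μ i * T i := upper
    _ = 4⁻¹ ^ (k - j) * (4⁻¹ ^ j * V * ∑ i, μ i * T i) := by
      rw [← mul_assoc, ← mul_assoc, ← pow_add, Nat.sub_add_cancel hjk]
    _ ≤ _ := by gcongr

/-- Enlarging the radius changes the energy at each scale by a bounded factor. -/
theorem exists_lintegral_dyadicMass_rpow_le (n : ℕ) {A : ℝ} (hA : 0 < A) (A' : ℝ) {q : ℝ}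
    (hq : 1 ≤ q) :
    ∃ C : ℝ≥0, ∀ {ι : Type} [Fintype ι] (μ : ι → ℝ≥0∞) (z : ι → 𝔼[n]) (j : ℕ),
      ∫⁻ x, dyadicMass μ z A' j x ^ q ≤ C * ∫⁻ x, dyadicMass μ z A j x ^ q := by
  -- One covering of the ball of radius A' by balls of radius A serves all scales after dilation, so
  -- the constant does not depend on j; translation invariance then makes all the terms equal.
  obtain ⟨t, -, htf, ht⟩ := (isCompact_closedBall (0 : 𝔼[n]) A').finite_cover_balls hA
  lift t to Finset 𝔼[n] using htf
  refine ⟨(t.card : ℝ≥0) ^ (q - 1) * t.card, fun {ι} _ μ z j => ?_⟩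
  have key : ∀ x, dyadicMass μ z A' j x ≤
      ∑ y ∈ t, dyadicMass μ z A j (x + (1 / 2 ^ j : ℝ) • y) := by
    intro x
    unfold dyadicMass ballMass
    rw [← Finset.mul_sum, Finset.sum_comm]
    gcongr with i
    by_cases hx : x ∈ ball (z i) (A' / 2 ^ j)
    · have hm : (2 ^ j : ℝ) • (z i - x) ∈ closedBall (0 : 𝔼[n]) A' := by
        rw [mem_closedBall_zero_iff, norm_smul, ← dist_eq_norm, dist_comm]
        rw [mem_ball, lt_div_iff₀ (by positivity)] at hx
        simp; linarith
      obtain ⟨y, hy, hyA⟩ := Set.mem_iUnion₂.1 (ht hm)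
      have hmem : x + (1 / 2 ^ j : ℝ) • y ∈ ball (z i) (A / 2 ^ j) := by
        rw [mem_ball, dist_comm, dist_eq_norm] at hyA ⊢
        rw [lt_div_iff₀ (by positivity)]
        have : y - (2 ^ j : ℝ) • (z i - x) = -((2 ^ j : ℝ) • (z i - (x + (1 / 2 ^ j : ℝ) • y))) := by
          rw [← smul_neg, smul_sub, smul_neg, smul_sub, smul_add, smul_smul]
          field_simp
          rw [one_smul]; abel
        rw [this, norm_neg, norm_smul] at hyA
        simpa [mul_comm] using hyA
      rw [Set.indicator_of_mem hx]
      refine le_trans (le_of_eq ?_) (Finset.single_le_sum (fun _ _ => zero_le) hy)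
      rw [Set.indicator_of_mem hmem]
    · simp [hx]
  calc ∫⁻ x, dyadicMass μ z A' j x ^ q
      ≤ ∫⁻ x, (t.card : ℝ≥0∞) ^ (q - 1) *
          ∑ y ∈ t, dyadicMass μ z A j (x + (1 / 2 ^ j : ℝ) • y) ^ q := by
        refine lintegral_mono fun x => ?_
        refine le_trans (ENNReal.rpow_le_rpow (key x) (by linarith)) ?_
        exact ENNReal.rpow_sum_le_const_mul_sum_rpow _ _ hq
    _ = (t.card : ℝ≥0∞) ^ (q - 1) * (t.card * ∫⁻ x, dyadicMass μ z A j x ^ q) := by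
        rw [lintegral_const_mul _ (by fun_prop), lintegral_finsetSum _ fun y _ => by fun_prop]
        congr 1
        rw [Finset.sum_congr rfl fun y _ => lintegral_add_right_eq_self
          (fun x => dyadicMass μ z A j x ^ q) _]
        simp
    _ = _ := by
        rw [ENNReal.coe_mul, ENNReal.coe_rpow_of_nonneg _ (by linarith)]
        push_cast
        ring

/-- **Wolff's inequality**, in two dual forms. -/
theorem exists_wolff (hn : 2 ≤ n) {A A₀ p q : ℝ} (hA : 0 < A) (hA₀ : 0 < A₀)
    (hpq : p.HolderConjugate q) :
    ∃ C : ℝ≥0, ∀ {ι : Type} [Fintype ι] (μ : ι → ℝ≥0∞) (z : ι → 𝔼[n]) (N : ℕ), (∀ i, μ i ≠ ⊤) →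
      ∫⁻ x, (∑ k ∈ Finset.range N, dyadicMass μ z A k x) ^ q ≤
        C * ∑ k ∈ Finset.range N, ∫⁻ x, dyadicMass μ z A₀ k x ^ q ∧
      ∫⁻ x, (∑ k ∈ Finset.range N, dyadicMass μ z A k x ^ (q - 1)) ^ p ≤
        C * ∑ k ∈ Finset.range N, ∫⁻ x, dyadicMass μ z A₀ k x ^ q := by
  obtain ⟨C₁, hC₁⟩ := ENNReal.exists_sum_rpow_le hpq.symm.lt
  obtain ⟨C₂, hC₂⟩ := ENNReal.exists_sum_rpow_le hpq.lt
  obtain ⟨C₃, hC₃⟩ := exists_lintegral_dyadicMass_rpow_le n hA₀ (3 * A) hpq.symm.lt.le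
  have hq0 : 0 < q - 1 := by linarith [hpq.symm.lt]
  have h24 : ∀ m : ℕ, (2 : ℝ≥0∞) ^ m * 4⁻¹ ^ m = 2⁻¹ ^ m := by
    intro m
    rw [← mul_pow]
    congr 1
    rw [show (4 : ℝ≥0∞) = 2 * 2 by norm_num, ENNReal.mul_inv (by simp) (by simp), ← mul_assoc,
      ENNReal.mul_inv_cancel (by simp) (by simp), one_mul]
  refine ⟨max C₁ C₂ * (2 * C₃), fun {ι} _ μ z N hμ => ?_⟩
  set R : ℕ → ℝ≥0∞ := fun j => ∫⁻ x, dyadicMass μ z (3 * A) j x ^ q with hR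
  have hR3 : ∀ j, R j ≤ C₃ * ∫⁻ x, dyadicMass μ z A₀ j x ^ q := fun j => hC₃ μ z j
  -- The decay 4^{-(k-j)} of the interaction between scales beats the weight 2^{k-j} and leaves a
  -- summable factor.
  have cross : ∀ {j k : ℕ}, j ≤ k →
      2 ^ (k - j) * ∫⁻ x, dyadicMass μ z A k x * dyadicMass μ z A j x ^ (q - 1) ≤
        2⁻¹ ^ (k - j) * R j := by
    intro j k hjk
    have := lintegral_dyadicMass_mul_rpow_le μ z hn hA hq0.le hjk
    rw [sub_add_cancel] at this
    rw [← h24, mul_assoc]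
    gcongr
  have fin : ∀ C : ℝ≥0, C ≤ max C₁ C₂ → ∀ S : ℝ≥0∞, S ≤ 2 * ∑ j ∈ Finset.range N, R j →
      C * S ≤ ((max C₁ C₂ * (2 * C₃) : ℝ≥0) : ℝ≥0∞) *
        ∑ k ∈ Finset.range N, ∫⁻ x, dyadicMass μ z A₀ k x ^ q := by
    intro C hC S hS
    rw [ENNReal.coe_mul, mul_assoc]
    refine mul_le_mul' (by exact_mod_cast hC) (hS.trans ?_)
    rw [ENNReal.coe_mul, mul_assoc, Finset.mul_sum (a := (C₃ : ℝ≥0∞))]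
    push_cast
    gcongr with j
    exact hR3 j
  constructor
  · refine le_trans ?_ (fin C₁ (le_max_left _ _) (∑ k ∈ Finset.range N,
      ∑ j ∈ Finset.range N with j ≤ k, 2 ^ (k - j) *
        ∫⁻ x, dyadicMass μ z A k x * dyadicMass μ z A j x ^ (q - 1)) ?_)
    · calc _ ≤ ∫⁻ x, C₁ * ∑ k ∈ Finset.range N, ∑ j ∈ Finset.range N with j ≤ k,
            2 ^ (k - j) * (dyadicMass μ z A k x * dyadicMass μ z A j x ^ (q - 1)) :=
          lintegral_mono fun x => (hC₁ _ _ fun k => dyadicMass_ne_top z hμ A k x).1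
        _ = _ := by
          rw [lintegral_const_mul _ (by fun_prop), lintegral_finsetSum _ fun y _ => by fun_prop]
          congr 1
          refine Finset.sum_congr rfl fun k _ => ?_
          rw [lintegral_finsetSum _ fun y _ => by fun_prop]
          exact Finset.sum_congr rfl fun j _ => lintegral_const_mul _ (by fun_prop)
    · calc _ ≤ ∑ k ∈ Finset.range N, ∑ j ∈ Finset.range N with j ≤ k, 2⁻¹ ^ (k - j) * R j := by
            refine Finset.sum_le_sum fun k _ => Finset.sum_le_sum fun j hj => ?_
            exact cross (Finset.mem_filter.1 hj).2
        _ = ∑ j ∈ Finset.range N, ∑ k ∈ Finset.range N with j ≤ k, 2⁻¹ ^ (k - j) * R j := by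
            rw [Finset.sum_comm']
            simp only [Finset.mem_filter]
            tauto
        _ ≤ ∑ j ∈ Finset.range N, 2 * R j := by
            refine Finset.sum_le_sum fun j _ => ?_
            rw [← Finset.sum_mul]
            gcongr
            refine ENNReal.sum_inv_two_pow_le _ (fun k => k - j) ?_
            intro a ha b hb hab
            simp at ha hb hab
            omega
        _ = _ := by rw [Finset.mul_sum]
  -- Conjugacy enters as (q-1)(p-1) = 1, so that raising the dual sequence to the p-1 gives back the
  -- mass itself, to the first power.
  · have e : ∀ k x, (dyadicMass μ z A k x ^ (q - 1)) ^ (p - 1) = dyadicMass μ z A k x := by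
      intro k x
      rw [← ENNReal.rpow_mul, show (q - 1) * (p - 1) = 1 by linarith [hpq.mul_eq_add],
        ENNReal.rpow_one]
    refine le_trans ?_ (fin C₂ (le_max_right _ _) (∑ k ∈ Finset.range N,
      ∑ j ∈ Finset.range N with k ≤ j, 2 ^ (j - k) *
        ∫⁻ x, dyadicMass μ z A j x * dyadicMass μ z A k x ^ (q - 1)) ?_)
    · calc _ ≤ ∫⁻ x, C₂ * ∑ k ∈ Finset.range N, ∑ j ∈ Finset.range N with k ≤ j,
            2 ^ (j - k) * (dyadicMass μ z A j x * dyadicMass μ z A k x ^ (q - 1)) := by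
            refine lintegral_mono fun x => ?_
            have := (hC₂ (Finset.range N) (fun k => dyadicMass μ z A k x ^ (q - 1)) fun k =>
              ENNReal.rpow_ne_top_of_nonneg hq0.le (dyadicMass_ne_top z hμ A k x)).2
            simp only [e] at this
            simpa only [mul_comm (dyadicMass μ z A _ x)] using this
        _ = _ := by
          rw [lintegral_const_mul _ (by fun_prop), lintegral_finsetSum _ fun y _ => by fun_prop]
          congr 1
          refine Finset.sum_congr rfl fun k _ => ?_
          rw [lintegral_finsetSum _ fun y _ => by fun_prop]
          exact Finset.sum_congr rfl fun j _ => lintegral_const_mul _ (by fun_prop)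
    · calc _ ≤ ∑ k ∈ Finset.range N, ∑ j ∈ Finset.range N with k ≤ j, 2⁻¹ ^ (j - k) * R k := by
            refine Finset.sum_le_sum fun k _ => Finset.sum_le_sum fun j hj => ?_
            exact cross (Finset.mem_filter.1 hj).2
        _ ≤ ∑ j ∈ Finset.range N, 2 * R j := by
            refine Finset.sum_le_sum fun j _ => ?_
            rw [← Finset.sum_mul]
            gcongr
            refine ENNReal.sum_inv_two_pow_le _ (fun k => k - j) ?_
            intro a ha b hb hab
            simp at ha hb hab
            omega
        _ = _ := by rw [Finset.mul_sum]

end Wolff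

/-! ### Minimisation of the dyadic energy over probability weights. -/

section Equilibrium

variable {X : Type*} [MeasurableSpace X] {ν : Measure X} [IsFiniteMeasure ν]

theorem integrable_of_nonneg_of_le {f : X → ℝ} (hf : Measurable f) (h0 : ∀ x, 0 ≤ f x) {B : ℝ}
    (hB : ∀ x, f x ≤ B) : Integrable f ν :=
  Integrable.of_bound hf.aestronglyMeasurable B (Filter.Eventually.of_forall fun x => by
    rw [Real.norm_eq_abs, abs_of_nonneg (h0 x)]; exact hB x)

/-- Differentiation under the integral sign. The base may be negative for some t, but for s > 1 the
function `Real.rpow` is still differentiable there and is bounded by the power of the absolute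
value, so the derivative is two-sided. -/
theorem hasDerivAt_integral_rpow_add_mul {f g : X → ℝ} (hf : Measurable f) (hg : Measurable g)
    {B s : ℝ} (hs : 1 < s) (hfB : ∀ x, |f x| ≤ B) (hgB : ∀ x, |g x| ≤ B) :
    HasDerivAt (fun t => ∫ x, (f x + t * g x) ^ s ∂ν) (∫ x, s * f x ^ (s - 1) * g x ∂ν) 0 := by
  have key : ∀ t ∈ ball (0 : ℝ) 1, ∀ x, |f x + t * g x| ≤ 2 * B := by
    intro t ht x
    rw [mem_ball_zero_iff, Real.norm_eq_abs] at ht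
    calc |f x + t * g x| ≤ |f x| + |t * g x| := abs_add_le _ _
      _ ≤ B + 1 * B := by
        rw [abs_mul]
        have := hfB x
        have := hgB x
        gcongr
      _ = 2 * B := by ring
  have h := hasDerivAt_integral_of_dominated_loc_of_deriv_le (μ := ν)
    (F := fun t x => (f x + t * g x) ^ s) (F' := fun t x => s * (f x + t * g x) ^ (s - 1) * g x)
    (x₀ := 0) (s := ball 0 1) (bound := fun _ => s * (2 * B) ^ (s - 1) * B)
    (ball_mem_nhds 0 one_pos)
    (Filter.Eventually.of_forall fun t => by
      have : Measurable fun x => (f x + t * g x) ^ s := by fun_prop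
      exact this.aestronglyMeasurable)
    (by
      refine Integrable.of_bound ?_ ((2 * B) ^ s) (Filter.Eventually.of_forall fun x => ?_)
      · have : Measurable fun x => (f x + 0 * g x) ^ s := by fun_prop
        exact this.aestronglyMeasurable
      · rw [Real.norm_eq_abs]
        refine (Real.abs_rpow_le_abs_rpow _ _).trans ?_
        exact Real.rpow_le_rpow (abs_nonneg _) (key 0 (by simp) x) (by linarith))
    (by
      have : Measurable fun x => s * (f x + 0 * g x) ^ (s - 1) * g x := by fun_prop
      exact this.aestronglyMeasurable)
    (Filter.Eventually.of_forall fun x t ht => by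
      rw [Real.norm_eq_abs, abs_mul, abs_mul, abs_of_pos (by linarith : (0 : ℝ) < s)]
      have h1 : |(f x + t * g x) ^ (s - 1)| ≤ (2 * B) ^ (s - 1) :=
        (Real.abs_rpow_le_abs_rpow _ _).trans
          (Real.rpow_le_rpow (abs_nonneg _) (key t ht x) (by linarith))
      have h2 := hgB x
      have : 0 ≤ s := by linarith
      have hB : 0 ≤ B := (abs_nonneg _).trans h2
      gcongr)
    (integrable_const _)
    (Filter.Eventually.of_forall fun x t _ => by
      have h1 : HasDerivAt (fun t => f x + t * g x) (g x) t := by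
        simpa using ((hasDerivAt_id t).mul_const (g x)).const_add (f x)
      have := (Real.hasDerivAt_rpow_const (x := f x + t * g x) (p := s) (Or.inr hs.le)).comp t h1
      exact this)
  simpa using h.2

/-- The equilibrium weights of a finite family of bounded kernels. -/
theorem exists_equilibrium {ι κ : Type*} [Fintype ι] [Nonempty ι] [Fintype κ]
    {h : κ → ι → X → ℝ} (hm : ∀ k i, Measurable (h k i)) (h0 : ∀ k i x, 0 ≤ h k i x) {B : ℝ}
    (hB : ∀ k i x, h k i x ≤ B) (hpos : ∀ i, ∃ k, 0 < ∫ x, h k i x ∂ν) {s : ℝ} (hs : 1 < s) :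
    ∃ μ : ι → ℝ, (∀ i, 0 ≤ μ i) ∧
      (∀ i, 1 ≤ ∑ k, ∫ x, (∑ j, μ j * h k j x) ^ (s - 1) * h k i x ∂ν) ∧
      ∑ k, ∫ x, (∑ j, μ j * h k j x) ^ s ∂ν = ∑ i, μ i := by
  classical
  set F : (ι → ℝ) → κ → X → ℝ := fun μ k x => ∑ j, μ j * h k j x with hF
  set I : (ι → ℝ) → ℝ := fun μ => ∑ k, ∫ x, F μ k x ^ s ∂ν with hI
  have hFm : ∀ μ k, Measurable (F μ k) := fun μ k =>
    Finset.measurable_fun_sum _ fun j _ => (hm k j).const_mul _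
  have hF0 : ∀ μ ∈ stdSimplex ℝ ι, ∀ k x, 0 ≤ F μ k x := fun μ hμ k x =>
    Finset.sum_nonneg fun j _ => mul_nonneg (hμ.1 j) (h0 k j x)
  have hFB : ∀ μ ∈ stdSimplex ℝ ι, ∀ k x, F μ k x ≤ B := fun μ hμ k x => by
    calc F μ k x ≤ ∑ j, μ j * B := by
          refine Finset.sum_le_sum fun j _ => ?_
          exact mul_le_mul_of_nonneg_left (hB k j x) (hμ.1 j)
      _ = B := by rw [← Finset.sum_mul, hμ.2, one_mul]
  have hcont : ContinuousOn I (stdSimplex ℝ ι) := by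
    refine continuousOn_finsetSum _ fun k _ => ?_
    refine continuousOn_of_dominated (bound := fun _ => B ^ s) (fun μ _ => ?_) (fun μ hμ => ?_)
      (integrable_const _) (Filter.Eventually.of_forall fun x => ?_)
    · exact ((hFm μ k).pow_const s).aestronglyMeasurable
    · refine Filter.Eventually.of_forall fun x => ?_
      rw [Real.norm_eq_abs, abs_of_nonneg (Real.rpow_nonneg (hF0 μ hμ k x) _)]
      exact Real.rpow_le_rpow (hF0 μ hμ k x) (hFB μ hμ k x) (by linarith)
    · refine Continuous.continuousOn ?_
      have : Continuous fun μ : ι → ℝ => F μ k x := by simp only [hF]; fun_prop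
      exact this.rpow_const fun _ => Or.inr (by linarith)
  obtain ⟨m, hm1, hmin⟩ := (isCompact_stdSimplex ℝ ι).exists_isMinOn
    ⟨_, single_mem_stdSimplex ℝ (Classical.arbitrary ι)⟩ hcont
  have hInt : ∀ k, Integrable (fun x => F m k x ^ s) ν := fun k =>
    integrable_of_nonneg_of_le ((hFm m k).pow_const s)
      (fun x => Real.rpow_nonneg (hF0 m hm1 k x) _)
      (fun x => Real.rpow_le_rpow (hF0 m hm1 k x) (hFB m hm1 k x) (by linarith))
  -- A zero minimum would force the kernel of some atom of positive weight to vanish almost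
  -- everywhere at every k. Positivity is what permits the rescaling at the end.
  have hIpos : 0 < I m := by
    obtain ⟨i, hi⟩ : ∃ i, 0 < m i := by
      by_contra! hcon
      have : ∑ i, m i ≤ 0 := Finset.sum_nonpos fun i _ => hcon i
      linarith [hm1.2]
    obtain ⟨k, hk⟩ := hpos i
    have hnn : ∀ k, 0 ≤ ∫ x, F m k x ^ s ∂ν := fun k =>
      integral_nonneg fun x => Real.rpow_nonneg (hF0 m hm1 k x) _
    refine lt_of_lt_of_le ?_ (Finset.single_le_sum (fun k _ => hnn k) (Finset.mem_univ k))
    refine lt_of_le_of_ne (hnn k) fun heq => ?_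
    have hz := (integral_eq_zero_iff_of_nonneg
      (fun x => Real.rpow_nonneg (hF0 m hm1 k x) _) (hInt k)).1 heq.symm
    have : ∫ x, h k i x ∂ν = 0 := by
      refine integral_eq_zero_of_ae ?_
      filter_upwards [hz] with x hx
      have hx0 : F m k x = 0 :=
        ((Real.rpow_eq_zero_iff_of_nonneg (hF0 m hm1 k x)).1 hx).1
      have h1 : m i * h k i x ≤ F m k x :=
        Finset.single_le_sum (f := fun j => m j * h k j x)
          (fun j _ => mul_nonneg (hm1.1 j) (h0 k j x)) (Finset.mem_univ i)
      have h2 : m i * h k i x = 0 :=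
        le_antisymm (hx0 ▸ h1) (mul_nonneg hi.le (h0 k i x))
      exact (mul_eq_zero.1 h2).resolve_left hi.ne'
    linarith
  have hvar : ∀ i, I m ≤ ∑ k, ∫ x, F m k x ^ (s - 1) * h k i x ∂ν := by
    intro i
    -- The variation moves the minimiser towards the vertex i of the simplex. Only t > 0 stays
    -- admissible, so minimality gives a one-sided inequality.
    set g : κ → X → ℝ := fun k x => h k i x - F m k x with hg
    have hgB : ∀ k x, |g k x| ≤ B := fun k x => by
      rw [abs_le]
      constructor <;> simp only [hg] <;>
        linarith [h0 k i x, hB k i x, hF0 m hm1 k x, hFB m hm1 k x]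
    have hD : HasDerivAt (fun t => ∑ k, ∫ x, (F m k x + t * g k x) ^ s ∂ν)
        (∑ k, ∫ x, s * F m k x ^ (s - 1) * g k x ∂ν) 0 := by
      refine HasDerivAt.fun_sum fun k _ => ?_
      refine hasDerivAt_integral_rpow_add_mul (hFm m k) ((hm k i).sub (hFm m k)) hs
        (fun x => ?_) (hgB k)
      rw [abs_of_nonneg (hF0 m hm1 k x)]; exact hFB m hm1 k x
    have hge : 0 ≤ ∑ k, ∫ x, s * F m k x ^ (s - 1) * g k x ∂ν := by
      have ht := (hasDerivWithinAt_iff_tendsto_slope' (s := Set.Ioi (0 : ℝ))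
        (by simp)).1 (hD.hasDerivWithinAt)
      refine ge_of_tendsto ht ?_
      filter_upwards [Ioo_mem_nhdsGT (zero_lt_one (α := ℝ))] with t ht
      rw [slope_def_field]
      refine div_nonneg (sub_nonneg.2 ?_) (by linarith [ht.1])
      have hmem : (1 - t) • m + t • Pi.single i 1 ∈ stdSimplex ℝ ι :=
        convex_stdSimplex ℝ ι hm1 (single_mem_stdSimplex ℝ i) (by linarith [ht.2]) ht.1.le
          (by ring)
      have e : ∀ k x, F ((1 - t) • m + t • Pi.single i 1) k x = F m k x + t * g k x := by
        intro k x
        simp only [hF, hg, Pi.add_apply, Pi.smul_apply, smul_eq_mul, add_mul, mul_assoc,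
          Finset.sum_add_distrib, ← Finset.mul_sum]
        simp [Pi.single_apply]
        ring
      have := hmin hmem
      simp only [Set.mem_ofPred_eq, hI, e] at this
      simpa using this
    have hI1 : ∀ k, Integrable (fun x => F m k x ^ (s - 1) * h k i x) ν := fun k =>
      integrable_of_nonneg_of_le (B := B ^ (s - 1) * B) (((hFm m k).pow_const _).mul (hm k i))
        (fun x => mul_nonneg (Real.rpow_nonneg (hF0 m hm1 k x) _) (h0 k i x)) (fun x => by
          have := hF0 m hm1 k x
          exact mul_le_mul (Real.rpow_le_rpow this (hFB m hm1 k x) (by linarith)) (hB k i x)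
            (h0 k i x) (Real.rpow_nonneg (this.trans (hFB m hm1 k x)) _))
    have e2 : ∀ k, ∫ x, s * F m k x ^ (s - 1) * g k x ∂ν =
        s * (∫ x, F m k x ^ (s - 1) * h k i x ∂ν - ∫ x, F m k x ^ s ∂ν) := by
      intro k
      rw [← integral_sub (hI1 k) (hInt k), ← integral_const_mul]
      refine integral_congr_ae (Filter.Eventually.of_forall fun x => ?_)
      have : F m k x ^ s = F m k x ^ (s - 1) * F m k x := by
        rw [← Real.rpow_add_one' (hF0 m hm1 k x) (by linarith), sub_add_cancel]
      simp only [hg, this]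
      ring
    simp_rw [e2, ← Finset.mul_sum, Finset.sum_sub_distrib] at hge
    have := nonneg_of_mul_nonneg_right hge (by linarith)
    simp only [hI]
    linarith
  -- The dilation for which a^{s-1} I(m) = 1: the variational inequalities then have lower bound 1,
  -- and the energy a^s I(m) equals the new total mass a.
  set a : ℝ := I m ^ (-(1 / (s - 1))) with ha
  have ha0 : 0 < a := Real.rpow_pos_of_pos hIpos _
  have has : a ^ (s - 1) * I m = 1 := by
    rw [ha, ← Real.rpow_mul hIpos.le, ← Real.rpow_add_one hIpos.ne',
      show -(1 / (s - 1)) * (s - 1) + 1 = 0 by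
        have : s - 1 ≠ 0 := by linarith
        field_simp; ring, Real.rpow_zero]
  have e : ∀ k x, ∑ j, (a • m) j * h k j x = a * F m k x := by
    intro k x
    simp [hF, Finset.mul_sum, mul_assoc]
  refine ⟨a • m, fun i => mul_nonneg ha0.le (hm1.1 i), fun i => ?_, ?_⟩
  · simp_rw [e]
    have : ∀ k, ∫ x, (a * F m k x) ^ (s - 1) * h k i x ∂ν =
        a ^ (s - 1) * ∫ x, F m k x ^ (s - 1) * h k i x ∂ν := fun k => by
      rw [← integral_const_mul]
      refine integral_congr_ae (Filter.Eventually.of_forall fun x => ?_)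
      simp only [Real.mul_rpow ha0.le (hF0 m hm1 k x)]
      ring
    simp_rw [this, ← Finset.mul_sum]
    refine has.symm.le.trans ?_
    exact mul_le_mul_of_nonneg_left (hvar i) (Real.rpow_nonneg ha0.le _)
  · simp_rw [e]
    have : ∀ k, ∫ x, (a * F m k x) ^ s ∂ν = a ^ s * ∫ x, F m k x ^ s ∂ν := fun k => by
      rw [← integral_const_mul]
      refine integral_congr_ae (Filter.Eventually.of_forall fun x => ?_)
      simp only [Real.mul_rpow ha0.le (hF0 m hm1 k x)]
    simp_rw [this, ← Finset.mul_sum]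
    have h2 : ∑ i, (a • m) i = a := by
      simp [← Finset.mul_sum, hm1.2]
    rw [h2]
    change a ^ s * I m = a
    rw [show s = (s - 1) + 1 by ring, Real.rpow_add_one ha0.ne', mul_right_comm, has, one_mul]

end Equilibrium

/-! ### The regularised fundamental solution and dyadic lower bounds. -/

section RegularizedKernel

variable {n : ℕ}

local notation "𝔼[" n "]" => EuclideanSpace ℝ (Fin n)

theorem fderiv_norm_sub_sq (c x v : 𝔼[n]) :
    fderiv ℝ (fun y => ‖y - c‖ ^ 2) x v = 2 * inner ℝ (x - c) v := by
  have h : HasFDerivAt (fun y : 𝔼[n] => y - c) (ContinuousLinearMap.id ℝ _) x :=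
    (hasFDerivAt_id x).sub_const c
  rw [h.norm_sq.fderiv]
  simp [inner_sub_left]

theorem norm_fderiv_norm_sub_sq (c x : 𝔼[n]) :
    ‖fderiv ℝ (fun y => ‖y - c‖ ^ 2) x‖ = 2 * ‖x - c‖ := by
  have : fderiv ℝ (fun y => ‖y - c‖ ^ 2) x = (2 : ℝ) • innerSL ℝ (x - c) := by
    ext v; rw [fderiv_norm_sub_sq]; simp [inner_sub_left]
  rw [this, norm_smul, innerSL_apply_norm]; simp

theorem laplacian_norm_sub_sq (c x : 𝔼[n]) :
    Laplacian.laplacian (fun y => ‖y - c‖ ^ 2) x = 2 * n := by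
  have : fderiv ℝ (fun y : 𝔼[n] => ‖y - c‖ ^ 2) = fun y => (2 : ℝ) • innerSL ℝ (y - c) := by
    ext y v; rw [fderiv_norm_sub_sq]; simp [inner_sub_left]
  rw [laplacian_eq_sum_secondPartial]
  have h2 : ∀ i : Fin n, secondPartial (fun y => ‖y - c‖ ^ 2) i i x = 2 := by
    intro i
    have hd : HasFDerivAt (fun y : 𝔼[n] => (2 : ℝ) • innerSL ℝ (y - c)) ((2 : ℝ) • innerSL ℝ) x :=
      by
        have h1 : HasFDerivAt (fun y : 𝔼[n] => y - c) (ContinuousLinearMap.id ℝ _) x :=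
          (hasFDerivAt_id x).sub_const c
        have h3 := ((innerSL ℝ (E := 𝔼[n])).hasFDerivAt (x := x - c)).comp x h1
        exact h3.const_smul (2 : ℝ)
    rw [secondPartial_eq_fderiv, this, hd.fderiv]
    have : inner ℝ (EuclideanSpace.single i (1 : ℝ)) (EuclideanSpace.single i (1 : ℝ)) = (1 : ℝ) := by
      simp
    change (2 : ℝ) * inner ℝ (EuclideanSpace.single i (1 : ℝ)) (EuclideanSpace.single i (1 : ℝ)) = 2
    rw [this, mul_one]
  simp [h2, mul_comm]

/-- The regularized fundamental solution `(ε² + |x - c|²)^{-(n-2)/2}`. -/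
noncomputable def regKernel (ε : ℝ) (c x : 𝔼[n]) : ℝ :=
  (ε ^ 2 + ‖x - c‖ ^ 2) ^ (-(((n : ℝ) - 2) / 2))

theorem regKernel_base_pos {ε : ℝ} (hε : ε ≠ 0) (c x : 𝔼[n]) : 0 < ε ^ 2 + ‖x - c‖ ^ 2 := by
  positivity

theorem regKernel_pos {ε : ℝ} (hε : ε ≠ 0) (c x : 𝔼[n]) : 0 < regKernel ε c x :=
  Real.rpow_pos_of_pos (regKernel_base_pos hε c x) _

theorem contDiff_norm_sub_sq (c : 𝔼[n]) {m : WithTop ℕ∞} : ContDiff ℝ m fun y => ‖y - c‖ ^ 2 :=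
  (contDiff_id.sub contDiff_const).norm_sq ℝ

theorem contDiff_regKernel {ε : ℝ} (hε : ε ≠ 0) (c : 𝔼[n]) {m : WithTop ℕ∞} :
    ContDiff ℝ m (regKernel ε c) :=
  (contDiff_const.add (contDiff_norm_sub_sq c)).rpow_const_of_ne
    fun x => (regKernel_base_pos hε c x).ne'

theorem regKernel_deriv {ε b t : ℝ} (ht : 0 < ε ^ 2 + t) :
    HasDerivAt (fun t => (ε ^ 2 + t) ^ b) (b * (ε ^ 2 + t) ^ (b - 1)) t := by
  have h1 : HasDerivAt (fun t => ε ^ 2 + t) 1 t := (hasDerivAt_id t).const_add _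
  have := h1.rpow_const (p := b) (Or.inl ht.ne')
  simpa using this

/-- The terms in |x - c|² combine with the base and only ε² survives. The formula has two uses: its
sign gives superharmonicity, and its size is that of an approximate identity. -/
theorem laplacian_regKernel {ε : ℝ} (hε : ε ≠ 0) (c x : 𝔼[n]) :
    Laplacian.laplacian (regKernel ε c) x =
      -(n * (n - 2) * ε ^ 2 * (ε ^ 2 + ‖x - c‖ ^ 2) ^ (-(((n : ℝ) + 2) / 2))) := by
  set a : ℝ := ((n : ℝ) - 2) / 2 with ha
  have hp := regKernel_base_pos hε c x
  have hev : ∀ᶠ t in nhds (‖x - c‖ ^ 2), 0 < ε ^ 2 + t :=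
    (continuous_const.add continuous_id).continuousAt.eventually (lt_mem_nhds hp)
  have h2 : HasDerivAt (fun t => -a * (ε ^ 2 + t) ^ (-a - 1))
      (-a * ((-a - 1) * (ε ^ 2 + ‖x - c‖ ^ 2) ^ (-a - 1 - 1))) (‖x - c‖ ^ 2) :=
    (regKernel_deriv hp).const_mul _
  have key := laplacian_comp (f := fun y : 𝔼[n] => ‖y - c‖ ^ 2) (x := x)
    (h := fun t => (ε ^ 2 + t) ^ (-a)) (contDiff_norm_sub_sq c).contDiffAt
    (hev.mono fun t ht => regKernel_deriv ht) h2
  change Laplacian.laplacian (fun y => (ε ^ 2 + ‖y - c‖ ^ 2) ^ (-a)) x = _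
  rw [key, laplacian_norm_sub_sq, norm_fderiv_norm_sub_sq]
  have e1 : -(((n : ℝ) + 2) / 2) = -a - 1 - 1 := by rw [ha]; ring
  have e2 : (ε ^ 2 + ‖x - c‖ ^ 2) ^ (-a - 1) =
      (ε ^ 2 + ‖x - c‖ ^ 2) ^ (-a - 1 - 1) * (ε ^ 2 + ‖x - c‖ ^ 2) := by
    rw [← Real.rpow_add_one hp.ne', sub_add_cancel]
  have e3 : (n : ℝ) = 2 * a + 2 := by rw [ha]; ring
  rw [e1, e2, e3]
  ring

theorem norm_fderiv_regKernel_sq {ε : ℝ} (hε : ε ≠ 0) (c x : 𝔼[n]) :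
    ‖fderiv ℝ (regKernel ε c) x‖ ^ 2 =
      ((n : ℝ) - 2) ^ 2 * ‖x - c‖ ^ 2 * (ε ^ 2 + ‖x - c‖ ^ 2) ^ (-(n : ℝ)) := by
  set a : ℝ := ((n : ℝ) - 2) / 2 with ha
  have hp := regKernel_base_pos hε c x
  have key := norm_fderiv_comp (f := fun y : 𝔼[n] => ‖y - c‖ ^ 2) (x := x)
    (h := fun t => (ε ^ 2 + t) ^ (-a)) (h₁ := fun t => -a * (ε ^ 2 + t) ^ (-a - 1))
    ((contDiff_norm_sub_sq c (m := 1)).differentiable (by simp) x) (regKernel_deriv hp)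
  change ‖fderiv ℝ (fun y => (ε ^ 2 + ‖y - c‖ ^ 2) ^ (-a)) x‖ ^ 2 = _
  rw [key, norm_fderiv_norm_sub_sq, mul_pow, sq_abs, mul_pow (-a), ← Real.rpow_mul_natCast hp.le,
    show (-a - 1) * ((2 : ℕ) : ℝ) = -n by rw [ha]; push_cast; ring]
  rw [ha]; ring

/-- Under y = x + εy' all powers of ε cancel, so the negative Laplacian of the kernel has mass
independent of ε. -/
theorem integral_regKernel_scaling {ε : ℝ} (hε : 0 < ε) (ψ : 𝔼[n] → ℝ) (x : 𝔼[n]) :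
    ∫ y, ε ^ 2 * (ε ^ 2 + ‖y - x‖ ^ 2) ^ (-(((n : ℝ) + 2) / 2)) * ψ y =
      ∫ y, (1 + ‖y‖ ^ 2) ^ (-(((n : ℝ) + 2) / 2)) * ψ (x + ε • y) := by
  rw [← integral_add_left_eq_self _ x]
  simp only [add_sub_cancel_left]
  have h := Measure.integral_comp_smul volume
    (fun y : 𝔼[n] => ε ^ 2 * (ε ^ 2 + ‖y‖ ^ 2) ^ (-(((n : ℝ) + 2) / 2)) * ψ (x + y)) ε
  rw [finrank_euclideanSpace_fin, abs_of_pos (by positivity), smul_eq_mul,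
    eq_inv_mul_iff_mul_eq₀ (by positivity)] at h
  rw [← h, ← integral_const_mul]
  refine integral_congr_ae (Filter.Eventually.of_forall fun y => ?_)
  simp only
  rw [norm_smul, Real.norm_eq_abs, abs_of_pos hε, mul_pow,
    show ε ^ 2 + ε ^ 2 * ‖y‖ ^ 2 = ε ^ 2 * (1 + ‖y‖ ^ 2) by ring,
    Real.mul_rpow (by positivity) (by positivity), ← Real.rpow_natCast_mul hε.le]
  have e : ε ^ n * (ε ^ 2 * ε ^ (((2 : ℕ) : ℝ) * -(((n : ℝ) + 2) / 2))) = 1 := by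
    rw [← mul_assoc, ← pow_add, ← Real.rpow_natCast, ← Real.rpow_add hε]
    push_cast
    rw [show (n : ℝ) + 2 + 2 * -(((n : ℝ) + 2) / 2) = 0 by ring, Real.rpow_zero]
  calc _ = (ε ^ n * (ε ^ 2 * ε ^ (((2 : ℕ) : ℝ) * -(((n : ℝ) + 2) / 2)))) *
        ((1 + ‖y‖ ^ 2) ^ (-(((n : ℝ) + 2) / 2)) * ψ (x + ε • y)) := by ring
    _ = _ := by rw [e, one_mul]

/-- The approximate identity generated by the regularized kernel. -/
theorem exists_pos_le_integral_regKernel (n : ℕ) :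
    ∃ c : ℝ, 0 < c ∧ ∀ ψ : 𝔼[n] → ℝ, ContDiff ℝ 1 ψ → HasCompactSupport ψ →
      ∃ ε₀ : ℝ, 0 < ε₀ ∧ ∀ ε, 0 < ε → ε ≤ ε₀ → ∀ x, 1 ≤ ψ x →
        c ≤ ∫ y, ε ^ 2 * (ε ^ 2 + ‖y - x‖ ^ 2) ^ (-(((n : ℝ) + 2) / 2)) * ψ y := by
  set κ : 𝔼[n] → ℝ := fun y => (1 + ‖y‖ ^ 2) ^ (-(((n : ℝ) + 2) / 2)) with hκ
  have hκp : ∀ y, 0 < κ y := fun y => Real.rpow_pos_of_pos (by positivity) _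
  have hκc : Continuous κ := by
    refine Continuous.rpow_const (by fun_prop) fun y => Or.inl (by positivity)
  have hκi : Integrable κ := by
    have := integrable_rpow_neg_one_add_norm_sq (E := 𝔼[n]) (μ := volume) (r := (n : ℝ) + 2)
      (by simp)
    exact this.congr (Filter.Eventually.of_forall fun y => by simp only [hκ, neg_div])
  -- A finite first moment is enough, since ψ is compared with its value at x only through its
  -- Lipschitz constant.
  have hκi' : Integrable fun y => κ y * ‖y‖ := by
    have := integrable_rpow_neg_one_add_norm_sq (E := 𝔼[n]) (μ := volume) (r := (n : ℝ) + 1)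
      (by simp)
    refine this.mono' (by fun_prop) (Filter.Eventually.of_forall fun y => ?_)
    have h1 : (0 : ℝ) < 1 + ‖y‖ ^ 2 := by positivity
    rw [Real.norm_eq_abs, abs_of_nonneg (mul_nonneg (hκp y).le (norm_nonneg y))]
    have h2 : ‖y‖ ≤ (1 + ‖y‖ ^ 2) ^ (1 / 2 : ℝ) := by
      rw [← Real.sqrt_eq_rpow]
      exact Real.le_sqrt_of_sq_le (by linarith)
    calc κ y * ‖y‖ ≤ κ y * (1 + ‖y‖ ^ 2) ^ (1 / 2 : ℝ) := by have := (hκp y).le; gcongr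
      _ = _ := by
        simp only [hκ]; rw [← Real.rpow_add h1]; congr 1; ring
  have hc0 : 0 < ∫ y, κ y := by
    rw [integral_pos_iff_support_of_nonneg (fun y => (hκp y).le) hκi]
    have : Function.support κ = Set.univ := by
      ext y; simp [(hκp y).ne']
    rw [this]
    exact isOpen_univ.measure_pos volume Set.univ_nonempty
  set c₀ := ∫ y, κ y with hc₀
  set c₁ := ∫ y, κ y * ‖y‖ with hc₁
  have hc1 : 0 ≤ c₁ := integral_nonneg fun y => mul_nonneg (hκp y).le (norm_nonneg y)
  refine ⟨c₀ / 2, by positivity, fun ψ hψ hψc => ?_⟩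
  obtain ⟨L, hL⟩ := hψ.lipschitzWith_of_hasCompactSupport hψc (by simp)
  obtain ⟨B, hB⟩ := hψ.continuous.bounded_above_of_compact_support hψc
  -- The Lipschitz error L ε c₁ is at most half of the total mass c₀. The threshold depends on ψ,
  -- but the resulting lower bound c₀/2 does not.
  refine ⟨c₀ / (2 * (L * c₁ + 1)), by positivity, fun ε hε hε' x hx => ?_⟩
  rw [integral_regKernel_scaling hε]
  have hlow : ∀ y, 1 - L * ε * ‖y‖ ≤ ψ (x + ε • y) := by
    intro y
    have := hL.dist_le_mul (x + ε • y) x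
    rw [Real.dist_eq, dist_eq_norm, add_sub_cancel_left, norm_smul, Real.norm_eq_abs,
      abs_of_pos hε] at this
    linarith [neg_le_of_abs_le this]
  have hI : Integrable fun y => κ y * ψ (x + ε • y) := by
    refine hκi.mul_bdd (c := B) ?_ (Filter.Eventually.of_forall fun y => hB _)
    have := hψ.continuous
    fun_prop
  have hI2 : Integrable fun y => κ y * (1 - L * ε * ‖y‖) := by
    have : (fun y => κ y * (1 - L * ε * ‖y‖)) = fun y => κ y - L * ε * (κ y * ‖y‖) := by
      ext y; ring
    rw [this]
    exact hκi.sub (hκi'.const_mul _)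
  calc c₀ / 2 ≤ c₀ - L * ε * c₁ := by
        rw [le_div_iff₀ (by positivity)] at hε'
        have : 0 ≤ L * c₁ := mul_nonneg L.coe_nonneg hc1
        nlinarith
    _ = ∫ y, κ y * (1 - L * ε * ‖y‖) := by
        have : (fun y => κ y * (1 - L * ε * ‖y‖)) = fun y => κ y - L * ε * (κ y * ‖y‖) := by
          ext y; ring
        rw [this, integral_sub hκi (hκi'.const_mul _), integral_const_mul]
    _ ≤ _ := integral_mono hI2 hI fun y => by
        have := (hκp y).le
        have := hlow y
        simp only
        gcongr

/-- At the last scale k ≤ N whose ball still contains y, either k = N and ε² bounds the base from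
below, or y lies outside the next ball and the distance does. One term of the sum then suffices. -/
theorem regKernel_le_sum_indicator (hn : 2 ≤ n) (N : ℕ) {x y : 𝔼[n]} (hxy : dist y x < 4) :
    ENNReal.ofReal (regKernel (1 / 2 ^ N) x y) ≤ ∑ k ∈ Finset.range (N + 1),
      (ball x (4 / 2 ^ k)).indicator (fun _ => (2 : ℝ≥0∞) ^ (k * (n - 2))) y := by
  classical
  set P : ℕ → Prop := fun k => dist y x < 4 / 2 ^ k with hP
  set k := Nat.findGreatest P N with hk
  have hkN : k ≤ N := Nat.findGreatest_le N
  have hPk : P k := Nat.findGreatest_spec (m := 0) (Nat.zero_le _) (by simpa [hP] using hxy)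
  have hbase : (1 / 2 ^ k : ℝ) ^ 2 ≤ (1 / 2 ^ N) ^ 2 + ‖y - x‖ ^ 2 := by
    rcases hkN.eq_or_lt with h | h
    · rw [h]; linarith [sq_nonneg ‖y - x‖]
    · have : ¬ P (k + 1) := Nat.findGreatest_is_greatest (Nat.lt_succ_self _) h
      simp only [hP, not_lt, dist_eq_norm, pow_succ] at this
      have h1 : (1 / 2 ^ k : ℝ) ≤ ‖y - x‖ := by
        refine le_trans ?_ this
        rw [div_le_div_iff₀ (by positivity) (by positivity)]
        nlinarith [pow_pos (zero_lt_two (α := ℝ)) k]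
      have : (1 / 2 ^ k : ℝ) ^ 2 ≤ ‖y - x‖ ^ 2 := by gcongr
      linarith [sq_nonneg (1 / 2 ^ N : ℝ)]
  have hn' : (2 : ℝ) ≤ n := by exact_mod_cast hn
  have hle : regKernel (1 / 2 ^ N) x y ≤ 2 ^ (k * (n - 2)) := by
    refine (Real.rpow_le_rpow_of_nonpos (by positivity) hbase (by linarith)).trans (le_of_eq ?_)
    rw [← Real.rpow_natCast_mul (by positivity), one_div, ← inv_pow,
      ← Real.rpow_natCast_mul (by positivity), Real.inv_rpow (by positivity),
      ← Real.rpow_neg (by positivity), ← Real.rpow_natCast]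
    congr 1
    push_cast [Nat.cast_sub hn]
    ring
  calc _ ≤ ENNReal.ofReal (2 ^ (k * (n - 2))) := ENNReal.ofReal_le_ofReal hle
    _ = (ball x (4 / 2 ^ k)).indicator (fun _ => (2 : ℝ≥0∞) ^ (k * (n - 2))) y := by
      rw [Set.indicator_of_mem (by exact hPk), ENNReal.ofReal_pow (by norm_num)]; simp
    _ ≤ _ := Finset.single_le_sum (f := fun k => (ball x (4 / 2 ^ k)).indicator
        (fun _ => (2 : ℝ≥0∞) ^ (k * (n - 2))) y) (fun _ _ => zero_le)
        (Finset.mem_range.2 (Nat.lt_succ_of_le hkN))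

theorem continuous_laplacian {f : 𝔼[n] → ℝ} (hf : ContDiff ℝ 2 f) :
    Continuous (Laplacian.laplacian f) := by
  have h1 : ContDiff ℝ 1 (fderiv ℝ f) := hf.fderiv_right (by norm_num)
  have h2 : Continuous (fderiv ℝ (fderiv ℝ f)) := h1.continuous_fderiv (by norm_num)
  have : Laplacian.laplacian f = fun x => ∑ i, fderiv ℝ (fderiv ℝ f) x
      (EuclideanSpace.single i 1) (EuclideanSpace.single i 1) := by
    ext x; simp_rw [laplacian_eq_sum_secondPartial, secondPartial_eq_fderiv]
  rw [this]
  fun_prop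

theorem tsupport_laplacian_subset (f : 𝔼[n] → ℝ) :
    tsupport (Laplacian.laplacian f) ⊆ tsupport f := by
  refine closure_minimal (fun x hx => ?_) (isClosed_tsupport f)
  by_contra hxf
  refine hx ?_
  have : f =ᶠ[nhds x] fun _ => 0 := by
    filter_upwards [(isClosed_tsupport f).isOpen_compl.mem_nhds hxf] with y hy
    exact image_eq_zero_of_notMem_tsupport hy
  rw [(InnerProductSpace.laplacian_congr_nhds this).eq_of_nhds]
  simp

/-- A test function that is at least one at a point is controlled there by the dyadic averages of
its Laplacian. -/
theorem exists_pos_le_sum_lintegral_laplacian (hn : 3 ≤ n) :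
    ∃ c : ℝ, 0 < c ∧ ∀ ψ : 𝔼[n] → ℝ, IsTestFunctionOn (ball 0 2) ψ →
      ∃ N₀ : ℕ, ∀ N, N₀ ≤ N → ∀ x ∈ ball (0 : 𝔼[n]) 1, 1 ≤ ψ x →
        ENNReal.ofReal c ≤ ∑ k ∈ Finset.range (N + 1), 2 ^ (k * (n - 2)) *
          ∫⁻ y in ball x (4 / 2 ^ k), ENNReal.ofReal |Laplacian.laplacian ψ y| := by
  obtain ⟨c, hc, H⟩ := exists_pos_le_integral_regKernel n
  have hn' : (3 : ℝ) ≤ n := by exact_mod_cast hn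
  have hnn : (0 : ℝ) < n * (n - 2) := by apply mul_pos <;> linarith
  refine ⟨n * (n - 2) * c, mul_pos hnn hc, fun ψ hψ => ?_⟩
  have hψ2 : ContDiff ℝ 2 ψ := by exact_mod_cast contDiff_infty.1 hψ.contDiff 2
  obtain ⟨ε₀, hε₀, Hε⟩ := H ψ (hψ2.of_le (by norm_num)) hψ.hasCompactSupport
  obtain ⟨N₀, hN₀⟩ := exists_pow_lt_of_lt_one hε₀ (show (1 / 2 : ℝ) < 1 by norm_num)
  refine ⟨N₀, fun N hN x hx hψx => ?_⟩
  set ε : ℝ := 1 / 2 ^ N with hε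
  have hεp : 0 < ε := by positivity
  have hεle : ε ≤ ε₀ := by
    refine le_trans ?_ hN₀.le
    rw [hε, div_pow, one_pow]
    gcongr; norm_num
  have h1 := Hε ε hεp hεle x hψx
  have hg := integral_mul_laplacian_comm isOpen_univ
    (contDiff_regKernel hεp.ne' x).contDiffOn hψ2 hψ.hasCompactSupport (Set.subset_univ _)
  have hLc := continuous_laplacian hψ2
  have hLs : HasCompactSupport (Laplacian.laplacian ψ) :=
    hψ.hasCompactSupport.of_isClosed_subset (isClosed_tsupport _) (tsupport_laplacian_subset ψ)
  have hΓc : Continuous (regKernel ε x) := (contDiff_regKernel hεp.ne' x (m := 0)).continuous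
  have hI : Integrable fun y => regKernel ε x y * |Laplacian.laplacian ψ y| := by
    refine (hΓc.mul hLc.abs).integrable_of_hasCompactSupport ?_
    exact (hLs.comp_left (g := fun t : ℝ => |t|) abs_zero).mul_left
  -- Green's identity moves the Laplacian from the kernel to ψ; the kernel being positive, only |Δψ|
  -- matters from here on.
  have h2 : n * (n - 2) * c ≤ ∫ y, regKernel ε x y * |Laplacian.laplacian ψ y| := by
    calc n * (n - 2) * c ≤ n * (n - 2) *
          ∫ y, ε ^ 2 * (ε ^ 2 + ‖y - x‖ ^ 2) ^ (-(((n : ℝ) + 2) / 2)) * ψ y := by gcongr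
      _ = -∫ y, ψ y * Laplacian.laplacian (regKernel ε x) y := by
          rw [← integral_const_mul, ← integral_neg]
          refine integral_congr_ae (Filter.Eventually.of_forall fun y => ?_)
          simp only [laplacian_regKernel hεp.ne']
          ring
      _ = ∫ y, -(regKernel ε x y * Laplacian.laplacian ψ y) := by rw [hg, integral_neg]
      _ ≤ _ := by
          refine integral_mono (Integrable.neg ?_) hI fun y => ?_
          · exact (hΓc.mul hLc).integrable_of_hasCompactSupport hLs.mul_left
          · have := (regKernel_pos hεp.ne' x y).le
            have := neg_abs_le (Laplacian.laplacian ψ y)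
            simp only
            nlinarith
  calc _ ≤ ENNReal.ofReal (∫ y, regKernel ε x y * |Laplacian.laplacian ψ y|) :=
        ENNReal.ofReal_le_ofReal h2
    _ = ∫⁻ y, ENNReal.ofReal (regKernel ε x y * |Laplacian.laplacian ψ y|) :=
        ofReal_integral_eq_lintegral_ofReal hI (Filter.Eventually.of_forall fun y =>
          mul_nonneg (regKernel_pos hεp.ne' x y).le (abs_nonneg _))
    _ ≤ ∫⁻ y, ∑ k ∈ Finset.range (N + 1), (ball x (4 / 2 ^ k)).indicator (fun y =>
          (2 : ℝ≥0∞) ^ (k * (n - 2)) * ENNReal.ofReal |Laplacian.laplacian ψ y|) y := by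
        refine lintegral_mono fun y => ?_
        by_cases hy : y ∈ ball (0 : 𝔼[n]) 2
        · have hd : dist y x < 4 := by
            rw [mem_ball] at hy hx
            linarith [dist_triangle y 0 x, dist_comm x 0]
          rw [ENNReal.ofReal_mul (regKernel_pos hεp.ne' x y).le]
          refine (mul_le_mul_left (regKernel_le_sum_indicator (by omega) N hd) _).trans ?_
          rw [Finset.sum_mul]
          refine Finset.sum_le_sum fun k _ => ?_
          by_cases hk : y ∈ ball x (4 / 2 ^ k) <;> simp [hk]
        · have : Laplacian.laplacian ψ y = 0 := image_eq_zero_of_notMem_tsupport fun h =>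
            hy (hψ.tsupport_subset (tsupport_laplacian_subset ψ h))
          simp [this]
    _ = _ := by
        have hm : Measurable fun y => ENNReal.ofReal |Laplacian.laplacian ψ y| := by
          have := hLc.measurable
          fun_prop
        rw [lintegral_finsetSum _ fun k _ => (hm.const_mul _).indicator measurableSet_ball]
        refine Finset.sum_congr rfl fun k _ => ?_
        rw [lintegral_indicator measurableSet_ball, lintegral_const_mul _ hm]

end RegularizedKernel

/-! ### Equilibrium weights on a net of K, bounded by the energy of ψ. -/

section EquilibriumOfCompact

variable {n : ℕ}

local notation "𝔼[" n "]" => EuclideanSpace ℝ (Fin n)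

/-- The absorption step of both halves of the proof: divide by x^{1/q}. Finiteness of x is
essential, since the hypothesis is empty for x = ⊤ and y > 0. -/
theorem ENNReal.le_rpow_of_le_rpow_mul {p q : ℝ} (hpq : p.HolderConjugate q) {x y : ℝ≥0∞}
    (hx : x ≠ ⊤) (h : x ≤ x ^ (1 / q) * y) : x ≤ y ^ p := by
  rcases eq_or_ne x 0 with rfl | hx0
  · exact zero_le
  have hp := hpq.pos
  have hs : x = x ^ (1 / q) * x ^ (1 / p) := by
    rw [← ENNReal.rpow_add _ _ hx0 hx, add_comm, hpq.one_div_add_one_div, div_one, ENNReal.rpow_one]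
  have h1 : x ^ (1 / p) ≤ y := by
    rw [← ENNReal.mul_le_mul_iff_right (a := x ^ (1 / q))
      (by simp [hx0, hx]) (ENNReal.rpow_ne_top_of_nonneg (by have := hpq.symm.pos; positivity) hx),
      ← hs]
    exact h
  calc x = (x ^ (1 / p)) ^ p := by
        rw [← ENNReal.rpow_mul, one_div_mul_cancel hp.ne', ENNReal.rpow_one]
    _ ≤ y ^ p := ENNReal.rpow_le_rpow h1 hp.le

theorem holderConjugate_critical (hn : 3 ≤ n) :
    (((n : ℝ) + 2) / 4).HolderConjugate (((n : ℝ) + 2) / ((n : ℝ) - 2)) := by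
  have hn' : (3 : ℝ) ≤ n := by exact_mod_cast hn
  rw [Real.holderConjugate_iff]
  have h2 : (n : ℝ) - 2 ≠ 0 := by linarith
  refine ⟨by rw [lt_div_iff₀ (by norm_num)]; linarith, ?_⟩
  field_simp
  ring

theorem ofReal_sum_eq_dyadicMass {ι : Type*} [Fintype ι] {μ : ι → ℝ} (hμ : ∀ i, 0 ≤ μ i)
    (z : ι → 𝔼[n]) (A : ℝ) (k : ℕ) (x : 𝔼[n]) :
    ENNReal.ofReal (∑ j, μ j * (ball (z j) (A / 2 ^ k)).indicator
      (fun _ => (2 : ℝ) ^ (k * (n - 2))) x) =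
      dyadicMass (fun i => ENNReal.ofReal (μ i)) z A k x := by
  rw [ENNReal.ofReal_sum_of_nonneg fun j _ => mul_nonneg (hμ j)
    (Set.indicator_nonneg (fun _ _ => by positivity) _), dyadicMass, ballMass, Finset.mul_sum]
  refine Finset.sum_congr rfl fun j _ => ?_
  by_cases hx : x ∈ ball (z j) (A / 2 ^ k)
  · rw [Set.indicator_of_mem hx, Set.indicator_of_mem hx, mul_comm,
      ENNReal.ofReal_mul (by positivity), ENNReal.ofReal_pow (by norm_num)]
    simp
  · simp [hx]

/-- The equilibrium weights on a finite net of `K`, with energy controlled by any admissible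
function. -/
theorem exists_net_equilibrium (hn : 3 ≤ n) :
    ∃ C : ℝ≥0, ∀ K : Set 𝔼[n], IsCompact K → K ⊆ ball 0 1 → K.Nonempty →
      ∀ ψ : 𝔼[n] → ℝ, IsTestFunctionOn (ball 0 2) ψ → (∀ x ∈ K, 1 ≤ ψ x) →
      ∃ (ι : Type) (_ : Fintype ι) (μ : ι → ℝ≥0∞) (z : ι → 𝔼[n]) (N : ℕ),
        (∀ i, μ i ≠ ⊤) ∧ (∀ i, z i ∈ ball 0 1) ∧
        (K ⊆ ⋃ i, ball (z i) ((1 / 8) / 2 ^ N)) ∧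
        (∀ i, 1 ≤ ∑ k ∈ Finset.range (N + 1), 2 ^ (k * (n - 2)) *
          ∫⁻ x in ball (z i) ((1 / 8) / 2 ^ k),
            dyadicMass μ z (1 / 8) k x ^ (((n : ℝ) + 2) / ((n : ℝ) - 2) - 1)) ∧
        ∑ k ∈ Finset.range (N + 1),
          ∫⁻ x, dyadicMass μ z (1 / 8) k x ^ (((n : ℝ) + 2) / ((n : ℝ) - 2)) ≤
          C * ∫⁻ x, ENNReal.ofReal |Laplacian.laplacian ψ x| ^ (((n : ℝ) + 2) / 4) := by
  classical
  set p : ℝ := ((n : ℝ) + 2) / 4 with hp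
  set q : ℝ := ((n : ℝ) + 2) / ((n : ℝ) - 2) with hq
  have hpq : p.HolderConjugate q := holderConjugate_critical hn
  obtain ⟨c, hc, Hc⟩ := exists_pos_le_sum_lintegral_laplacian hn
  obtain ⟨C, hC⟩ := exists_wolff (n := n) (by omega) (A := 4) (A₀ := 1 / 8) (by norm_num)
    (by norm_num) hpq
  refine ⟨(Real.toNNReal c)⁻¹ ^ p * C ^ (p / q), fun K hK hK1 hKn ψ hψ hψK => ?_⟩
  -- The number of scales and the fineness of the net depend on ψ; none of the constants does.
  obtain ⟨N, hN⟩ := Hc ψ hψ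
  obtain ⟨t, htK, htf, ht⟩ := hK.finite_cover_balls (e := (1 / 8) / 2 ^ N) (by positivity)
  lift t to Finset 𝔼[n] using htf
  have htn : Nonempty t := by
    obtain ⟨x, hx⟩ := hKn
    obtain ⟨y, hy, -⟩ := Set.mem_iUnion₂.1 (ht hx)
    exact ⟨⟨y, hy⟩⟩
  set z : t → 𝔼[n] := fun i => i with hz
  have hz1 : ∀ i, z i ∈ ball (0 : 𝔼[n]) 1 := fun i => hK1 (htK i.2)
  -- All the balls involved lie in B(0,2), so the restriction changes no integral and supplies the
  -- finite measure that the minimisation needs.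
  set ν : Measure 𝔼[n] := volume.restrict (ball 0 2) with hν
  have : IsFiniteMeasure ν := ⟨by
    rw [hν, Measure.restrict_apply_univ]; exact measure_ball_lt_top⟩
  set h : Fin (N + 1) → t → 𝔼[n] → ℝ := fun k i =>
    (ball (z i) ((1 / 8) / 2 ^ (k : ℕ))).indicator fun _ => (2 : ℝ) ^ ((k : ℕ) * (n - 2)) with hh
  have hm : ∀ k i, Measurable (h k i) := fun k i => measurable_const.indicator measurableSet_ball
  have h0 : ∀ k i x, 0 ≤ h k i x := fun k i x =>
    Set.indicator_nonneg (fun _ _ => by positivity) _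
  have hsub : ∀ (k : ℕ) i, ball (z i) ((1 / 8) / 2 ^ k) ⊆ ball (0 : 𝔼[n]) 2 := by
    intro k i x hx
    have h1 : (1 / 8 : ℝ) / 2 ^ k ≤ 1 / 8 := div_le_self (by norm_num) (one_le_pow₀ (by norm_num))
    have h2 := hz1 i
    rw [mem_ball] at hx h2 ⊢
    linarith [dist_triangle x (z i) 0]
  obtain ⟨m, hm0, hm1, hmE⟩ := exists_equilibrium (ν := ν) (B := 2 ^ (N * (n - 2))) hm h0
    (fun k i x => by
      refine (Set.indicator_le_self' (fun _ _ => by positivity) x).trans ?_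
      exact pow_le_pow_right₀ (by norm_num) (Nat.mul_le_mul_right _ (Nat.le_of_lt_succ k.2)))
    (fun i => ⟨0, by
      simp only [hh]
      rw [integral_indicator_const _ measurableSet_ball, smul_eq_mul]
      refine mul_pos (ENNReal.toReal_pos ?_ (measure_ne_top _ _)) (by positivity)
      rw [hν, Measure.restrict_apply measurableSet_ball,
        Set.inter_eq_left.2 (hsub _ i)]
      exact (measure_ball_pos _ _ (by positivity)).ne'⟩) hpq.symm.lt
  set μ : t → ℝ≥0∞ := fun i => ENNReal.ofReal (m i) with hμ
  have hμt : ∀ i, μ i ≠ ⊤ := fun i => ENNReal.ofReal_ne_top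
  have hF : ∀ (k : Fin (N + 1)) x, ENNReal.ofReal (∑ j, m j * h k j x) =
      dyadicMass μ z (1 / 8) k x := fun k x => ofReal_sum_eq_dyadicMass hm0 z _ _ x
  have hF0 : ∀ k x, 0 ≤ ∑ j, m j * h k j x := fun k x =>
    Finset.sum_nonneg fun j _ => mul_nonneg (hm0 j) (h0 k j x)
  have hFm : ∀ k, Measurable fun x => ∑ j, m j * h k j x := fun k =>
    Finset.measurable_fun_sum _ fun j _ => (hm k j).const_mul _
  have hout : ∀ (k : ℕ) x, x ∉ ball (0 : 𝔼[n]) 2 → dyadicMass μ z (1 / 8) k x = 0 := by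
    intro k x hx
    rw [dyadicMass, ballMass, Finset.sum_eq_zero, mul_zero]
    intro i _
    exact Set.indicator_of_notMem (fun h => hx (hsub k i h)) _
  have hq0 : 0 < q - 1 := by linarith [hpq.symm.lt]
  have hEner : ∑ k ∈ Finset.range (N + 1), ∫⁻ x, dyadicMass μ z (1 / 8) k x ^ q =
      ∑ i, μ i := by
    rw [Finset.sum_range, hμ, ← ENNReal.ofReal_sum_of_nonneg fun i _ => hm0 i, ← hmE,
      ENNReal.ofReal_sum_of_nonneg fun k _ => integral_nonneg fun x =>
        Real.rpow_nonneg (hF0 k x) _]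
    refine Finset.sum_congr rfl fun k _ => ?_
    rw [integral_eq_lintegral_of_nonneg_ae (Filter.Eventually.of_forall fun x =>
        Real.rpow_nonneg (hF0 k x) _) ((hFm k).pow_const q).aestronglyMeasurable]
    have e : ∫⁻ x, ENNReal.ofReal ((∑ j, m j * h k j x) ^ q) ∂ν =
        ∫⁻ x, dyadicMass μ z (1 / 8) k x ^ q := by
      rw [hν, ← lintegral_indicator measurableSet_ball]
      refine lintegral_congr fun x => ?_
      by_cases hx : x ∈ ball (0 : 𝔼[n]) 2
      · rw [Set.indicator_of_mem hx, ← ENNReal.ofReal_rpow_of_nonneg (hF0 k x) hpq.symm.nonneg,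
          hF]
      · rw [Set.indicator_of_notMem hx, hout k x hx, ENNReal.zero_rpow_of_pos hpq.symm.pos]
    rw [e, ENNReal.ofReal_toReal]
    refine ne_of_lt ?_
    calc ∫⁻ x, dyadicMass μ z (1 / 8) k x ^ q
        ≤ ∫⁻ x, (ball (0 : 𝔼[n]) 2).indicator
            (fun _ => (2 ^ ((k : ℕ) * (n - 2)) * ∑ i, μ i) ^ q) x := by
          refine lintegral_mono fun x => ?_
          by_cases hx : x ∈ ball (0 : 𝔼[n]) 2
          · rw [Set.indicator_of_mem hx]
            refine ENNReal.rpow_le_rpow ?_ hpq.symm.nonneg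
            unfold dyadicMass ballMass
            gcongr with i
            exact Set.indicator_le_self _ _ _
          · rw [hout k x hx, ENNReal.zero_rpow_of_pos hpq.symm.pos]; exact zero_le
      _ < ⊤ := by
          rw [lintegral_indicator measurableSet_ball, setLIntegral_const]
          refine ENNReal.mul_lt_top (ENNReal.rpow_lt_top_of_nonneg hpq.symm.nonneg ?_)
            measure_ball_lt_top
          exact ENNReal.mul_ne_top (by simp) (ENNReal.sum_ne_top.2 fun i _ => hμt i)
  refine ⟨t, inferInstance, μ, z, N, hμt, hz1, fun x hx => ?_, fun i => ?_, ?_⟩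
  · obtain ⟨y, hy, hxy⟩ := Set.mem_iUnion₂.1 (ht hx)
    exact Set.mem_iUnion.2 ⟨⟨y, hy⟩, hxy⟩
  · rw [Finset.sum_range, ← ENNReal.ofReal_one]
    refine (ENNReal.ofReal_le_ofReal (hm1 i)).trans ?_
    rw [ENNReal.ofReal_sum_of_nonneg fun k _ => integral_nonneg fun x =>
      mul_nonneg (Real.rpow_nonneg (hF0 k x) _) (h0 k i x)]
    refine Finset.sum_le_sum fun k _ => ?_
    rw [integral_eq_lintegral_of_nonneg_ae (Filter.Eventually.of_forall fun x =>
        mul_nonneg (Real.rpow_nonneg (hF0 k x) _) (h0 k i x))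
        (((hFm k).pow_const _).mul (hm k i)).aestronglyMeasurable]
    refine ENNReal.ofReal_toReal_le.trans ?_
    rw [hν]
    refine (setLIntegral_le_lintegral _ _).trans ?_
    rw [← lintegral_const_mul _ (by fun_prop), ← lintegral_indicator measurableSet_ball]
    refine lintegral_mono fun x => ?_
    by_cases hx : x ∈ ball (z i) ((1 / 8) / 2 ^ (k : ℕ))
    · rw [Set.indicator_of_mem hx, ← hF, ENNReal.ofReal_rpow_of_nonneg (hF0 k x) hq0.le]
      simp only [hh]
      rw [Set.indicator_of_mem hx, mul_comm, ENNReal.ofReal_mul (by positivity),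
        ENNReal.ofReal_pow (by norm_num)]
      simp
    · have : h k i x = 0 := Set.indicator_of_notMem hx _
      rw [this, mul_zero, ENNReal.ofReal_zero]
      exact zero_le
  · rw [hEner]
    set Y := ∫⁻ x, ENNReal.ofReal |Laplacian.laplacian ψ x| ^ p with hY
    have hψ2 : ContDiff ℝ 2 ψ := by exact_mod_cast contDiff_infty.1 hψ.contDiff 2
    have hLm : Measurable fun x => ENNReal.ofReal |Laplacian.laplacian ψ x| := by
      have := (continuous_laplacian hψ2).measurable
      fun_prop
    have hM : ∑ i, μ i ≠ ⊤ := ENNReal.sum_ne_top.2 fun i _ => hμt i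
    -- The pointwise lower bounds at the net points, where ψ ≥ 1, are summed with weights μᵢ, and
    -- exchanging sum and integral turns the balls around zᵢ into the masses at x.
    have h1 : ENNReal.ofReal c * ∑ i, μ i ≤
        ∫⁻ x, (∑ k ∈ Finset.range (N + 1), dyadicMass μ z 4 k x) *
          ENNReal.ofReal |Laplacian.laplacian ψ x| := by
      calc ENNReal.ofReal c * ∑ i, μ i = ∑ i, μ i * ENNReal.ofReal c := by
            rw [mul_comm, Finset.sum_mul]
        _ ≤ ∑ i, μ i * ∑ k ∈ Finset.range (N + 1), 2 ^ (k * (n - 2)) *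
            ∫⁻ y in ball (z i) (4 / 2 ^ k), ENNReal.ofReal |Laplacian.laplacian ψ y| := by
            gcongr with i
            exact hN N le_rfl (z i) (hz1 i) (hψK _ (htK i.2))
        _ = _ := by
            simp_rw [Finset.mul_sum, Finset.sum_mul]
            rw [Finset.sum_comm, lintegral_finsetSum _ fun k _ => by fun_prop]
            refine Finset.sum_congr rfl fun k _ => ?_
            simp_rw [show ∀ x, dyadicMass μ z 4 k x = 2 ^ (k * (n - 2)) *
              ballMass μ z (4 / 2 ^ k) x from fun _ => rfl, mul_assoc]
            rw [lintegral_const_mul _ (by fun_prop), lintegral_ballMass_mul _ _ _ hLm,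
              Finset.mul_sum]
            exact Finset.sum_congr rfl fun i _ => by ring
    have h2 := ENNReal.lintegral_mul_le_Lp_mul_Lq volume hpq.symm
      (f := fun x => ∑ k ∈ Finset.range (N + 1), dyadicMass μ z 4 k x)
      (g := fun x => ENNReal.ofReal |Laplacian.laplacian ψ x|)
      (by fun_prop) hLm.aemeasurable
    have h3 := (hC μ z (N + 1) hμt).1
    rw [hEner] at h3
    have hq1 : 0 ≤ 1 / q := by have := hpq.symm.pos; positivity
    have hcne : (Real.toNNReal c) ≠ 0 := by simpa using hc
    -- Hölder and the first form of Wolff's inequality. Since the energy equals the total mass, the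
    -- mass reappears to the power 1/q and can be absorbed.
    have h4 : ∑ i, μ i ≤ (∑ i, μ i) ^ (1 / q) *
        (((Real.toNNReal c)⁻¹ : ℝ≥0) * ((C : ℝ≥0∞) ^ (1 / q) * Y ^ (1 / p))) := by
      have h5 : ENNReal.ofReal c * ∑ i, μ i ≤
          ((C : ℝ≥0∞) * ∑ i, μ i) ^ (1 / q) * Y ^ (1 / p) := by
        refine h1.trans (h2.trans ?_)
        gcongr
      rw [ENNReal.mul_rpow_of_nonneg _ _ hq1] at h5
      have h6 : (((Real.toNNReal c)⁻¹ : ℝ≥0) : ℝ≥0∞) * ENNReal.ofReal c = 1 := by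
        rw [ENNReal.ofReal, ← ENNReal.coe_mul, inv_mul_cancel₀ hcne, ENNReal.coe_one]
      calc ∑ i, μ i = ((Real.toNNReal c)⁻¹ : ℝ≥0) * (ENNReal.ofReal c * ∑ i, μ i) := by
            rw [← mul_assoc, h6, one_mul]
        _ ≤ ((Real.toNNReal c)⁻¹ : ℝ≥0) *
            ((C : ℝ≥0∞) ^ (1 / q) * (∑ i, μ i) ^ (1 / q) * Y ^ (1 / p)) := by gcongr
        _ = _ := by ring
    refine (ENNReal.le_rpow_of_le_rpow_mul hpq hM h4).trans (le_of_eq ?_)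
    have hp0 := hpq.nonneg
    rw [ENNReal.mul_rpow_of_nonneg _ _ hp0, ENNReal.mul_rpow_of_nonneg _ _ hp0,
      ← ENNReal.rpow_mul, ← ENNReal.rpow_mul, one_div_mul_cancel hpq.pos.ne', ENNReal.rpow_one,
      ENNReal.coe_mul, ENNReal.coe_rpow_of_nonneg _ hp0,
      ENNReal.coe_rpow_of_nonneg _ (div_nonneg hp0 hpq.symm.nonneg), mul_assoc]
    congr 3
    ring

end EquilibriumOfCompact

/-! ### Smooth kernels at dyadic scales. -/

section Smear

variable {n : ℕ}

local notation "𝔼[" n "]" => EuclideanSpace ℝ (Fin n)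

/-- The convolution of a density with a kernel. -/
noncomputable def smear (w f : 𝔼[n] → ℝ) (x : 𝔼[n]) : ℝ := ∫ y, w y * f (x - y)

theorem smear_eq_convolution (w f : 𝔼[n] → ℝ) :
    smear w f = convolution w f (ContinuousLinearMap.mul ℝ ℝ) volume := rfl

variable {w : 𝔼[n] → ℝ} {B : ℝ}

theorem locallyIntegrable_of_bound (hw : Measurable w) (hB : ∀ y, |w y| ≤ B) :
    LocallyIntegrable w volume :=
  (memLp_top_of_bound hw.aestronglyMeasurable B
    (Filter.Eventually.of_forall hB)).locallyIntegrable le_top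

/-- All derivatives fall on the kernel, so the density may be merely bounded and measurable, as
powers of ball masses are. -/
theorem contDiff_smear (hw : Measurable w) (hB : ∀ y, |w y| ≤ B) {f : 𝔼[n] → ℝ}
    (hf : ContDiff ℝ ∞ f) (hfc : HasCompactSupport f) : ContDiff ℝ ∞ (smear w f) := by
  rw [smear_eq_convolution]
  exact hfc.contDiff_convolution_right _ (locallyIntegrable_of_bound hw hB) hf

theorem fderiv_smear (hw : Measurable w) (hB : ∀ y, |w y| ≤ B) {f : 𝔼[n] → ℝ}
    (hf : ContDiff ℝ ∞ f) (hfc : HasCompactSupport f) (x v : 𝔼[n]) :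
    fderiv ℝ (smear w f) x v = smear w (fun z => fderiv ℝ f z v) x := by
  have hl := locallyIntegrable_of_bound hw hB
  have hf1 : ContDiff ℝ 1 f := by exact_mod_cast contDiff_infty.1 hf 1
  rw [smear_eq_convolution,
    (hfc.hasFDerivAt_convolution_right (ContinuousLinearMap.mul ℝ ℝ) hl hf1 x).fderiv,
    convolution_precompR_apply _ hl (hfc.fderiv ℝ) (hf1.continuous_fderiv (by simp))]
  rfl

theorem integrable_smear (hw : Measurable w) (hB : ∀ y, |w y| ≤ B) {f : 𝔼[n] → ℝ}
    (hf : Integrable f) (x : 𝔼[n]) : Integrable fun y => w y * f (x - y) :=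
  (hf.comp_sub_left x).bdd_mul (c := B) hw.aestronglyMeasurable (Filter.Eventually.of_forall hB)

theorem abs_smear_le (hw : Measurable w) (hw0 : ∀ y, 0 ≤ w y) (hB : ∀ y, |w y| ≤ B)
    {f g : 𝔼[n] → ℝ} (hfg : ∀ z, |f z| ≤ g z) (hg : Integrable g) (x : 𝔼[n]) :
    |smear w f x| ≤ smear w g x := by
  have := norm_integral_le_of_norm_le (f := fun y => w y * f (x - y))
    (integrable_smear hw hB hg x) (Filter.Eventually.of_forall fun y => ?_)
  · exact this
  rw [Real.norm_eq_abs, abs_mul, abs_of_nonneg (hw0 y)]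
  exact mul_le_mul_of_nonneg_left (hfg _) (hw0 y)

theorem smear_nonneg (hw0 : ∀ y, 0 ≤ w y) {f : 𝔼[n] → ℝ} (hf : ∀ z, 0 ≤ f z) (x : 𝔼[n]) :
    0 ≤ smear w f x := integral_nonneg fun y => mul_nonneg (hw0 y) (hf _)

theorem smear_add_mul (hw : Measurable w) (hB : ∀ y, |w y| ≤ B) {f g : 𝔼[n] → ℝ}
    (hf : Integrable f) (hg : Integrable g) (a b : ℝ) (x : 𝔼[n]) :
    smear w (fun z => a * f z + b * g z) x = a * smear w f x + b * smear w g x := by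
  unfold smear
  rw [← integral_const_mul, ← integral_const_mul, ← integral_add
    ((integrable_smear hw hB hf x).const_mul a) ((integrable_smear hw hB hg x).const_mul b)]
  exact integral_congr_ae (Filter.Eventually.of_forall fun y => by simp only; ring)

/-- The indicator of the ball of radius `2^{-k}/2`. -/
noncomputable def dyadicIndicator (n k : ℕ) : 𝔼[n] → ℝ :=
  (ball (0 : 𝔼[n]) ((1 / 2) / 2 ^ k)).indicator fun _ => 1

theorem integrable_dyadicIndicator (n k : ℕ) : Integrable (dyadicIndicator n k) :=
  (integrable_indicator_iff measurableSet_ball).2 (integrableOn_const (by finiteness))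

theorem dyadicIndicator_nonneg (n k : ℕ) (z : 𝔼[n]) : 0 ≤ dyadicIndicator n k z :=
  Set.indicator_nonneg (fun _ _ => zero_le_one) _

theorem dyadicIndicator_smul (n k : ℕ) (z : 𝔼[n]) :
    dyadicIndicator n 0 ((2 : ℝ) ^ k • z) = dyadicIndicator n k z := by
  have : (2 : ℝ) ^ k • z ∈ ball (0 : 𝔼[n]) ((1 / 2) / 2 ^ 0) ↔
      z ∈ ball (0 : 𝔼[n]) ((1 / 2) / 2 ^ k) := by
    rw [mem_ball_zero_iff, mem_ball_zero_iff, norm_smul, pow_zero, div_one,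
      lt_div_iff₀ (show (0 : ℝ) < 2 ^ k by positivity), Real.norm_eq_abs, abs_of_pos (by positivity), mul_comm]
  by_cases h : z ∈ ball (0 : 𝔼[n]) ((1 / 2) / 2 ^ k)
  · rw [dyadicIndicator, dyadicIndicator, Set.indicator_of_mem h, Set.indicator_of_mem (this.2 h)]
  · rw [dyadicIndicator, dyadicIndicator, Set.indicator_of_notMem h,
      Set.indicator_of_notMem (mt this.1 h)]

theorem exists_fderiv_fderiv_bound {E : Type*} [NormedAddCommGroup E] [NormedSpace ℝ E]
    {f : E → ℝ} (hf : ContDiff ℝ 2 f) (hc : HasCompactSupport f) :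
    ∃ L : ℝ, ∀ z u v, ‖u‖ ≤ 1 → ‖v‖ ≤ 1 → |fderiv ℝ (fderiv ℝ f) z u v| ≤ L := by
  obtain ⟨L, hL⟩ := (hc.iteratedFDeriv (𝕜 := ℝ) 2).exists_bound_of_continuous
    (hf.continuous_iteratedFDeriv (m := 2) (by norm_num))
  refine ⟨L, fun z u v hu hv => ?_⟩
  have h := (iteratedFDeriv ℝ 2 f z).le_opNorm ![u, v]
  rw [iteratedFDeriv_two_apply, Real.norm_eq_abs] at h
  refine h.trans ?_
  simp only [Fin.prod_univ_two, Matrix.cons_val_zero, Matrix.cons_val_one]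
  calc _ ≤ ‖iteratedFDeriv ℝ 2 f z‖ * (1 * 1) := by gcongr
    _ ≤ L := by simpa using hL z

/-- A smooth nonnegative kernel whose gradient is controlled by its square root. -/
theorem exists_bump_kernel (n : ℕ) :
    ∃ (ρ : 𝔼[n] → ℝ) (L : ℝ), ContDiff ℝ ∞ ρ ∧ HasCompactSupport ρ ∧ (∀ z, 0 ≤ ρ z) ∧
      (∀ z ∈ ball (0 : 𝔼[n]) (1 / 4), ρ z = 1) ∧ tsupport ρ ⊆ ball 0 (1 / 2) ∧ 0 < L ∧
      ∀ v, ‖v‖ ≤ 1 → ∀ z,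
        (∀ τ : ℝ, 0 < τ → |fderiv ℝ ρ z v| ≤ L * (τ * ρ z + τ⁻¹ * dyadicIndicator n 0 z)) ∧
        |fderiv ℝ ρ z v| ≤ L * dyadicIndicator n 0 z ∧
        ∀ u, ‖u‖ ≤ 1 → |fderiv ℝ (fun y => fderiv ℝ ρ y v) z u| ≤ L * dyadicIndicator n 0 z := by
  obtain ⟨χ, hχ1, hχ2⟩ : ∃ χ : ContDiffBump (0 : 𝔼[n]), χ.rIn = 1 / 4 ∧ χ.rOut = 3 / 8 :=
    ⟨⟨1 / 4, 3 / 8, by norm_num, by norm_num⟩, rfl, rfl⟩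
  -- Squaring the bump makes |∇ρ| of order √ρ, which is the source of the quadratic gradient bound.
  obtain ⟨ρ, hρ⟩ : ∃ ρ : 𝔼[n] → ℝ, ρ = fun z => χ z ^ 2 := ⟨_, rfl⟩
  have hχs : ContDiff ℝ ∞ χ := χ.contDiff
  have hρs : ContDiff ℝ ∞ ρ := by rw [hρ]; exact hχs.pow 2
  have hts : tsupport ρ ⊆ ball (0 : 𝔼[n]) (1 / 2) := by
    have h1 : tsupport ρ ⊆ tsupport χ := by
      refine closure_mono fun z hz => ?_
      simp only [hρ, Function.mem_support] at hz ⊢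
      exact fun h => hz (by rw [h]; norm_num)
    refine h1.trans ?_
    rw [χ.tsupport_eq]
    exact closedBall_subset_ball (by rw [hχ2]; norm_num)
  have hρc : HasCompactSupport ρ :=
    (isCompact_closedBall (0 : 𝔼[n]) (1 / 2)).of_isClosed_subset (isClosed_tsupport _)
      (hts.trans ball_subset_closedBall)
  obtain ⟨L₁, hL₁⟩ := (χ.hasCompactSupport.fderiv ℝ).exists_bound_of_continuous
    (hχs.continuous_fderiv (by simp))
  have hf1 : ContDiff ℝ 1 (fderiv ℝ ρ) := by
    refine ContDiff.fderiv_right (m := 1) (n := 2) ?_ (by norm_num)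
    exact_mod_cast contDiff_infty.1 hρs 2
  obtain ⟨L₂, hL₂⟩ := (hρc.fderiv ℝ).exists_bound_of_continuous hf1.continuous
  obtain ⟨L₃, hL₃⟩ := exists_fderiv_fderiv_bound
    (by exact_mod_cast contDiff_infty.1 hρs 2 : ContDiff ℝ 2 ρ) hρc
  obtain ⟨L, hL⟩ : ∃ L, L = |L₁| + |L₂| + |L₃| + 1 := ⟨_, rfl⟩
  have hLp : 0 < L := by rw [hL]; positivity
  have hin : ∀ z ∈ ball (0 : 𝔼[n]) (1 / 2), dyadicIndicator n 0 z = 1 := by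
    intro z hz
    exact Set.indicator_of_mem (by simpa using hz) _
  have hout : ∀ z, z ∉ ball (0 : 𝔼[n]) (1 / 2) → ∀ v, fderiv ℝ ρ z v = 0 := by
    intro z hz v
    rw [image_eq_zero_of_notMem_tsupport fun h => hz (hts (tsupport_fderiv_subset ℝ h))]
    simp
  have hlin : ∀ (T : 𝔼[n] →L[ℝ] ℝ) (M : ℝ), ‖T‖ ≤ M → M ≤ L → ∀ v, ‖v‖ ≤ 1 → |T v| ≤ L := by
    intro T M hT hM v hv
    have := T.le_opNorm v
    rw [Real.norm_eq_abs] at this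
    calc _ ≤ ‖T‖ * ‖v‖ := this
      _ ≤ ‖T‖ * 1 := by gcongr
      _ ≤ L := by linarith
  refine ⟨ρ, L, hρs, hρc, fun z => by rw [hρ]; exact sq_nonneg _,
    fun z hz => ?_, hts, hLp, fun v hv z => ?_⟩
  · simp only [hρ]
    rw [χ.one_of_mem_closedBall (by rw [hχ1]; exact ball_subset_closedBall hz)]
    norm_num
  have habs : ∀ t : ℝ, t ≤ |t| := le_abs_self
  have ha1 := abs_nonneg L₁
  have ha2 := abs_nonneg L₂
  have ha3 := abs_nonneg L₃
  refine ⟨fun τ hτ => ?_, ?_, fun u hu => ?_⟩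
  · by_cases hz : z ∈ ball (0 : 𝔼[n]) (1 / 2)
    · rw [hin z hz, mul_one]
      have hd : fderiv ℝ ρ z v = 2 * χ z * fderiv ℝ χ z v := by
        have := ((hχs.differentiable (by simp)) z).hasFDerivAt.pow 2
        rw [hρ, HasFDerivAt.fderiv (f := fun z => χ z ^ 2) this]
        simp
      have h1 : |fderiv ℝ χ z v| ≤ L :=
        hlin _ L₁ (hL₁ z) (by linarith [habs L₁]) v hv
      rw [hd, abs_mul, abs_of_nonneg (by have := χ.nonneg (x := z); positivity)]
      -- The weighted arithmetic-geometric inequality, from (τχ - 1)² ≥ 0; this linear form of |∇ρ|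
      -- ≤ C√ρ survives convolution and summation over scales.
      have h2 : 2 * χ z ≤ τ * ρ z + τ⁻¹ := by
        have : 0 ≤ τ⁻¹ * (τ * χ z - 1) ^ 2 := by positivity
        have e : τ⁻¹ * (τ * χ z - 1) ^ 2 = τ * χ z ^ 2 - 2 * χ z + τ⁻¹ := by
          field_simp; ring
        simp only [hρ]; linarith
      have := χ.nonneg (x := z)
      calc _ ≤ (2 * χ z) * L := by gcongr
        _ ≤ (τ * ρ z + τ⁻¹) * L := by gcongr
        _ = _ := mul_comm _ _
    · rw [hout z hz, abs_zero]
      have := dyadicIndicator_nonneg n 0 z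
      have : 0 ≤ ρ z := by rw [hρ]; exact sq_nonneg _
      positivity
  · by_cases hz : z ∈ ball (0 : 𝔼[n]) (1 / 2)
    · rw [hin z hz, mul_one]
      exact hlin _ L₂ (hL₂ z) (by linarith [habs L₂]) v hv
    · rw [hout z hz, abs_zero]
      exact mul_nonneg hLp.le (dyadicIndicator_nonneg n 0 z)
  · have hd : fderiv ℝ (fun y => fderiv ℝ ρ y v) z u = fderiv ℝ (fderiv ℝ ρ) z u v := by
      rw [fderiv_clm_apply ((hf1.differentiable (by simp)) z) (by fun_prop)]
      simp
    rw [hd]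
    by_cases hz : z ∈ ball (0 : 𝔼[n]) (1 / 2)
    · rw [hin z hz, mul_one]
      exact (hL₃ z u v hu hv).trans (by linarith [habs L₃])
    · rw [image_eq_zero_of_notMem_tsupport fun h => hz (hts (tsupport_fderiv_subset ℝ
        (tsupport_fderiv_subset ℝ h)))]
      simpa using mul_nonneg hLp.le (dyadicIndicator_nonneg n 0 z)

theorem fderiv_comp_smul_apply {f : 𝔼[n] → ℝ} (c : ℝ) (z v : 𝔼[n]) :
    fderiv ℝ (fun y => f (c • y)) z v = c * fderiv ℝ f (c • z) v := by
  rw [fderiv_comp_smul]; simp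

/-- A family of kernels at dyadic scales. -/
theorem exists_dyadic_kernels (n : ℕ) :
    ∃ (ρ : ℕ → 𝔼[n] → ℝ) (L : ℝ), 0 < L ∧ ∀ k, ContDiff ℝ ∞ (ρ k) ∧ HasCompactSupport (ρ k) ∧
      (∀ z, 0 ≤ ρ k z) ∧ (∀ z ∈ ball (0 : 𝔼[n]) ((1 / 4) / 2 ^ k), ρ k z = 1) ∧
      (∀ z, ρ k z ≠ 0 → z ∈ ball (0 : 𝔼[n]) ((1 / 2) / 2 ^ k)) ∧
      ∀ v, ‖v‖ ≤ 1 → ∀ z,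
        (∀ τ : ℝ, 0 < τ →
          |fderiv ℝ (ρ k) z v| ≤ L * τ * ρ k z + L * τ⁻¹ * 4 ^ k * dyadicIndicator n k z) ∧
        |fderiv ℝ (ρ k) z v| ≤ L * 4 ^ k * dyadicIndicator n k z ∧
        ∀ u, ‖u‖ ≤ 1 → |fderiv ℝ (fun y => fderiv ℝ (ρ k) y v) z u| ≤
          L * 4 ^ k * dyadicIndicator n k z := by
  obtain ⟨ρ, L, hs, hc, h0, h1, hts, hL, hb⟩ := exists_bump_kernel n
  have hsm : ∀ (k : ℕ) (z : 𝔼[n]) (r : ℝ), (2 : ℝ) ^ k • z ∈ ball (0 : 𝔼[n]) r ↔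
      z ∈ ball (0 : 𝔼[n]) (r / 2 ^ k) := by
    intro k z r
    rw [mem_ball_zero_iff, mem_ball_zero_iff, norm_smul, lt_div_iff₀ (by positivity),
      Real.norm_eq_abs, abs_of_pos (by positivity), mul_comm]
  have h24 : ∀ k : ℕ, (2 : ℝ) ^ k * 2 ^ k = 4 ^ k := fun k => by rw [← mul_pow]; norm_num
  refine ⟨fun k z => ρ ((2 : ℝ) ^ k • z), L, hL, fun k => ⟨?_, ?_, fun z => h0 _, ?_, ?_, ?_⟩⟩
  · exact hs.comp (contDiff_const_smul _)
  · exact hc.comp_smul (by positivity)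
  · intro z hz
    exact h1 _ ((hsm k z _).2 hz)
  · intro z hz
    exact (hsm k z _).1 (hts (subset_tsupport _ hz))
  · intro v hv z
    obtain ⟨b1, b2, b3⟩ := hb v hv ((2 : ℝ) ^ k • z)
    have hI := dyadicIndicator_smul n k z
    have hI0 := dyadicIndicator_nonneg n k z
    have e1 : ∀ y, fderiv ℝ (fun z => ρ ((2 : ℝ) ^ k • z)) y v =
        2 ^ k * fderiv ℝ ρ ((2 : ℝ) ^ k • y) v := fun y => fderiv_comp_smul_apply _ y v
    have hk : (0 : ℝ) < 2 ^ k := by positivity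
    refine ⟨fun τ hτ => ?_, ?_, fun u hu => ?_⟩
    · rw [e1, abs_mul, abs_of_pos hk]
      -- The chain rule contributes 2^k. With this parameter it cancels in the first term and
      -- becomes 4^k in the second, the same factor as for second derivatives.
      have := b1 (τ / 2 ^ k) (by positivity)
      rw [hI] at this
      calc _ ≤ 2 ^ k * (L * (τ / 2 ^ k * ρ ((2 : ℝ) ^ k • z) +
            (τ / 2 ^ k)⁻¹ * dyadicIndicator n k z)) := by gcongr
        _ = _ := by rw [← h24]; field_simp
    · rw [e1, abs_mul, abs_of_pos hk]
      rw [hI] at b2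
      calc _ ≤ 2 ^ k * (L * dyadicIndicator n k z) := by gcongr
        _ ≤ 4 ^ k * (L * dyadicIndicator n k z) := by gcongr; norm_num
        _ = _ := by ring
    · simp_rw [e1]
      have hdiff : DifferentiableAt ℝ (fun y => fderiv ℝ ρ ((2 : ℝ) ^ k • y) v) z := by
        have : ContDiff ℝ 1 (fderiv ℝ ρ) := by
          refine ContDiff.fderiv_right (m := 1) (n := 2) ?_ (by norm_num)
          exact_mod_cast contDiff_infty.1 hs 2
        have h2 : ContDiff ℝ 1 fun y => fderiv ℝ ρ ((2 : ℝ) ^ k • y) v :=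
          (this.comp (contDiff_const_smul _)).clm_apply contDiff_const
        exact h2.differentiable (by simp) z
      have b3' := b3 u hu
      rw [hI] at b3'
      rw [fderiv_const_mul hdiff]
      have := fderiv_comp_smul_apply (f := fun y => fderiv ℝ ρ y v) ((2 : ℝ) ^ k) z u
      rw [_root_.smul_apply, this, smul_eq_mul, ← mul_assoc, h24, abs_mul,
        abs_of_pos (by positivity)]
      calc _ ≤ 4 ^ k * (L * dyadicIndicator n k z) := by gcongr
        _ = _ := by ring

/-- A smooth truncation of the half line. -/
theorem exists_smooth_step :
    ∃ (H : ℝ → ℝ) (L : ℝ), ContDiff ℝ ∞ H ∧ 0 < L ∧ (∀ t, 0 ≤ H t ∧ H t ≤ 1) ∧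
      (∀ t, t ≤ 1 / 2 → H t = 0) ∧ (∀ t, 1 ≤ t → H t = 1) ∧
      (∀ t, |deriv H t| ≤ L) ∧ (∀ t, |deriv (deriv H) t| ≤ L) ∧
      (∀ t, 1 < t → deriv H t = 0 ∧ deriv (deriv H) t = 0) ∧ ∀ t, 0 ≤ deriv H t := by
  set H : ℝ → ℝ := fun t => Real.smoothTransition (2 * t - 1) with hH
  have hs : ContDiff ℝ ∞ H := Real.smoothTransition.contDiff.comp (by fun_prop)
  have h0 : ∀ t, t ≤ 1 / 2 → H t = 0 := fun t ht =>
    Real.smoothTransition.zero_of_nonpos (by linarith)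
  have h1 : ∀ t, 1 ≤ t → H t = 1 := fun t ht =>
    Real.smoothTransition.one_of_one_le (by linarith)
  have hgt : ∀ t, 1 < t → deriv H t = 0 := fun t ht => by
    have : H =ᶠ[nhds t] fun _ => 1 := by
      filter_upwards [lt_mem_nhds ht] with s hs using h1 s hs.le
    rw [this.deriv_eq]; simp
  have hgt2 : ∀ t, 1 < t → deriv (deriv H) t = 0 := fun t ht => by
    have : deriv H =ᶠ[nhds t] fun _ => 0 := by
      filter_upwards [lt_mem_nhds ht] with s hs using hgt s hs
    rw [this.deriv_eq]; simp
  have hlt : ∀ t, t < 1 / 2 → deriv H t = 0 := fun t ht => by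
    have : H =ᶠ[nhds t] fun _ => 0 := by
      filter_upwards [gt_mem_nhds ht] with s hs using h0 s hs.le
    rw [this.deriv_eq]; simp
  have hc : HasCompactSupport (deriv H) := by
    refine HasCompactSupport.intro (isCompact_Icc (a := 1 / 2) (b := (1 : ℝ))) fun t ht => ?_
    rw [Set.mem_Icc, not_and_or, not_le, not_le] at ht
    exact ht.elim (hlt t) (hgt t)
  have hs1 : ContDiff ℝ 1 (deriv H) := by
    have : ContDiff ℝ (1 + 1) H := by exact_mod_cast contDiff_infty.1 hs 2
    exact (contDiff_succ_iff_deriv.1 this).2.2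
  obtain ⟨L₁, hL₁⟩ := hc.exists_bound_of_continuous hs1.continuous
  obtain ⟨L₂, hL₂⟩ := hc.deriv.exists_bound_of_continuous (hs1.continuous_deriv (by simp))
  refine ⟨H, |L₁| + |L₂| + 1, hs, by positivity, fun t => ⟨Real.smoothTransition.nonneg _,
    Real.smoothTransition.le_one _⟩, h0, h1, fun t => ?_, fun t => ?_, fun t ht =>
    ⟨hgt t ht, hgt2 t ht⟩, fun t => ?_⟩
  · have := hL₁ t
    rw [Real.norm_eq_abs] at this
    linarith [le_abs_self L₁, abs_nonneg L₂]
  · have := hL₂ t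
    rw [Real.norm_eq_abs] at this
    linarith [le_abs_self L₂, abs_nonneg L₁]
  · exact (Real.smoothTransition.monotone.comp fun a b h => by simpa using h).deriv_nonneg

/-- Take τ = A/(2L): since P ≤ 1 the first term is at most A/2 and is absorbed. -/
theorem sq_le_four_mul_of_forall_le {A L P S : ℝ} (hA : 0 ≤ A) (hL : 0 < L) (hS : 0 ≤ S)
    (hP : P ≤ 1) (h : ∀ τ : ℝ, 0 < τ → A ≤ L * τ * P + L * τ⁻¹ * S) :
    A ^ 2 ≤ 4 * L ^ 2 * S := by
  rcases hA.eq_or_lt with rfl | hA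
  · have : 0 ≤ 4 * L ^ 2 * S := by positivity
    simpa using this
  have h1 := h (A / (2 * L)) (by positivity)
  have h2 : L * (A / (2 * L)) * P ≤ A / 2 := by
    have : L * (A / (2 * L)) = A / 2 := by field_simp
    rw [this]
    nlinarith
  have h3 : L * (A / (2 * L))⁻¹ * S = 2 * L ^ 2 * S / A := by field_simp
  have h4 : A / 2 ≤ 2 * L ^ 2 * S / A := by linarith
  rw [le_div_iff₀ hA] at h4
  nlinarith

end Smear

/-! ### Pointwise derivative bounds for a truncated potential. -/

section Truncation

variable {n : ℕ}

local notation "𝔼[" n "]" => EuclideanSpace ℝ (Fin n)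

/-- The sum of potentials of densities against dyadic kernels. -/
noncomputable def dyadicPotential (ρ : ℕ → 𝔼[n] → ℝ) (w : ℕ → 𝔼[n] → ℝ) (M : ℕ) (x : 𝔼[n]) : ℝ :=
  ∑ k ∈ Finset.range M, smear (w k) (ρ k) x

variable {w : ℕ → 𝔼[n] → ℝ} {B : ℕ → ℝ}

theorem contDiff_dyadicPotential (hw : ∀ k, Measurable (w k)) (hB : ∀ k y, |w k y| ≤ B k)
    {ρ : ℕ → 𝔼[n] → ℝ} (hρ : ∀ k, ContDiff ℝ ∞ (ρ k)) (hc : ∀ k, HasCompactSupport (ρ k)) (M : ℕ) :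
    ContDiff ℝ ∞ (dyadicPotential ρ w M) :=
  ContDiff.sum fun k _ => contDiff_smear (hw k) (hB k) (hρ k) (hc k)

theorem fderiv_dyadicPotential (hw : ∀ k, Measurable (w k)) (hB : ∀ k y, |w k y| ≤ B k)
    {ρ : ℕ → 𝔼[n] → ℝ} (hρ : ∀ k, ContDiff ℝ ∞ (ρ k)) (hc : ∀ k, HasCompactSupport (ρ k)) (M : ℕ)
    (x v : 𝔼[n]) :
    fderiv ℝ (dyadicPotential ρ w M) x v =
      dyadicPotential (fun k z => fderiv ℝ (ρ k) z v) w M x := by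
  unfold dyadicPotential
  rw [fderiv_fun_sum fun k _ =>
    (contDiff_smear (hw k) (hB k) (hρ k) (hc k)).differentiable (by simp) x]
  rw [sum_apply]
  exact Finset.sum_congr rfl fun k _ => fderiv_smear (hw k) (hB k) (hρ k) (hc k) x v

theorem fderiv_fderiv_dyadicPotential (hw : ∀ k, Measurable (w k)) (hB : ∀ k y, |w k y| ≤ B k)
    {ρ : ℕ → 𝔼[n] → ℝ} (hρ : ∀ k, ContDiff ℝ ∞ (ρ k)) (hc : ∀ k, HasCompactSupport (ρ k)) (M : ℕ)
    (x u v : 𝔼[n]) :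
    fderiv ℝ (fderiv ℝ (dyadicPotential ρ w M)) x u v =
      dyadicPotential (fun k z => fderiv ℝ (fun y => fderiv ℝ (ρ k) y v) z u) w M x := by
  have hs : ContDiff ℝ 2 (dyadicPotential ρ w M) := by
    exact_mod_cast contDiff_infty.1 (contDiff_dyadicPotential hw hB hρ hc M) 2
  have hd : DifferentiableAt ℝ (fderiv ℝ (dyadicPotential ρ w M)) x :=
    (hs.fderiv_right (m := 1) (by norm_num)).differentiable (by simp) x
  have e : fderiv ℝ (fderiv ℝ (dyadicPotential ρ w M)) x u v =
      fderiv ℝ (fun y => fderiv ℝ (dyadicPotential ρ w M) y v) x u := by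
    rw [fderiv_clm_apply hd (by fun_prop)]
    simp
  rw [e]
  simp_rw [fderiv_dyadicPotential hw hB hρ hc]
  exact fderiv_dyadicPotential hw hB
    (fun k => (contDiff_infty_iff_fderiv.1 (hρ k)).2.clm_apply contDiff_const)
    (fun k => (hc k).fderiv_apply ℝ v) M x u

theorem abs_dyadicPotential_le (hw : ∀ k, Measurable (w k)) (hw0 : ∀ k y, 0 ≤ w k y)
    (hB : ∀ k y, |w k y| ≤ B k) {f g : ℕ → 𝔼[n] → ℝ} (hfg : ∀ k z, |f k z| ≤ g k z)
    (hg : ∀ k, Integrable (g k)) (M : ℕ) (x : 𝔼[n]) :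
    |dyadicPotential f w M x| ≤ dyadicPotential g w M x :=
  (Finset.abs_sum_le_sum_abs _ _).trans <| Finset.sum_le_sum fun k _ =>
    abs_smear_le (hw k) (hw0 k) (hB k) (hfg k) (hg k) x

/-- A smooth truncation of a dyadic potential whose first and second derivatives are
controlled by a positive dyadic operator. -/
theorem exists_truncation (n : ℕ) :
    ∃ (ρ : ℕ → 𝔼[n] → ℝ) (H : ℝ → ℝ) (C : ℝ), 0 < C ∧
      (∀ k z, 0 ≤ ρ k z) ∧ (∀ k, Integrable (ρ k)) ∧
      (∀ k, ∀ z ∈ ball (0 : 𝔼[n]) ((1 / 4) / 2 ^ k), ρ k z = 1) ∧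
      (∀ k z, ρ k z ≠ 0 → z ∈ ball (0 : 𝔼[n]) ((1 / 2) / 2 ^ k)) ∧
      (∀ t, 0 ≤ H t ∧ H t ≤ 1) ∧ H 0 = 0 ∧ (∀ t, 1 ≤ t → H t = 1) ∧
      ∀ (w : ℕ → 𝔼[n] → ℝ) (B : ℕ → ℝ) (M : ℕ), (∀ k, Measurable (w k)) → (∀ k y, 0 ≤ w k y) →
        (∀ k y, |w k y| ≤ B k) →
        ContDiff ℝ ∞ (fun x => H (dyadicPotential ρ w M x)) ∧
        ∀ x, hessianNorm (fun x => H (dyadicPotential ρ w M x)) x ≤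
            C * dyadicPotential (fun k z => 4 ^ k * dyadicIndicator n k z) w M x ∧
          ‖fderiv ℝ (fun x => H (dyadicPotential ρ w M x)) x‖ ≤
            C * dyadicPotential (fun k z => 4 ^ k * dyadicIndicator n k z) w M x ∧
          ‖fderiv ℝ (fun x => H (dyadicPotential ρ w M x)) x‖ ^ 2 ≤
            C * dyadicPotential (fun k z => 4 ^ k * dyadicIndicator n k z) w M x := by
  obtain ⟨ρ, L, hL, hρ⟩ := exists_dyadic_kernels n
  obtain ⟨H, l, hHs, hl, hH01, hH0, hH1, hHd, hHd2, hHd0, -⟩ := exists_smooth_step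
  have hρs : ∀ k, ContDiff ℝ ∞ (ρ k) := fun k => (hρ k).1
  have hρc : ∀ k, HasCompactSupport (ρ k) := fun k => (hρ k).2.1
  have hρi : ∀ k, Integrable (ρ k) := fun k =>
    (hρs k).continuous.integrable_of_hasCompactSupport (hρc k)
  have hIi : ∀ (c : ℝ) (k : ℕ), Integrable fun z => c * dyadicIndicator n k z := fun c k =>
    (integrable_dyadicIndicator n k).const_mul c
  refine ⟨ρ, H, l * L + l ^ 2 * (4 * L ^ 2) + n * (l * L + l * (4 * L ^ 2)),
    by positivity, fun k => (hρ k).2.2.1, hρi, fun k => (hρ k).2.2.2.1,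
    fun k => (hρ k).2.2.2.2.1, hH01, hH0 0 (by norm_num), hH1, fun w B M hw hw0 hB => ?_⟩
  have hs := contDiff_dyadicPotential hw hB hρs hρc M
  refine ⟨hHs.comp hs, fun x => ?_⟩
  obtain ⟨P, hP⟩ : ∃ P, P = dyadicPotential ρ w M := ⟨_, rfl⟩
  obtain ⟨S, hS⟩ : ∃ S, S = dyadicPotential (fun k z => 4 ^ k * dyadicIndicator n k z) w M x :=
    ⟨_, rfl⟩
  have hmul : ∀ c : ℝ, dyadicPotential (fun k z => c * (4 ^ k * dyadicIndicator n k z)) w M x =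
      c * S := by
    intro c
    rw [hS, dyadicPotential, dyadicPotential, Finset.mul_sum]
    refine Finset.sum_congr rfl fun k _ => ?_
    rw [smear, smear, ← integral_const_mul]
    exact integral_congr_ae (Filter.Eventually.of_forall fun y => by simp only; ring)
  have hS0 : 0 ≤ S := by
    rw [hS]
    exact Finset.sum_nonneg fun k _ => smear_nonneg (hw0 k)
      (fun z => mul_nonneg (by positivity) (dyadicIndicator_nonneg n k z)) x
  have hd1 : ∀ v, ‖v‖ ≤ 1 → |fderiv ℝ P x v| ≤ L * S := by
    intro v hv
    rw [hP, fderiv_dyadicPotential hw hB hρs hρc, ← hmul]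
    refine abs_dyadicPotential_le hw hw0 hB (fun k z => ?_)
      (fun k => ((hIi (4 ^ k) k).const_mul L)) M x
    exact (((hρ k).2.2.2.2.2 v hv z).2.1).trans_eq (by ring)
  have hd2 : ∀ u v, ‖u‖ ≤ 1 → ‖v‖ ≤ 1 → |fderiv ℝ (fderiv ℝ P) x u v| ≤ L * S := by
    intro u v hu hv
    rw [hP, fderiv_fderiv_dyadicPotential hw hB hρs hρc, ← hmul]
    refine abs_dyadicPotential_le hw hw0 hB (fun k z => ?_)
      (fun k => ((hIi (4 ^ k) k).const_mul L)) M x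
    exact (((hρ k).2.2.2.2.2 v hv z).2.2 u hu).trans_eq (by ring)
  have hdτ : ∀ v, ‖v‖ ≤ 1 → ∀ τ : ℝ, 0 < τ →
      |fderiv ℝ P x v| ≤ L * τ * P x + L * τ⁻¹ * S := by
    intro v hv τ hτ
    have e : L * τ * P x + L * τ⁻¹ * S = dyadicPotential (fun k z => L * τ * ρ k z +
        L * τ⁻¹ * (4 ^ k * dyadicIndicator n k z)) w M x := by
      rw [hP, hS, dyadicPotential, dyadicPotential, dyadicPotential, Finset.mul_sum,
        Finset.mul_sum, ← Finset.sum_add_distrib]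
      refine Finset.sum_congr rfl fun k _ => ?_
      rw [smear_add_mul (hw k) (hB k) (hρi k) (hIi _ k)]
    rw [e, hP, fderiv_dyadicPotential hw hB hρs hρc]
    refine abs_dyadicPotential_le hw hw0 hB (fun k z => ?_)
      (fun k => ((hρi k).const_mul _).add ((hIi (4 ^ k) k).const_mul _)) M x
    exact (((hρ k).2.2.2.2.2 v hv z).1 τ hτ).trans_eq (by simp only [Pi.add_apply]; ring)
  have hn1 : ‖fderiv ℝ P x‖ ≤ L * S :=
    ContinuousLinearMap.opNorm_le_of_unit_norm (by positivity) fun v hv => hd1 v hv.le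
  -- The quadratic bound is available only where the potential is at most 1. Elsewhere it is not
  -- needed, because both derivatives of the truncation vanish beyond 1.
  have hn2 : P x ≤ 1 → ‖fderiv ℝ P x‖ ^ 2 ≤ 4 * L ^ 2 * S := by
    intro hPx
    have hsq : ‖fderiv ℝ P x‖ ≤ Real.sqrt (4 * L ^ 2 * S) := by
      refine ContinuousLinearMap.opNorm_le_of_unit_norm (Real.sqrt_nonneg _) fun v hv => ?_
      exact Real.le_sqrt_of_sq_le (sq_le_four_mul_of_forall_le (abs_nonneg _) hL hS0 hPx
        (hdτ v hv.le))
    calc _ ≤ Real.sqrt (4 * L ^ 2 * S) ^ 2 := by gcongr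
      _ = _ := Real.sq_sqrt (by positivity)
  have hPs : ContDiff ℝ ∞ P := hP ▸ hs
  have hPs2 : ContDiffAt ℝ 2 P x := by
    exact_mod_cast (contDiff_infty.1 hPs 2).contDiffAt
  have hH1' : ∀ t, HasDerivAt H (deriv H t) t := fun t =>
    (hHs.differentiable (by simp) t).hasDerivAt
  have hH2' : ∀ t, HasDerivAt (deriv H) (deriv (deriv H) t) t := fun t =>
    ((contDiff_infty_iff_deriv.1 hHs).2.differentiable (by simp) t).hasDerivAt
  have hsecond : ∀ i j, |secondPartial (fun x => H (P x)) i j x| ≤ (l * L + l * (4 * L ^ 2)) * S := by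
    intro i j
    rw [secondPartial_eq_fderiv, (fderiv_fderiv_comp hPs2 (Filter.Eventually.of_forall hH1')
      (hH2' _) _ _).2]
    obtain ⟨u, hu⟩ : ∃ u : 𝔼[n], u = EuclideanSpace.single i 1 := ⟨_, rfl⟩
    obtain ⟨v, hv⟩ : ∃ v : 𝔼[n], v = EuclideanSpace.single j 1 := ⟨_, rfl⟩
    have hu1 : ‖u‖ ≤ 1 := by rw [hu]; simp
    have hv1 : ‖v‖ ≤ 1 := by rw [hv]; simp
    rw [← hu, ← hv]
    have a1 : |deriv H (P x) * fderiv ℝ (fderiv ℝ P) x u v| ≤ l * (L * S) := by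
      rw [abs_mul]
      exact mul_le_mul (hHd _) (hd2 u v hu1 hv1) (abs_nonneg _) hl.le
    have a2 : |deriv (deriv H) (P x) * (fderiv ℝ P x u * fderiv ℝ P x v)| ≤
        l * (4 * L ^ 2 * S) := by
      rcases le_or_gt (P x) 1 with h | h
      · rw [abs_mul]
        refine mul_le_mul (hHd2 _) ?_ (abs_nonneg _) hl.le
        rw [abs_mul]
        have b : ∀ v, ‖v‖ ≤ 1 → |fderiv ℝ P x v| ≤ ‖fderiv ℝ P x‖ := fun v hv =>
          (fderiv ℝ P x).unit_le_opNorm v hv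
        calc _ ≤ ‖fderiv ℝ P x‖ * ‖fderiv ℝ P x‖ :=
              mul_le_mul (b u hu1) (b v hv1) (abs_nonneg _) (norm_nonneg _)
          _ ≤ _ := by rw [← sq]; exact hn2 h
      · rw [(hHd0 _ h).2, zero_mul, abs_zero]; positivity
    exact (abs_add_le _ _).trans (by linarith)
  have hfirst : ‖fderiv ℝ (fun x => H (P x)) x‖ = |deriv H (P x)| * ‖fderiv ℝ P x‖ :=
    norm_fderiv_comp (hPs2.differentiableAt (by simp)) (hH1' _)
  rw [← hP, ← hS, hfirst]
  have c1 : 0 ≤ l * L * S := by positivity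
  have c2 : 0 ≤ l ^ 2 * (4 * L ^ 2) * S := by positivity
  have c3 : 0 ≤ n * (l * L + l * (4 * L ^ 2)) * S := by positivity
  refine ⟨?_, ?_, ?_⟩
  · refine (hessianNorm_le (by positivity) hsecond).trans ?_
    linarith
  · have : |deriv H (P x)| * ‖fderiv ℝ P x‖ ≤ l * (L * S) :=
      mul_le_mul (hHd _) hn1 (norm_nonneg _) hl.le
    linarith
  · rcases le_or_gt (P x) 1 with h | h
    · have : (|deriv H (P x)| * ‖fderiv ℝ P x‖) ^ 2 ≤ l ^ 2 * (4 * L ^ 2 * S) := by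
        rw [mul_pow]
        refine mul_le_mul ?_ (hn2 h) (by positivity) (by positivity)
        exact pow_le_pow_left₀ (abs_nonneg _) (hHd _) 2
      linarith
    · rw [(hHd0 _ h).1, abs_zero, zero_mul]
      have : (0 : ℝ) ^ 2 = 0 := by norm_num
      rw [this]; linarith

end Truncation

/-! ### The cutoff φ and its majorant. -/

section SmoothTruncation

variable {n : ℕ}

local notation "𝔼[" n "]" => EuclideanSpace ℝ (Fin n)

theorem ballMass_le_sum {ι : Type*} [Fintype ι] (μ : ι → ℝ≥0∞) (z : ι → 𝔼[n]) (r : ℝ) (x : 𝔼[n]) :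
    ballMass μ z r x ≤ ∑ i, μ i :=
  Finset.sum_le_sum fun _ _ => Set.indicator_le_self _ _ _

theorem exists_mem_ball_of_dyadicMass_ne_zero {ι : Type*} [Fintype ι] {μ : ι → ℝ≥0∞}
    {z : ι → 𝔼[n]} {A : ℝ} {k : ℕ} {x : 𝔼[n]} (h : dyadicMass μ z A k x ≠ 0) :
    ∃ i, x ∈ ball (z i) (A / 2 ^ k) := by
  by_contra! hx
  refine h ?_
  rw [dyadicMass, ballMass, Finset.sum_eq_zero fun i _ => Set.indicator_of_notMem (hx i) _, mul_zero]

theorem dyadicMass_le_of_dist {ι : Type*} [Fintype ι] (μ : ι → ℝ≥0∞) (z : ι → 𝔼[n]) {A t A' : ℝ}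
    {k : ℕ} {x y : 𝔼[n]} (h : dist x y ≤ t / 2 ^ k) (hA : A + t ≤ A') :
    dyadicMass μ z A k x ≤ dyadicMass μ z A' k y := by
  unfold dyadicMass
  gcongr
  exact ballMass_le_of_dist μ z h (by rw [← add_div]; gcongr)

theorem ofReal_smear {w f : 𝔼[n] → ℝ} {B : ℝ} (hw : Measurable w) (hw0 : ∀ y, 0 ≤ w y)
    (hB : ∀ y, |w y| ≤ B) (hf : Integrable f) (hf0 : ∀ z, 0 ≤ f z) (x : 𝔼[n]) :
    ENNReal.ofReal (smear w f x) = ∫⁻ y, ENNReal.ofReal (w y) * ENNReal.ofReal (f (x - y)) := by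
  rw [smear, ofReal_integral_eq_lintegral_ofReal (integrable_smear hw hB hf x)
    (Filter.Eventually.of_forall fun y => mul_nonneg (hw0 y) (hf0 _))]
  exact lintegral_congr fun y => ENNReal.ofReal_mul (hw0 y)

/-- A smooth cutoff equal to one near `K` whose derivatives have a majorant controlled by the
Hessian energy of an arbitrary admissible function. -/
theorem exists_smooth_truncation (hn : 3 ≤ n) :
    ∃ C : ℝ≥0, ∀ K : Set 𝔼[n], IsCompact K → K ⊆ ball 0 1 →
      ∀ ψ : 𝔼[n] → ℝ, IsTestFunctionOn (ball 0 2) ψ → (∀ x ∈ K, 1 ≤ ψ x) →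
      ∃ φ : 𝔼[n] → ℝ, IsTestFunctionOn (ball 0 2) φ ∧ (∀ x, 0 ≤ φ x ∧ φ x ≤ 1) ∧
        (∃ V : Set 𝔼[n], IsOpen V ∧ K ⊆ V ∧ ∀ x ∈ V, φ x = 1) ∧
        ∃ B : 𝔼[n] → ℝ≥0∞, Measurable B ∧
          (∀ x, ENNReal.ofReal (hessianNorm φ x) ≤ B x ∧ ENNReal.ofReal ‖fderiv ℝ φ x‖ ≤ B x ∧
            ENNReal.ofReal (‖fderiv ℝ φ x‖ ^ 2) ≤ B x) ∧
          ∫⁻ x, B x ^ (((n : ℝ) + 2) / 4) ≤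
            C * ∫⁻ x, ENNReal.ofReal (hessianNorm ψ x ^ (((n : ℝ) + 2) / 4)) := by
  obtain ⟨p, hp⟩ : ∃ p, p = ((n : ℝ) + 2) / 4 := ⟨_, rfl⟩
  obtain ⟨q, hq⟩ : ∃ q, q = ((n : ℝ) + 2) / ((n : ℝ) - 2) := ⟨_, rfl⟩
  have hpq : p.HolderConjugate q := hp ▸ hq ▸ holderConjugate_critical hn
  have hq1 : 0 < q - 1 := by linarith [hpq.symm.lt]
  have hp0 : 0 < p := hpq.pos
  obtain ⟨C₁, hC₁⟩ := exists_net_equilibrium hn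
  obtain ⟨C₂, hC₂⟩ := exists_wolff (n := n) (by omega) (A := 5 / 8) (A₀ := 1 / 8) (by norm_num)
    (by norm_num) hpq
  obtain ⟨ρ, H, c, hc, hρ0, hρi, hρ1, hρs, hH01, hH0, hH1, hΨ⟩ := exists_truncation n
  obtain ⟨V, hV⟩ : ∃ V : ℝ≥0, (V : ℝ≥0∞) = volume (ball (0 : 𝔼[n]) (1 / 2)) :=
    ⟨_, ENNReal.coe_toNNReal measure_ball_lt_top.ne⟩
  obtain ⟨D, hD⟩ : ∃ D : ℝ≥0, D = Real.toNNReal c * V := ⟨_, rfl⟩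
  rw [← hp]
  rw [← hp, ← hq] at hC₁
  refine ⟨D ^ p * (C₂ * (C₁ * (n : ℝ≥0) ^ p)), fun K hK hK1 ψ hψ hψK => ?_⟩
  -- The minimisation needs at least one net point; for empty K the zero function serves.
  rcases K.eq_empty_or_nonempty with rfl | hKn
  · have h0 : ∀ x : 𝔼[n], fderiv ℝ (fun _ : 𝔼[n] => (0 : ℝ)) x = 0 := fun x => by simp
    refine ⟨fun _ => 0, ⟨contDiff_const, HasCompactSupport.zero, ?_⟩, fun x => by norm_num,
      ⟨∅, isOpen_empty, le_rfl, by simp⟩, fun _ => 0, measurable_const, fun x => ?_, ?_⟩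
    · rw [show (fun _ : 𝔼[n] => (0 : ℝ)) = 0 from rfl, tsupport_zero]; exact Set.empty_subset _
    · have : hessianNorm (fun _ : 𝔼[n] => (0 : ℝ)) x ≤ 0 := by
        refine (hessianNorm_le le_rfl fun i j => ?_).trans_eq (mul_zero (n : ℝ))
        rw [secondPartial_eq_fderiv]
        simp
      simp [this]
    · simp [ENNReal.zero_rpow_of_pos hp0]
  obtain ⟨ι, _, μ, z, N, hμ, hz, hcov, hlow, hen⟩ := hC₁ K hK hK1 hKn ψ hψ hψK
  -- The densities of the nonlinear potential appearing in the Euler-Lagrange conditions.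
  obtain ⟨w, hw⟩ : ∃ w : ℕ → 𝔼[n] → ℝ, w = fun k y =>
      2 ^ (k * (n - 2)) * (dyadicMass μ z (1 / 8) k y ^ (q - 1)).toReal := ⟨_, rfl⟩
  have hwm : ∀ k, Measurable (w k) := fun k => by rw [hw]; fun_prop
  have hw0 : ∀ k y, 0 ≤ w k y := fun k y => by rw [hw]; positivity
  have hdt : ∀ k y, dyadicMass μ z (1 / 8) k y ^ (q - 1) ≠ ⊤ := fun k y =>
    ENNReal.rpow_ne_top_of_nonneg hq1.le (dyadicMass_ne_top z hμ _ _ _)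
  have hwB : ∀ k y, |w k y| ≤ 2 ^ (k * (n - 2)) *
      ((2 ^ (k * (n - 2)) * ∑ i, μ i) ^ (q - 1)).toReal := by
    intro k y
    rw [abs_of_nonneg (hw0 k y), hw]
    have : ((2 : ℝ≥0∞) ^ (k * (n - 2)) * ∑ i, μ i) ^ (q - 1) ≠ ⊤ :=
      ENNReal.rpow_ne_top_of_nonneg hq1.le (ENNReal.mul_ne_top (by simp)
        (ENNReal.sum_ne_top.2 fun i _ => hμ i))
    simp only
    gcongr
    unfold dyadicMass
    gcongr
    exact ballMass_le_sum μ z _ _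
  have hwof : ∀ k y, ENNReal.ofReal (w k y) =
      2 ^ (k * (n - 2)) * dyadicMass μ z (1 / 8) k y ^ (q - 1) := by
    intro k y
    rw [hw]
    simp only
    rw [ENNReal.ofReal_mul (by positivity), ENNReal.ofReal_toReal (hdt k y),
      ENNReal.ofReal_pow (by norm_num)]
    simp
  obtain ⟨hs, hb⟩ := hΨ w _ (N + 1) hwm hw0 hwB
  obtain ⟨Ψ, hΨ'⟩ : ∃ Ψ, Ψ = dyadicPotential ρ w (N + 1) := ⟨_, rfl⟩
  rw [← hΨ'] at hs hb
  -- The radius is 1 + 1/8 + 1/2: net point, ball mass, kernel.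
  have hsupp : ∀ x, H (Ψ x) ≠ 0 → x ∈ closedBall (0 : 𝔼[n]) (13 / 8) := by
    intro x hx
    have h1 : Ψ x ≠ 0 := fun h => hx (by rw [h, hH0])
    rw [hΨ', dyadicPotential] at h1
    obtain ⟨k, -, hk⟩ := Finset.exists_ne_zero_of_sum_ne_zero h1
    have : ∃ y, w k y * ρ k (x - y) ≠ 0 := by
      by_contra! h
      exact hk (by rw [smear]; simp [h])
    obtain ⟨y, hy⟩ := this
    have hy1 := left_ne_zero_of_mul hy
    have hy2 := hρs k _ (right_ne_zero_of_mul hy)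
    have : dyadicMass μ z (1 / 8) k y ≠ 0 := by
      intro h
      apply hy1
      rw [hw]
      simp only
      rw [h, ENNReal.zero_rpow_of_pos hq1, ENNReal.toReal_zero, mul_zero]
    obtain ⟨i, hi⟩ := exists_mem_ball_of_dyadicMass_ne_zero this
    have hzi := hz i
    rw [mem_ball_zero_iff] at hzi hy2
    rw [mem_ball, dist_eq_norm] at hi
    rw [mem_closedBall_zero_iff]
    have e : x = (x - y) + (y - z i) + z i := by abel
    have h2 : (1 : ℝ) ≤ 2 ^ k := one_le_pow₀ (by norm_num)
    have h3 : (1 / 2 : ℝ) / 2 ^ k ≤ 1 / 2 := div_le_self (by norm_num) h2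
    have h4 : (1 / 8 : ℝ) / 2 ^ k ≤ 1 / 8 := div_le_self (by norm_num) h2
    calc ‖x‖ = ‖(x - y) + (y - z i) + z i‖ := by rw [← e]
      _ ≤ ‖x - y‖ + ‖y - z i‖ + ‖z i‖ := norm_add₃_le
      _ ≤ 13 / 8 := by linarith
  have hts : tsupport (fun x => H (Ψ x)) ⊆ closedBall 0 (13 / 8) :=
    closure_minimal hsupp isClosed_closedBall
  -- For k ≤ N, a point y within 2^{-k}/8 of zᵢ is within 2^{-k}/4 of x, where the kernel equals 1.
  -- Hence the potential at x dominates the Euler-Lagrange sum at zᵢ, and it is at least 1 on a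
  -- whole neighbourhood of K.
  have hone : ∀ i, ∀ x ∈ ball (z i) ((1 / 8) / 2 ^ N), H (Ψ x) = 1 := by
    intro i x hx
    apply hH1
    rw [← ENNReal.ofReal_le_ofReal_iff (by
      rw [hΨ']; exact Finset.sum_nonneg fun k _ => smear_nonneg (hw0 k) (hρ0 k) x),
      ENNReal.ofReal_one, hΨ', dyadicPotential,
      ENNReal.ofReal_sum_of_nonneg fun k _ => smear_nonneg (hw0 k) (hρ0 k) x]
    refine (hlow i).trans (Finset.sum_le_sum fun k hk => ?_)
    rw [ofReal_smear (hwm k) (hw0 k) (hwB k) (hρi k) (hρ0 k), ← lintegral_const_mul _ (by fun_prop)]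
    refine (lintegral_mono_ae ((ae_restrict_iff' measurableSet_ball).2
      (Filter.Eventually.of_forall fun y hy => ?_))).trans
      (setLIntegral_le_lintegral (ball (z i) ((1 / 8) / 2 ^ k)) _)
    have : x - y ∈ ball (0 : 𝔼[n]) ((1 / 4) / 2 ^ k) := by
      rw [mem_ball_zero_iff, ← dist_eq_norm]
      have h1 : (1 / 8 : ℝ) / 2 ^ N ≤ (1 / 8) / 2 ^ k := by
        gcongr
        · norm_num
        · rw [Finset.mem_range] at hk; omega
      rw [mem_ball] at hx hy
      have h2 : (1 / 4 : ℝ) / 2 ^ k = (1 / 8) / 2 ^ k + (1 / 8) / 2 ^ k := by ring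
      linarith [dist_triangle x (z i) y, dist_comm y (z i)]
    rw [hwof, hρ1 k _ this]
    simp
  obtain ⟨B, hB⟩ : ∃ B : 𝔼[n] → ℝ≥0∞, B = fun x =>
      D * ∑ k ∈ Finset.range (N + 1), dyadicMass μ z (5 / 8) k x ^ (q - 1) := ⟨_, rfl⟩
  -- The factor 4^k of two derivatives cancels exactly against the scaled volume of the kernel's
  -- support. Moving the mass from y to x enlarges the radius factor from 1/8 to 1/8 + 1/2 = 5/8.
  have hSB : ∀ x, ENNReal.ofReal (c *
      dyadicPotential (fun k z => 4 ^ k * dyadicIndicator n k z) w (N + 1) x) ≤ B x := by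
    intro x
    have hnn : ∀ k (z : 𝔼[n]), 0 ≤ 4 ^ k * dyadicIndicator n k z := fun k z =>
      mul_nonneg (by positivity) (dyadicIndicator_nonneg n k z)
    rw [ENNReal.ofReal_mul hc.le, hB, hD, dyadicPotential,
      ENNReal.ofReal_sum_of_nonneg fun k _ => smear_nonneg (hw0 k) (hnn k) x, ENNReal.coe_mul]
    simp only
    rw [mul_assoc, Finset.mul_sum (a := (V : ℝ≥0∞))]
    change ENNReal.ofReal c * _ ≤ ENNReal.ofReal c * _
    gcongr with k hk
    rw [ofReal_smear (hwm k) (hw0 k) (hwB k)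
      ((integrable_dyadicIndicator n k).const_mul _) (hnn k)]
    have hpt : ∀ y, ENNReal.ofReal (w k y) *
        ENNReal.ofReal (4 ^ k * dyadicIndicator n k (x - y)) ≤
        (ball x ((1 / 2) / 2 ^ k)).indicator
          (fun _ => 4 ^ k * (2 ^ (k * (n - 2)) * dyadicMass μ z (5 / 8) k x ^ (q - 1))) y := by
      intro y
      by_cases hy : y ∈ ball x ((1 / 2) / 2 ^ k)
      · have hxy : x - y ∈ ball (0 : 𝔼[n]) ((1 / 2) / 2 ^ k) := by
          rw [mem_ball_zero_iff, ← dist_eq_norm, dist_comm]; exact hy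
        rw [Set.indicator_of_mem hy, dyadicIndicator, Set.indicator_of_mem hxy, hwof, mul_one,
          ENNReal.ofReal_pow (by norm_num), mul_comm]
        have h4 : ENNReal.ofReal 4 = 4 := by simp
        rw [h4]
        gcongr
        exact dyadicMass_le_of_dist μ z (t := 1 / 2) (mem_ball.1 hy).le (by norm_num)
      · have hxy : x - y ∉ ball (0 : 𝔼[n]) ((1 / 2) / 2 ^ k) := by
          rw [mem_ball_zero_iff, ← dist_eq_norm, dist_comm]; exact hy
        rw [Set.indicator_of_notMem hy, dyadicIndicator, Set.indicator_of_notMem hxy]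
        simp
    refine (lintegral_mono hpt).trans ?_
    rw [lintegral_indicator measurableSet_ball, setLIntegral_const]
    have h4 : (4 : ℝ≥0∞) ^ k * 4⁻¹ ^ k = 1 := by
      rw [← mul_pow, ENNReal.mul_inv_cancel (by norm_num) (by norm_num), one_pow]
    have := two_pow_mul_volume_ball (n := n) (by omega) (A := 1 / 2) (by norm_num) k x
    calc _ = 4 ^ k * (2 ^ (k * (n - 2)) * volume (ball x ((1 / 2) / 2 ^ k))) *
          dyadicMass μ z (5 / 8) k x ^ (q - 1) := by ring
      _ = (4 ^ k * 4⁻¹ ^ k) * volume (ball (0 : 𝔼[n]) (1 / 2)) *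
          dyadicMass μ z (5 / 8) k x ^ (q - 1) := by rw [this]; ring
      _ ≤ _ := by rw [h4, one_mul, hV]
  refine ⟨fun x => H (Ψ x), ⟨hs, ?_, hts.trans (closedBall_subset_ball (by norm_num))⟩,
    fun x => hH01 _, ⟨⋃ i, ball (z i) ((1 / 8) / 2 ^ N), isOpen_iUnion fun i => isOpen_ball, hcov,
    fun x hx => ?_⟩, B, by rw [hB]; fun_prop, fun x => ?_, ?_⟩
  · exact (isCompact_closedBall _ _).of_isClosed_subset (isClosed_tsupport _) hts
  · obtain ⟨i, hi⟩ := Set.mem_iUnion.1 hx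
    exact hone i x hi
  · obtain ⟨b1, b2, b3⟩ := hb x
    exact ⟨(ENNReal.ofReal_le_ofReal b1).trans (hSB x), (ENNReal.ofReal_le_ofReal b2).trans (hSB x),
      (ENNReal.ofReal_le_ofReal b3).trans (hSB x)⟩
  -- The dual form of Wolff's inequality returns from the radius factor 5/8 to the energy with
  -- factor 1/8, which ψ controls.
  · have hw2 := (hC₂ μ z (N + 1) hμ).2
    have hlap : ∫⁻ x, ENNReal.ofReal |Laplacian.laplacian ψ x| ^ p ≤
        (n : ℝ≥0∞) ^ p * ∫⁻ x, ENNReal.ofReal (hessianNorm ψ x ^ p) := by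
      rw [← lintegral_const_mul' _ _ (ENNReal.rpow_ne_top_of_nonneg hp0.le (by simp))]
      refine lintegral_mono fun x => ?_
      rw [← ENNReal.ofReal_rpow_of_nonneg (hessianNorm_nonneg _ _) hp0.le,
        ← ENNReal.mul_rpow_of_nonneg _ _ hp0.le]
      gcongr
      refine (ENNReal.ofReal_le_ofReal (abs_laplacian_le ψ x)).trans_eq ?_
      rw [ENNReal.ofReal_mul (by positivity), ENNReal.ofReal_natCast]
    calc ∫⁻ x, B x ^ p = ∫⁻ x, (D : ℝ≥0∞) ^ p * (∑ k ∈ Finset.range (N + 1),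
          dyadicMass μ z (5 / 8) k x ^ (q - 1)) ^ p := by
          rw [hB]
          exact lintegral_congr fun x => ENNReal.mul_rpow_of_nonneg _ _ hp0.le
      _ = (D : ℝ≥0∞) ^ p * ∫⁻ x, (∑ k ∈ Finset.range (N + 1),
          dyadicMass μ z (5 / 8) k x ^ (q - 1)) ^ p :=
          lintegral_const_mul' _ _ (ENNReal.rpow_ne_top_of_nonneg hp0.le (by simp))
      _ ≤ (D : ℝ≥0∞) ^ p * (C₂ * (C₁ * ((n : ℝ≥0∞) ^ p *
          ∫⁻ x, ENNReal.ofReal (hessianNorm ψ x ^ p)))) := by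
          gcongr
          refine hw2.trans ?_
          gcongr
          refine hen.trans ?_
          gcongr
      _ = _ := by
          push_cast
          rw [ENNReal.coe_rpow_of_nonneg _ hp0.le, ENNReal.coe_rpow_of_nonneg _ hp0.le]
          push_cast
          ring

end SmoothTruncation

/-! ### Ingredients of the cutoff at infinity. -/

section Cutoff

variable {n : ℕ}

local notation "𝔼[" n "]" => EuclideanSpace ℝ (Fin n)

/-- A truncation `F` of the identity vanishing on `(-∞, 1]` with `F'' ≤ C F ^ β`. -/
theorem exists_identity_truncation {β : ℝ} (hβ : 0 < β) (hβ1 : β < 1) :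
    ∃ (F F₁ F₂ : ℝ → ℝ) (C : ℝ), 0 < C ∧ ContDiff ℝ 2 F ∧ (∀ t, HasDerivAt F (F₁ t) t) ∧
      (∀ t, HasDerivAt F₁ (F₂ t) t) ∧ (∀ t, t ≤ 1 → F t = 0) ∧ (∀ t, 2 ≤ t → F t = t) ∧
      (∀ t, 0 ≤ t → 0 ≤ F t ∧ F t ≤ t) ∧ (∀ t, 0 ≤ t → 0 ≤ F₁ t) ∧
      (∀ t, 0 ≤ t → F₂ t ≤ C * F t ^ β) ∧ (∀ t, t < 1 → F₂ t = 0) ∧ (∀ t, 2 < t → F₂ t = 0) := by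
  obtain ⟨H, L, hs, hL, h01, h0, h1, hd, hd2, hd0, hdn⟩ := exists_smooth_step
  -- Two derivatives lower the power of H from k+3 to k+1; the choice of k ensures (k+3)β ≤ k+1, so
  -- F^β still dominates.
  obtain ⟨k, hk⟩ := exists_nat_ge (2 / (1 - β))
  obtain ⟨c, hc⟩ : ∃ c : ℝ, c = (k + 3 : ℕ) := ⟨_, rfl⟩
  have hcpos : 0 < c := by rw [hc]; positivity
  have hc3 : 3 ≤ c := by rw [hc]; push_cast; linarith [(Nat.cast_nonneg k : (0 : ℝ) ≤ k)]
  have hD : ∀ t, HasDerivAt (fun t => H (t / 2)) (deriv H (t / 2) / 2) t := fun t => by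
    have := (hs.differentiable (by simp) (t / 2)).hasDerivAt.comp t ((hasDerivAt_id t).div_const 2)
    exact this.congr_deriv (by ring)
  have hD2 : ∀ t, HasDerivAt (fun t => deriv H (t / 2) / 2) (deriv (deriv H) (t / 2) / 4) t :=
    fun t => by
      have := (((contDiff_infty_iff_deriv.1 hs).2.differentiable (by simp)
        (t / 2)).hasDerivAt.comp t ((hasDerivAt_id t).div_const 2)).div_const 2
      exact this.congr_deriv (by ring)
  refine ⟨fun t => t * H (t / 2) ^ (k + 3),
    fun t => H (t / 2) ^ (k + 3) + t * (c * H (t / 2) ^ (k + 2) * (deriv H (t / 2) / 2)),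
    fun t => 2 * (c * H (t / 2) ^ (k + 2) * (deriv H (t / 2) / 2)) +
      t * (c * ((c - 1) * H (t / 2) ^ (k + 1) * (deriv H (t / 2) / 2)) * (deriv H (t / 2) / 2) +
        c * H (t / 2) ^ (k + 2) * (deriv (deriv H) (t / 2) / 4)),
    2 * (c * L) + 2 * (c * ((c - 1) * L) * L + c * L), ?_, ?_, ?_, ?_, ?_, ?_, ?_, ?_, ?_, ?_, ?_⟩
  · have : 0 ≤ c - 1 := by linarith
    positivity
  · have : ContDiff ℝ 2 H := by exact_mod_cast contDiff_infty.1 hs 2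
    fun_prop
  · intro t
    have := (hasDerivAt_id t).mul ((hD t).pow (k + 3))
    refine this.congr_deriv ?_
    simp only [id, hc]
    push_cast
    norm_num
  · intro t
    have h3 := (hD t).pow (k + 3)
    have h2 := (hD t).pow (k + 2)
    have := h3.add ((hasDerivAt_id t).mul ((h2.const_mul c).mul (hD2 t)))
    refine this.congr_deriv ?_
    have e1 : k + 3 - 1 = k + 2 := by omega
    have e2 : k + 2 - 1 = k + 1 := by omega
    simp only [id, hc, Pi.pow_apply, Pi.mul_apply, e1, e2]
    push_cast
    ring
  · intro t ht
    simp only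
    rw [h0 _ (by linarith), zero_pow (by omega), mul_zero]
  · intro t ht
    simp only
    rw [h1 _ (by linarith), one_pow, mul_one]
  · intro t ht
    have := h01 (t / 2)
    exact ⟨mul_nonneg ht (pow_nonneg this.1 _),
      mul_le_of_le_one_right ht (pow_le_one₀ this.1 this.2)⟩
  · intro t ht
    have := (h01 (t / 2)).1
    have := hdn (t / 2)
    positivity
  · intro t ht
    have hn := h01 (t / 2)
    have hF : 0 ≤ (t * H (t / 2) ^ (k + 3)) ^ β := by
      have := hn.1
      positivity
    have hc1 : 0 ≤ c - 1 := by linarith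
    have hC : 0 ≤ 2 * (c * L) + 2 * (c * ((c - 1) * L) * L + c * L) := by positivity
    rcases lt_or_ge t 1 with h | h
    · simp only
      rw [h0 (t / 2) (by linarith)]
      rw [zero_pow (by omega), zero_pow (by omega), zero_pow (by omega)]
      simp [Real.zero_rpow hβ.ne']
    rcases lt_or_ge 2 t with h' | h'
    · simp only
      rw [(hd0 _ (by linarith : 1 < t / 2)).1, (hd0 _ (by linarith : 1 < t / 2)).2]
      have := mul_nonneg hC hF
      simpa using this
    obtain ⟨s, hs⟩ : ∃ s, s = H (t / 2) := ⟨_, rfl⟩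
    obtain ⟨d, hdd⟩ : ∃ d, d = deriv H (t / 2) / 2 := ⟨_, rfl⟩
    obtain ⟨e, he⟩ : ∃ e, e = deriv (deriv H) (t / 2) / 4 := ⟨_, rfl⟩
    have hd1 : d ≤ L := by have := (abs_le.1 (hd (t / 2))).2; rw [hdd]; linarith
    have hdn0 : 0 ≤ d := by rw [hdd]; have := hdn (t / 2); positivity
    have he1 : e ≤ L := by have := (abs_le.1 (hd2 (t / 2))).2; rw [he]; linarith
    simp only
    rw [← hs, ← hdd, ← he]
    rw [← hs] at hn
    have hs21 : s ^ (k + 2) ≤ s ^ (k + 1) := pow_le_pow_of_le_one hn.1 hn.2 (by omega)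
    have hs1 : 0 ≤ s ^ (k + 1) := pow_nonneg hn.1 _
    have hs2 : 0 ≤ s ^ (k + 2) := pow_nonneg hn.1 _
    have hkey : s ^ (k + 1) ≤ (t * s ^ (k + 3)) ^ β := by
      calc s ^ (k + 1) = s ^ ((k + 1 : ℕ) : ℝ) := (Real.rpow_natCast _ _).symm
        _ ≤ s ^ (((k + 3 : ℕ) : ℝ) * β) := by
            refine Real.rpow_le_rpow_of_exponent_ge' hn.1 hn.2 (by positivity) ?_
            rw [div_le_iff₀ (by linarith)] at hk
            push_cast
            nlinarith
        _ = (1 * s ^ (k + 3)) ^ β := by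
            rw [one_mul, ← Real.rpow_natCast s (k + 3), ← Real.rpow_mul hn.1]
        _ ≤ _ := by
            have := pow_nonneg hn.1 (k + 3)
            gcongr
    refine le_trans ?_ (mul_le_mul_of_nonneg_left hkey hC)
    have t1 : c * s ^ (k + 2) * d ≤ c * s ^ (k + 1) * L := by gcongr
    have t2 : c * ((c - 1) * s ^ (k + 1) * d) * d ≤ c * ((c - 1) * s ^ (k + 1) * L) * L := by gcongr
    have t3 : c * s ^ (k + 2) * e ≤ c * s ^ (k + 1) * L := by
      calc _ ≤ c * s ^ (k + 2) * L := by gcongr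
        _ ≤ _ := by gcongr
    have t4 : t * (c * ((c - 1) * s ^ (k + 1) * d) * d + c * s ^ (k + 2) * e) ≤
        2 * (c * ((c - 1) * s ^ (k + 1) * L) * L + c * s ^ (k + 1) * L) := by
      calc _ ≤ t * (c * ((c - 1) * s ^ (k + 1) * L) * L + c * s ^ (k + 1) * L) := by gcongr
        _ ≤ _ := by gcongr
    linarith
  · intro t ht
    simp only
    rw [h0 (t / 2) (by linarith), zero_pow (by omega), zero_pow (by omega)]
    simp
  · intro t ht
    simp only
    rw [(hd0 _ (by linarith : 1 < t / 2)).1, (hd0 _ (by linarith : 1 < t / 2)).2]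
    simp

/-- The gradient of |x|^{2-n} is of size |x|^{1-n}, that is, the function to the power (n-1)/(n-2).
Regularisation keeps this as an inequality, so the gradient is small where the kernel is small. -/
theorem norm_fderiv_regKernel_sq_le (hn : 3 ≤ n) {R a : ℝ} (hR : R ≠ 0) (ha : 0 < a) {x : 𝔼[n]}
    (h : a * regKernel R 0 x ≤ 2) :
    ‖fderiv ℝ (regKernel R 0) x‖ ^ 2 ≤
      ((n : ℝ) - 2) ^ 2 * (2 / a) ^ (2 * ((n : ℝ) - 1) / ((n : ℝ) - 2)) := by
  have hn3 : (3 : ℝ) ≤ n := by exact_mod_cast hn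
  have hs := regKernel_base_pos hR (0 : 𝔼[n]) x
  obtain ⟨s, hsd⟩ : ∃ s, s = R ^ 2 + ‖x - 0‖ ^ 2 := ⟨_, rfl⟩
  rw [norm_fderiv_regKernel_sq hR, mul_assoc]
  rw [regKernel] at h
  rw [← hsd] at hs h ⊢
  gcongr
  have h1 : ‖x - 0‖ ^ 2 ≤ s := by rw [hsd]; nlinarith [sq_nonneg R]
  calc ‖x - 0‖ ^ 2 * s ^ (-(n : ℝ)) ≤ s * s ^ (-(n : ℝ)) := by gcongr
    _ = (s ^ (-(((n : ℝ) - 2) / 2))) ^ (2 * ((n : ℝ) - 1) / ((n : ℝ) - 2)) := by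
        rw [← Real.rpow_mul hs.le]
        nth_rw 1 [← Real.rpow_one s]
        rw [← Real.rpow_add hs]
        congr 1
        have : (n : ℝ) - 2 ≠ 0 := by linarith
        field_simp
        ring
    _ ≤ _ := by
        refine Real.rpow_le_rpow (by positivity) ?_ (div_nonneg (by linarith) (by linarith))
        rw [le_div_iff₀ ha, mul_comm]
        exact h

/-- The kernel is at most |x|^{2-n}. This bounds the support of the cutoff and hence the volume on
which its error lives. -/
theorem norm_le_of_one_le_mul_regKernel (hn : 3 ≤ n) {R a : ℝ} (hR : R ≠ 0) {x : 𝔼[n]}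
    (h : 1 ≤ a * regKernel R 0 x) : ‖x‖ ≤ a ^ (1 / ((n : ℝ) - 2)) := by
  have hn3 : (3 : ℝ) ≤ n := by exact_mod_cast hn
  have hs := regKernel_base_pos hR (0 : 𝔼[n]) x
  obtain ⟨s, hsd⟩ : ∃ s, s = R ^ 2 + ‖x - 0‖ ^ 2 := ⟨_, rfl⟩
  rw [regKernel] at h
  rw [← hsd] at hs h
  have h1 : ‖x‖ ^ 2 ≤ s := by rw [hsd, sub_zero]; nlinarith [sq_nonneg R]
  rw [Real.rpow_neg hs.le, ← div_eq_mul_inv, le_div_iff₀ (by positivity), one_mul] at h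
  have h2 : ‖x‖ ^ ((n : ℝ) - 2) ≤ a := by
    refine le_trans ?_ h
    calc ‖x‖ ^ ((n : ℝ) - 2) = (‖x‖ ^ 2) ^ (((n : ℝ) - 2) / 2) := by
          rw [← Real.rpow_natCast, ← Real.rpow_mul (norm_nonneg _)]
          congr 1
          push_cast
          ring
      _ ≤ _ := Real.rpow_le_rpow (by positivity) h1 (by linarith)
  calc ‖x‖ = (‖x‖ ^ ((n : ℝ) - 2)) ^ (1 / ((n : ℝ) - 2)) := by
        rw [← Real.rpow_mul (norm_nonneg _), mul_one_div_cancel (by linarith), Real.rpow_one]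
    _ ≤ _ := Real.rpow_le_rpow (by positivity) h2 (div_nonneg zero_le_one (by linarith))

theorem mul_regKernel_le_one (hn : 3 ≤ n) {R : ℝ} (hR : 0 < R) (x : 𝔼[n]) :
    (R ^ 2) ^ (((n : ℝ) - 2) / 2) * regKernel R 0 x ≤ 1 := by
  have hn3 : (3 : ℝ) ≤ n := by exact_mod_cast hn
  have hs := regKernel_base_pos hR.ne' (0 : 𝔼[n]) x
  rw [regKernel, Real.rpow_neg hs.le, ← div_eq_mul_inv, div_le_one (by positivity)]
  exact Real.rpow_le_rpow (by positivity) (by nlinarith [sq_nonneg ‖x - 0‖]) (by linarith)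

/-- For |x| ≤ R/n the ratio is at least the inverse of (1 + 1/n)^{(n-2)/2}, and that power is at
most e^{1/2} < 2. -/
theorem half_le_mul_regKernel (hn : 3 ≤ n) {R : ℝ} (hR : 0 < R) {x : 𝔼[n]}
    (hx : n * ‖x‖ ≤ R) : 1 / 2 ≤ (R ^ 2) ^ (((n : ℝ) - 2) / 2) * regKernel R 0 x := by
  have hn3 : (3 : ℝ) ≤ n := by exact_mod_cast hn
  have hs := regKernel_base_pos hR.ne' (0 : 𝔼[n]) x
  rw [regKernel, Real.rpow_neg hs.le, ← div_eq_mul_inv, le_div_iff₀ (by positivity)]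
  have h1 : R ^ 2 + ‖x - 0‖ ^ 2 ≤ R ^ 2 * Real.exp (1 / n) := by
    rw [sub_zero]
    have h2 : 1 + 1 / (n : ℝ) ≤ Real.exp (1 / n) := by
      linarith [Real.add_one_le_exp (1 / (n : ℝ))]
    have h3 : ‖x‖ ^ 2 ≤ R ^ 2 * (1 / n) := by
      have h4 : (n * ‖x‖) ^ 2 ≤ R ^ 2 := by gcongr
      rw [mul_one_div, le_div_iff₀ (by positivity)]
      have h5 : ‖x‖ ^ 2 * n ≤ (n * ‖x‖) ^ 2 := by
        rw [mul_pow]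
        nlinarith [sq_nonneg ‖x‖, mul_nonneg (sq_nonneg ‖x‖) (by positivity : (0 : ℝ) ≤ n)]
      linarith
    calc _ ≤ R ^ 2 * (1 + 1 / (n : ℝ)) := by linarith
      _ ≤ _ := by gcongr
  have h6 : Real.exp (1 / (n : ℝ)) ^ (((n : ℝ) - 2) / 2) ≤ 2 := by
    rw [← Real.exp_mul]
    calc _ ≤ Real.exp (1 / 2) := by
          apply Real.exp_le_exp.2
          rw [one_div_mul_eq_div, div_le_iff₀ (by positivity)]
          linarith
      _ ≤ 2 := by
          have := Real.exp_one_lt_d9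
          have h7 : Real.exp (1 / 2) ^ 2 = Real.exp 1 := by rw [← Real.exp_nat_mul]; norm_num
          nlinarith [Real.exp_pos (1 / 2)]
  calc 1 / 2 * (R ^ 2 + ‖x - 0‖ ^ 2) ^ (((n : ℝ) - 2) / 2)
      ≤ 1 / 2 * (R ^ 2 * Real.exp (1 / n)) ^ (((n : ℝ) - 2) / 2) := by
        gcongr
        linarith
    _ = 1 / 2 * ((R ^ 2) ^ (((n : ℝ) - 2) / 2) * Real.exp (1 / n) ^ (((n : ℝ) - 2) / 2)) := by
        rw [Real.mul_rpow (by positivity) (by positivity)]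
    _ ≤ 1 / 2 * ((R ^ 2) ^ (((n : ℝ) - 2) / 2) * 2) := by gcongr
    _ = _ := by ring

end Cutoff

/-! ### Almost superharmonic cutoffs at infinity. -/

section SuperharmonicCutoff

variable {n : ℕ}

local notation "𝔼[" n "]" => EuclideanSpace ℝ (Fin n)

theorem mul_norm_fderiv_regKernel_le_one (hn : 3 ≤ n) {R : ℝ} (hR : 2 * n ≤ R) {x : 𝔼[n]}
    (hx : ‖x‖ < 2) :
    (R ^ 2) ^ (((n : ℝ) - 2) / 2) * ‖fderiv ℝ (regKernel R 0) x‖ ≤ 1 := by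
  have hn3 : (3 : ℝ) ≤ n := by exact_mod_cast hn
  have hR0 : 0 < R := by linarith
  have hs := regKernel_base_pos hR0.ne' (0 : 𝔼[n]) x
  rw [← abs_of_nonneg (a := (R ^ 2) ^ (((n : ℝ) - 2) / 2) * ‖fderiv ℝ (regKernel R 0) x‖)
    (by positivity), ← sq_le_one_iff_abs_le_one, mul_pow, norm_fderiv_regKernel_sq hR0.ne']
  have e1 : ((R ^ 2) ^ (((n : ℝ) - 2) / 2)) ^ 2 = (R ^ 2) ^ ((n : ℝ) - 2) := by
    rw [← Real.rpow_natCast, ← Real.rpow_mul (by positivity)]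
    congr 1
    push_cast
    ring
  have e2 : (R ^ 2 + ‖x - 0‖ ^ 2) ^ (-(n : ℝ)) ≤ (R ^ 2) ^ (-(n : ℝ)) :=
    Real.rpow_le_rpow_of_nonpos (by positivity) (by nlinarith [sq_nonneg ‖x - 0‖]) (by linarith)
  have e3 : (R ^ 2) ^ ((n : ℝ) - 2) * (R ^ 2) ^ (-(n : ℝ)) = (R ^ 4)⁻¹ := by
    rw [← Real.rpow_add (by positivity), show (n : ℝ) - 2 + -n = -(2 : ℕ) by push_cast; ring,
      Real.rpow_neg (by positivity), Real.rpow_natCast, ← pow_mul]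
  rw [e1]
  calc _ ≤ (R ^ 2) ^ ((n : ℝ) - 2) * (((n : ℝ) - 2) ^ 2 * 2 ^ 2 * (R ^ 2) ^ (-(n : ℝ))) := by
        gcongr
        rw [sub_zero]
        exact hx.le
    _ = ((n : ℝ) - 2) ^ 2 * 2 ^ 2 * ((R ^ 2) ^ ((n : ℝ) - 2) * (R ^ 2) ^ (-(n : ℝ))) := by ring
    _ ≤ 1 := by
        rw [e3, ← div_eq_mul_inv, div_le_one (by positivity)]
        have h1 : ((n : ℝ) - 2) * 2 ≤ R := by linarith
        have h2 : (((n : ℝ) - 2) * 2) ^ 2 ≤ R ^ 2 :=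
          pow_le_pow_left₀ (by linarith) h1 2
        have h3 : (1 : ℝ) ≤ R ^ 2 := by nlinarith
        nlinarith

/-- Cutoff functions on arbitrarily large balls whose Laplacian is almost nonpositive, measured
at the critical exponent. -/
theorem exists_superharmonic_cutoff (hn : 3 ≤ n) {r δ : ℝ} (hr : 2 ≤ r) (hδ : 0 < δ) :
    ∃ W Q : 𝔼[n] → ℝ, ContDiff ℝ 2 W ∧ HasCompactSupport W ∧ (∀ x, 0 ≤ W x ∧ W x ≤ 1) ∧
      (∀ x ∈ ball (0 : 𝔼[n]) r, 1 / 2 ≤ W x) ∧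
      (∀ x ∈ ball (0 : 𝔼[n]) 2, ‖fderiv ℝ W x‖ ≤ 1) ∧ Measurable Q ∧ (∀ x, 0 ≤ Q x) ∧
      (∀ x, Laplacian.laplacian W x ≤ Q x * W x ^ (((n : ℝ) + 2) / ((n : ℝ) - 2))⁻¹) ∧
      ∫⁻ x, ENNReal.ofReal (Q x) ^ (((n : ℝ) + 2) / 4) ≤ ENNReal.ofReal δ := by
  obtain ⟨p, hp⟩ : ∃ p, p = ((n : ℝ) + 2) / 4 := ⟨_, rfl⟩
  obtain ⟨q, hq⟩ : ∃ q, q = ((n : ℝ) + 2) / ((n : ℝ) - 2) := ⟨_, rfl⟩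
  have hpq : p.HolderConjugate q := hp ▸ hq ▸ holderConjugate_critical hn
  rw [← hp, ← hq]
  have hn3 : (3 : ℝ) ≤ n := by exact_mod_cast hn
  have hq0 : 0 < q⁻¹ := inv_pos.2 hpq.symm.pos
  have hp0 : 0 < p := hpq.pos
  obtain ⟨F, F₁, F₂, C, hC, hFs, hF1, hF2, hF0, hFid, hFle, hF1n, hF2le, hF2z, hF2z'⟩ :=
    exists_identity_truncation hq0 (inv_lt_one_of_one_lt₀ hpq.symm.lt)
  -- Flat enough for the normalised kernel to stay above 1/2 on B(0,r) and to have gradient at most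
  -- 1 on B(0,2).
  obtain ⟨R, hR⟩ : ∃ R : ℝ, R = n * r := ⟨_, rfl⟩
  have hR2 : 2 * n ≤ R := by rw [hR]; nlinarith
  have hR0 : 0 < R := by linarith
  obtain ⟨b, hb⟩ : ∃ b : ℝ, b = (R ^ 2) ^ (((n : ℝ) - 2) / 2) := ⟨_, rfl⟩
  have hb0 : 0 < b := by rw [hb]; positivity
  obtain ⟨τ, hτ⟩ : ∃ τ : ℝ, τ = 2 * ((n : ℝ) - 1) / ((n : ℝ) - 2) := ⟨_, rfl⟩
  obtain ⟨D, hD⟩ : ∃ D : ℝ, D = C * ((n : ℝ) - 2) ^ 2 * 2 ^ τ := ⟨_, rfl⟩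
  have hn2 : 0 < (n : ℝ) - 2 := by linarith
  have hD0 : 0 < D := by rw [hD]; positivity
  obtain ⟨ν, hν⟩ : ∃ ν : ℝ, ν = (volume (ball (0 : 𝔼[n]) 1)).toReal := ⟨_, rfl⟩
  have hν0 : 0 ≤ ν := by rw [hν]; positivity
  obtain ⟨Z, hZ⟩ : ∃ Z : ℝ, Z = D ^ p * b ^ (1 / 2 : ℝ) * ν + 1 := ⟨_, rfl⟩
  have hZ0 : 0 < Z := by rw [hZ]; positivity
  -- The cutoff is ε F(a g) with a = b/ε: it equals the superharmonic b g where b g ≥ 2ε and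
  -- vanishes where b g ≤ ε. The bound ε ≤ 1/8 puts B(0,r) in the first region; the last condition
  -- makes the error small.
  obtain ⟨ε, hε0, hε8, hεδ⟩ : ∃ ε : ℝ, 0 < ε ∧ ε ≤ 1 / 8 ∧ Z * ε ^ (1 / 2 : ℝ) ≤ δ := by
    refine ⟨min (1 / 8) ((δ / Z) ^ 2), by positivity, min_le_left _ _, ?_⟩
    calc Z * (min (1 / 8) ((δ / Z) ^ 2)) ^ (1 / 2 : ℝ) ≤ Z * ((δ / Z) ^ 2) ^ (1 / 2 : ℝ) := by
          gcongr
          exact min_le_right _ _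
      _ = δ := by
          rw [← Real.sqrt_eq_rpow, Real.sqrt_sq (by positivity)]
          field_simp
  obtain ⟨a, ha⟩ : ∃ a : ℝ, a = b / ε := ⟨_, rfl⟩
  have ha0 : 0 < a := by rw [ha]; positivity
  have hεa : ε * a = b := by rw [ha]; field_simp
  obtain ⟨g, hg⟩ : ∃ g : 𝔼[n] → ℝ, g = regKernel R 0 := ⟨_, rfl⟩
  have hg0 : ∀ x, 0 < g x := fun x => hg ▸ regKernel_pos hR0.ne' 0 x
  have hgs : ContDiff ℝ 2 g := hg ▸ contDiff_regKernel hR0.ne' 0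
  have hag : ∀ x, 0 < a * g x := fun x => mul_pos ha0 (hg0 x)
  have hbg : ∀ x, b * g x = ε * (a * g x) := fun x => by rw [← mul_assoc, hεa]
  obtain ⟨M, hM⟩ : ∃ M : ℝ, M = D * ε ^ p⁻¹ * a ^ (-(2 / ((n : ℝ) - 2))) := ⟨_, rfl⟩
  have hM0 : 0 < M := by rw [hM]; positivity
  obtain ⟨P, hP⟩ : ∃ P : ℝ, P = a ^ (1 / ((n : ℝ) - 2)) := ⟨_, rfl⟩
  have hP0 : 0 < P := by rw [hP]; positivity
  have hbig : ∀ x : 𝔼[n], ‖x‖ ≤ r → 4 ≤ a * g x := by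
    intro x hx
    have h1 : 1 / 2 ≤ b * g x := by
      rw [hb, hg]
      exact half_le_mul_regKernel hn hR0 (by rw [hR]; gcongr)
    rw [hbg] at h1
    by_contra! h
    have : ε * (a * g x) < 1 / 8 * 4 :=
      mul_lt_mul' hε8 h (hag x).le (by norm_num)
    linarith
  have hball : ∀ x : 𝔼[n], 1 ≤ a * g x → x ∈ closedBall (0 : 𝔼[n]) P := by
    intro x hx
    rw [mem_closedBall_zero_iff, hP]
    exact norm_le_of_one_le_mul_regKernel hn hR0.ne' (hg ▸ hx)
  have hh1 : ∀ t, HasDerivAt (fun t => ε * F (a * t)) (b * F₁ (a * t)) t := fun t => by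
    have := ((hF1 (a * t)).comp t ((hasDerivAt_id t).const_mul a)).const_mul ε
    exact this.congr_deriv (by rw [← hεa]; ring)
  have hh2 : ∀ t, HasDerivAt (fun t => b * F₁ (a * t)) (b * a * F₂ (a * t)) t := fun t => by
    have := ((hF2 (a * t)).comp t ((hasDerivAt_id t).const_mul a)).const_mul b
    exact this.congr_deriv (by ring)
  have hsupp : ∀ x, ε * F (a * g x) ≠ 0 → x ∈ closedBall (0 : 𝔼[n]) P := by
    intro x hx
    refine hball x ?_
    by_contra! h
    exact hx (by rw [hF0 _ h.le, mul_zero])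
  refine ⟨fun x => ε * F (a * g x), (closedBall (0 : 𝔼[n]) P).indicator fun _ => M, ?_,
    HasCompactSupport.intro (isCompact_closedBall 0 P) fun x hx => by
      by_contra h; exact hx (hsupp x h), fun x => ⟨?_, ?_⟩, fun x hx => ?_, fun x hx => ?_,
    measurable_const.indicator measurableSet_closedBall,
    fun x => Set.indicator_nonneg (fun _ _ => hM0.le) x, fun x => ?_, ?_⟩
  · exact contDiff_const.mul (hFs.comp (contDiff_const.mul hgs))
  · exact mul_nonneg hε0.le (hFle _ (hag x).le).1
  · calc ε * F (a * g x) ≤ ε * (a * g x) := by gcongr; exact (hFle _ (hag x).le).2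
      _ = b * g x := (hbg x).symm
      _ ≤ 1 := by rw [hb, hg]; exact mul_regKernel_le_one hn hR0 x
  · rw [mem_ball_zero_iff] at hx
    have h4 := hbig x hx.le
    simp only
    rw [hFid _ (by linarith), ← hbg, hb, hg]
    exact half_le_mul_regKernel hn hR0 (by rw [hR]; gcongr)
  · rw [mem_ball_zero_iff] at hx
    have h4 := hbig x (hx.le.trans hr)
    refine (norm_fderiv_comp (h := fun t => ε * F (a * t)) (h₁ := fun t => b * F₁ (a * t))
      (hgs.differentiable (by norm_num) x) (hh1 (g x))).trans_le ?_
    have : F₁ (a * g x) = 1 := by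
      refine (hF1 _).unique ((hasDerivAt_id (a * g x)).congr_of_eventuallyEq ?_)
      filter_upwards [lt_mem_nhds (show (2 : ℝ) < a * g x by linarith)] with t ht
      exact hFid t ht.le
    rw [this, mul_one, abs_of_pos hb0, hb, hg]
    exact mul_norm_fderiv_regKernel_le_one hn hR2 hx
  · rw [laplacian_comp hgs.contDiffAt (Filter.Eventually.of_forall hh1) (hh2 _)]
    have hlap : b * F₁ (a * g x) * Laplacian.laplacian g x ≤ 0 := by
      refine mul_nonpos_of_nonneg_of_nonpos (mul_nonneg hb0.le (hF1n _ (hag x).le)) ?_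
      rw [hg, laplacian_regKernel hR0.ne']
      have := regKernel_base_pos hR0.ne' (0 : 𝔼[n]) x
      have : 0 ≤ n * (n - 2) * R ^ 2 * (R ^ 2 + ‖x - 0‖ ^ 2) ^ (-(((n : ℝ) + 2) / 2)) := by
        positivity
      linarith
    have hFn := (hFle _ (hag x).le).1
    have hrhs : 0 ≤ (closedBall (0 : 𝔼[n]) P).indicator (fun _ => M) x *
        (ε * F (a * g x)) ^ q⁻¹ :=
      mul_nonneg (Set.indicator_nonneg (fun _ _ => hM0.le) x) (by positivity)
    rcases lt_or_ge (a * g x) 1 with h | h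
    · rw [hF2z _ h, mul_zero, zero_mul]; linarith
    rcases lt_or_ge 2 (a * g x) with h' | h'
    · rw [hF2z' _ h', mul_zero, zero_mul]; linarith
    rw [Set.indicator_of_mem (hball x h)]
    have hgr : ‖fderiv ℝ g x‖ ^ 2 ≤ ((n : ℝ) - 2) ^ 2 * (2 / a) ^ τ := by
      rw [hτ, hg]
      exact norm_fderiv_regKernel_sq_le hn hR0.ne' ha0 (hg ▸ h')
    have h2 : b * a * F₂ (a * g x) * ‖fderiv ℝ g x‖ ^ 2 ≤
        b * a * (C * F (a * g x) ^ q⁻¹) * (((n : ℝ) - 2) ^ 2 * (2 / a) ^ τ) := by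
      gcongr
      exact hF2le _ (hag x).le
    -- The prefactor ε is split by conjugacy: ε^{1/q} completes F^{1/q} to W^{1/q}, and ε^{1/p}
    -- remains in the error.
    have e1 : ε ^ p⁻¹ * ε ^ q⁻¹ = ε := by
      rw [← Real.rpow_add hε0, hpq.inv_add_inv_eq_one, Real.rpow_one]
    have e2 : a ^ (-(2 / ((n : ℝ) - 2))) = a ^ 2 / a ^ τ := by
      rw [← Real.rpow_natCast, ← Real.rpow_sub ha0, hτ]
      congr 1
      push_cast
      field_simp
      ring
    have h3 : b * a * (C * F (a * g x) ^ q⁻¹) * (((n : ℝ) - 2) ^ 2 * (2 / a) ^ τ) =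
        M * (ε * F (a * g x)) ^ q⁻¹ := by
      rw [Real.mul_rpow hε0.le hFn, hM, hD, e2, Real.div_rpow (by norm_num) ha0.le, ← hεa]
      calc _ = ε * (C * ((n : ℝ) - 2) ^ 2 * 2 ^ τ * (a ^ 2 / a ^ τ) * F (a * g x) ^ q⁻¹) := by ring
        _ = (ε ^ p⁻¹ * ε ^ q⁻¹) *
            (C * ((n : ℝ) - 2) ^ 2 * 2 ^ τ * (a ^ 2 / a ^ τ) * F (a * g x) ^ q⁻¹) := by rw [e1]
        _ = _ := by ring
    linarith
  · have hind : ∀ x : 𝔼[n], ENNReal.ofReal ((closedBall (0 : 𝔼[n]) P).indicator (fun _ => M) x) ^ p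
        = (closedBall (0 : 𝔼[n]) P).indicator (fun _ => ENNReal.ofReal (M ^ p)) x := by
      intro x
      by_cases hx : x ∈ closedBall (0 : 𝔼[n]) P
      · rw [Set.indicator_of_mem hx, Set.indicator_of_mem hx,
          ENNReal.ofReal_rpow_of_nonneg hM0.le hp0.le]
      · rw [Set.indicator_of_notMem hx, Set.indicator_of_notMem hx, ENNReal.ofReal_zero,
          ENNReal.zero_rpow_of_pos hp0]
    simp_rw [hind]
    have : Nonempty (Fin n) := ⟨⟨0, by omega⟩⟩
    rw [lintegral_indicator measurableSet_closedBall, setLIntegral_const,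
      Measure.addHaar_closedBall _ _ hP0.le, finrank_euclideanSpace, Fintype.card_fin,
      ← ENNReal.ofReal_toReal (measure_ball_lt_top (μ := volume) (x := (0 : 𝔼[n])) (r := 1)).ne,
      ← hν, ← ENNReal.ofReal_mul (by positivity), ← ENNReal.ofReal_mul (by positivity)]
    refine ENNReal.ofReal_le_ofReal ?_
    -- The exponent of a is n/(n-2) - 2p/(n-2) = 1/2. As a = b/ε, the total is of order ε^{1/2},
    -- which tends to 0 with ε.
    have e1 : M ^ p * P ^ n = D ^ p * ε * a ^ (1 / 2 : ℝ) := by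
      rw [hM, hP, Real.mul_rpow (by positivity) (by positivity),
        Real.mul_rpow (by positivity) (by positivity), ← Real.rpow_mul hε0.le,
        inv_mul_cancel₀ hp0.ne', Real.rpow_one, ← Real.rpow_natCast, ← Real.rpow_mul ha0.le,
        ← Real.rpow_mul ha0.le, mul_assoc (D ^ p * ε), ← Real.rpow_add ha0]
      congr 2
      rw [hp]
      field_simp
      ring
    have e2 : ε * a ^ (1 / 2 : ℝ) = b ^ (1 / 2 : ℝ) * ε ^ (1 / 2 : ℝ) := by
      rw [ha, Real.div_rpow hb0.le hε0.le]
      have h1 : ε ^ (1 / 2 : ℝ) * ε ^ (1 / 2 : ℝ) = ε := by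
        rw [← Real.rpow_add hε0]; norm_num
      have h2 : 0 < ε ^ (1 / 2 : ℝ) := by positivity
      field_simp
      nlinarith
    calc M ^ p * (P ^ n * ν) = D ^ p * b ^ (1 / 2 : ℝ) * ν * ε ^ (1 / 2 : ℝ) := by
          rw [← mul_assoc, e1, mul_assoc (D ^ p), e2]; ring
      _ ≤ Z * ε ^ (1 / 2 : ℝ) := by
          gcongr
          rw [hZ]; linarith
      _ ≤ δ := hεδ

end SuperharmonicCutoff

/-! ### Laplacian bounds for η and for η times a cutoff at infinity. -/

section PowerCutoff

variable {n : ℕ}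

local notation "𝔼[" n "]" => EuclideanSpace ℝ (Fin n)

theorem ofReal_integral_le_lintegral_ofReal {α : Type*} [MeasurableSpace α] {μ : Measure α}
    (f : α → ℝ) : ENNReal.ofReal (∫ x, f x ∂μ) ≤ ∫⁻ x, ENNReal.ofReal (f x) ∂μ := by
  by_cases hf : Integrable f μ
  · rw [integral_eq_lintegral_pos_part_sub_lintegral_neg_part hf]
    exact (ENNReal.ofReal_le_ofReal (sub_le_self _ ENNReal.toReal_nonneg)).trans
      ENNReal.ofReal_toReal_le
  · rw [integral_undef hf, ENNReal.ofReal_zero]; exact zero_le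

/-- Derivative bounds for powers of `1 - φ`. -/
theorem power_cutoff_bounds {p q m : ℝ} (hpq : p.HolderConjugate q) (hm : 2 * p ≤ m)
    {φ : 𝔼[n] → ℝ} (hφ : ContDiff ℝ ∞ φ) (h01 : ∀ x, 0 ≤ φ x ∧ φ x ≤ 1) :
    ContDiff ℝ 2 (fun x => (1 - φ x) ^ m) ∧ ∀ x,
      ‖fderiv ℝ (fun x => (1 - φ x) ^ m) x‖ ≤ m * (((1 - φ x) ^ m) ^ q⁻¹ * ‖fderiv ℝ φ x‖) ∧
      |Laplacian.laplacian (fun x => (1 - φ x) ^ m) x| ≤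
        ((1 - φ x) ^ m) ^ q⁻¹ *
          (m * n * hessianNorm φ x + m ^ 2 * ‖fderiv ℝ φ x‖ ^ 2) := by
  have hm2 : 2 ≤ m := by linarith [hpq.lt]
  have hφ2 : ContDiff ℝ 2 φ := by exact_mod_cast contDiff_infty.1 hφ 2
  have hD : ∀ t : ℝ, HasDerivAt (fun t => (1 - t) ^ m) (-(m * (1 - t) ^ (m - 1))) t := by
    intro t
    have := (Real.hasDerivAt_rpow_const (x := 1 - t) (p := m) (Or.inr (by linarith))).comp t
      ((hasDerivAt_id t).const_sub 1)
    exact this.congr_deriv (by ring)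
  have hD2 : ∀ t : ℝ, HasDerivAt (fun t => -(m * (1 - t) ^ (m - 1)))
      (m * (m - 1) * (1 - t) ^ (m - 2)) t := by
    intro t
    have := (((Real.hasDerivAt_rpow_const (x := 1 - t) (p := m - 1) (Or.inr (by linarith))).comp t
      ((hasDerivAt_id t).const_sub 1)).const_mul m).neg
    refine this.congr_deriv ?_
    rw [show m - 1 - 1 = m - 2 by ring]
    ring
  refine ⟨?_, fun x => ?_⟩
  · exact_mod_cast ContDiff.rpow_const_of_le (m := 2) (contDiff_const.sub hφ2)
      (by exact_mod_cast hm2)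
  have hs0 : 0 ≤ 1 - φ x := by linarith [(h01 x).2]
  have hs1 : 1 - φ x ≤ 1 := by linarith [(h01 x).1]
  -- The origin of the condition on m: m - 2 ≥ m/q is equivalent to m ≥ 2p = (n+2)/2 when p =
  -- (n+2)/4.
  have hsq : (1 - φ x) ^ (m - 2) ≤ ((1 - φ x) ^ m) ^ q⁻¹ := by
    rw [← Real.rpow_mul hs0]
    refine Real.rpow_le_rpow_of_exponent_ge' hs0 hs1
      (mul_nonneg (by linarith) (inv_nonneg.2 hpq.symm.pos.le)) ?_
    have h1 : q⁻¹ = 1 - p⁻¹ := by linarith [hpq.inv_add_inv_eq_one]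
    have h2 : 2 ≤ m * p⁻¹ := by
      rw [← div_eq_mul_inv, le_div_iff₀ hpq.pos]; exact hm
    rw [h1]
    linarith
  have hsq1 : (1 - φ x) ^ (m - 1) ≤ (1 - φ x) ^ (m - 2) :=
    Real.rpow_le_rpow_of_exponent_ge' hs0 hs1 (by linarith) (by linarith)
  have hp1 : 0 ≤ (1 - φ x) ^ (m - 1) := Real.rpow_nonneg hs0 _
  have hp2 : 0 ≤ (1 - φ x) ^ (m - 2) := Real.rpow_nonneg hs0 _
  obtain ⟨s, hs⟩ : ∃ s, s = ((1 - φ x) ^ m) ^ q⁻¹ := ⟨_, rfl⟩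
  have hss : 0 ≤ s := hp2.trans (hs ▸ hsq)
  rw [← hs] at hsq ⊢
  have hm0 : 0 ≤ m := by linarith
  constructor
  · refine (norm_fderiv_comp (h := fun t => (1 - t) ^ m) (h₁ := fun t => -(m * (1 - t) ^ (m - 1)))
      (hφ2.differentiable (by norm_num) x) (hD (φ x))).trans_le ?_
    rw [abs_neg, abs_of_nonneg (mul_nonneg hm0 hp1), mul_assoc]
    gcongr
    exact hsq1.trans hsq
  · rw [laplacian_comp (h := fun t => (1 - t) ^ m) hφ2.contDiffAt
      (Filter.Eventually.of_forall hD) (hD2 _)]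
    have h1 : |(-(m * (1 - φ x) ^ (m - 1))) * Laplacian.laplacian φ x| ≤
        m * s * (n * hessianNorm φ x) := by
      rw [abs_mul, abs_neg, abs_of_nonneg (mul_nonneg hm0 hp1)]
      refine mul_le_mul ?_ (abs_laplacian_le φ x) (abs_nonneg _) (by positivity)
      gcongr
      exact hsq1.trans hsq
    have h2 : |m * (m - 1) * (1 - φ x) ^ (m - 2) * ‖fderiv ℝ φ x‖ ^ 2| ≤
        m * m * s * ‖fderiv ℝ φ x‖ ^ 2 := by
      have : 0 ≤ m - 1 := by linarith
      rw [abs_of_nonneg (by positivity)]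
      gcongr
      linarith
    calc _ ≤ m * s * (n * hessianNorm φ x) + m * m * s * ‖fderiv ℝ φ x‖ ^ 2 :=
          (abs_add_le _ _).trans (add_le_add h1 h2)
      _ = _ := by ring

/-- The Laplacian of a product of a power cutoff with a cutoff at infinity. -/
theorem laplacian_mul_le_rpow_mul {q A : ℝ} (hq : 1 < q) (hA : 0 ≤ A) {η W Q b : 𝔼[n] → ℝ} {x : 𝔼[n]}
    (hη : ContDiff ℝ 2 η) (hW : ContDiff ℝ 2 W) (hη01 : 0 ≤ η x ∧ η x ≤ 1)
    (hW01 : 0 ≤ W x ∧ W x ≤ 1) (hQ : 0 ≤ Q x)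
    (hηd : ‖fderiv ℝ η x‖ ≤ A * (η x ^ q⁻¹ * b x))
    (hηl : |Laplacian.laplacian η x| ≤ A * (η x ^ q⁻¹ * b x))
    (hWl : Laplacian.laplacian W x ≤ Q x * W x ^ q⁻¹) (hb0 : 0 ≤ b x)
    (hb : b x ≠ 0 → 1 / 2 ≤ W x ∧ ‖fderiv ℝ W x‖ ≤ 1) :
    Laplacian.laplacian (fun x => η x * W x) x ≤
      (η x * W x) ^ q⁻¹ * (Q x + A * (1 + 4 * n) * b x) := by
  have hq0 : 0 < q⁻¹ := inv_pos.2 (by linarith)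
  have hq1 : q⁻¹ ≤ 1 := inv_le_one_of_one_le₀ hq.le
  have hself : ∀ t : ℝ, 0 ≤ t → t ≤ 1 → t ≤ t ^ q⁻¹ := fun t h0 h1 => by
    have := Real.rpow_le_rpow_of_exponent_ge' h0 h1 hq0.le hq1
    rwa [Real.rpow_one] at this
  rw [Real.mul_rpow hη01.1 hW01.1]
  have e0 := Real.rpow_nonneg hη01.1 q⁻¹
  have w0 := Real.rpow_nonneg hW01.1 q⁻¹
  have e1 := hself _ hη01.1 hη01.2
  have w1 := hself _ hW01.1 hW01.2
  obtain ⟨s, hs⟩ : ∃ s, s = η x ^ q⁻¹ := ⟨_, rfl⟩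
  obtain ⟨t, ht⟩ : ∃ t, t = W x ^ q⁻¹ := ⟨_, rfl⟩
  rw [← hs] at e0 e1 hηd hηl ⊢
  rw [← ht] at w0 w1 hWl ⊢
  have a1 : η x * Laplacian.laplacian W x ≤ s * (Q x * t) :=
    (mul_le_mul_of_nonneg_left hWl hη01.1).trans
      (mul_le_mul_of_nonneg_right e1 (mul_nonneg hQ w0))
  have a2 : W x * Laplacian.laplacian η x ≤ t * (A * (s * b x)) :=
    (mul_le_mul_of_nonneg_left ((le_abs_self _).trans hηl) hW01.1).trans
      (mul_le_mul_of_nonneg_right w1 (by positivity))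
  -- Where the cutoff near K varies, W ≥ 1/2 and |∇W| ≤ 1, so |∇W| ≤ 2W ≤ 2W^{1/q}. Elsewhere the
  -- gradient of η vanishes.
  have a3 : ‖fderiv ℝ η x‖ * ‖fderiv ℝ W x‖ ≤ A * (s * b x) * (2 * t) := by
    by_cases h : b x = 0
    · rw [h, mul_zero, mul_zero] at hηd ⊢
      rw [le_antisymm hηd (norm_nonneg _)]
      simp
    · obtain ⟨h1, h2⟩ := hb h
      exact mul_le_mul hηd (by linarith) (norm_nonneg _) (by positivity)
  refine (laplacian_mul_le hη.contDiffAt hW.contDiffAt).trans ?_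
  have : 2 * n * (‖fderiv ℝ η x‖ * ‖fderiv ℝ W x‖) ≤ 2 * n * (A * (s * b x) * (2 * t)) := by
    gcongr
  linarith

end PowerCutoff

/-! ### A priori estimates for positive solutions. -/

section Energy

variable {n : ℕ}

local notation "𝔼[" n "]" => EuclideanSpace ℝ (Fin n)

theorem IsPositiveSolutionOn.continuousOn_rpow {O : Set 𝔼[n]} {u : 𝔼[n] → ℝ}
    (hu : IsPositiveSolutionOn O u) (s : ℝ) : ContinuousOn (fun x => u x ^ s) O :=
  hu.contDiffOn.continuousOn.rpow_const fun x hx => Or.inl (hu.pos x hx).ne'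

/-- Hölder's inequality for the weight `u f^{1/q}`. -/
theorem lintegral_ofReal_mul_rpow_mul_le {p q : ℝ} (hpq : p.HolderConjugate q) {O : Set 𝔼[n]}
    (hO : IsOpen O) {u f : 𝔼[n] → ℝ} (hu : ContinuousOn u O) (hu0 : ∀ x ∈ O, 0 < u x)
    (hf : Continuous f) (hf0 : ∀ x, 0 ≤ f x) (hfO : tsupport f ⊆ O)
    {G : 𝔼[n] → ℝ≥0∞} (hG : Measurable G) :
    ∫⁻ x, ENNReal.ofReal (u x * f x ^ q⁻¹) * G x ≤
      (∫⁻ x, ENNReal.ofReal (u x ^ q * f x)) ^ (1 / q) * (∫⁻ x, G x ^ p) ^ (1 / p) := by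
  have hq := hpq.symm.pos
  have hts : tsupport (fun x => f x ^ q⁻¹) ⊆ O := by
    refine (closure_mono fun x hx => ?_).trans hfO
    rw [Function.mem_support] at hx ⊢
    exact fun h => hx (by simp only [h, Real.zero_rpow (inv_ne_zero hq.ne')])
  have hc : Continuous fun x => u x * f x ^ q⁻¹ :=
    continuous_mul_of_tsupport_subset hO hu
      (hf.rpow_const fun x => Or.inr (inv_nonneg.2 hq.le)) hts
  refine (ENNReal.lintegral_mul_le_Lp_mul_Lq volume hpq.symm
    (ENNReal.measurable_ofReal.comp hc.measurable).aemeasurable hG.aemeasurable).trans_eq ?_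
  congr 2
  refine lintegral_congr fun x => ?_
  simp only [Function.comp_apply]
  by_cases hx : x ∈ O
  · rw [ENNReal.ofReal_rpow_of_nonneg (mul_nonneg (hu0 x hx).le (Real.rpow_nonneg (hf0 x) _)) hq.le,
      Real.mul_rpow (hu0 x hx).le (Real.rpow_nonneg (hf0 x) _), ← Real.rpow_mul (hf0 x),
      inv_mul_cancel₀ hq.ne', Real.rpow_one]
  · have : f x = 0 := image_eq_zero_of_notMem_tsupport fun h => hx (hfO h)
    rw [this, Real.zero_rpow (inv_ne_zero hq.ne'), mul_zero, mul_zero, ENNReal.ofReal_zero,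
      ENNReal.zero_rpow_of_pos hq]

/-- The energy inequality obtained by testing the equation with `f`. -/
theorem lintegral_rpow_mul_le_of_laplacian_le {p q : ℝ} (hpq : p.HolderConjugate q)
    (hq : q = ((n : ℝ) + 2) / ((n : ℝ) - 2)) {O : Set 𝔼[n]}
    (hO : IsOpen O) {u f : 𝔼[n] → ℝ} (hu : IsPositiveSolutionOn O u)
    (hf : ContDiff ℝ 2 f) (hf0 : ∀ x, 0 ≤ f x) (hfc : HasCompactSupport f) (hfO : tsupport f ⊆ O)
    {G : 𝔼[n] → ℝ≥0∞} (hG : Measurable G) {g : 𝔼[n] → ℝ}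
    (hg : ∀ x, Laplacian.laplacian f x ≤ f x ^ q⁻¹ * g x)
    (hgG : ∀ x, ENNReal.ofReal (g x) ≤ G x) :
    ∫⁻ x, ENNReal.ofReal (u x ^ q * f x) ≤ ∫⁻ x, G x ^ p := by
  have hq0 := hpq.symm.pos
  have hzero : ∀ x, x ∉ O → f x = 0 := fun x hx =>
    image_eq_zero_of_notMem_tsupport fun h => hx (hfO h)
  -- Compact support inside `O` makes the energy finite, which is what the absorption requires.
  have hint : Integrable fun x => u x ^ q * f x :=
    integrable_mul_of_tsupport_subset hO (hu.continuousOn_rpow q) hf.continuous hfc hfO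
  have hX : ENNReal.ofReal (∫ x, u x ^ q * f x) = ∫⁻ x, ENNReal.ofReal (u x ^ q * f x) := by
    refine ofReal_integral_eq_lintegral_ofReal hint (Filter.Eventually.of_forall fun x => ?_)
    by_cases hx : x ∈ O
    · exact mul_nonneg (Real.rpow_nonneg (hu.pos x hx).le _) (hf0 x)
    · simp [hzero x hx]
  have hgreen : ∫ x, u x ^ q * f x = ∫ x, u x * Laplacian.laplacian f x := by
    rw [← integral_mul_laplacian_comm hO hu.contDiffOn hf hfc hfO]
    refine integral_congr_ae (Filter.Eventually.of_forall fun x => ?_)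
    by_cases hx : x ∈ O
    · simp only
      rw [hu.equation x hx, hq, mul_comm]
    · simp [hzero x hx]
  refine ENNReal.le_rpow_of_le_rpow_mul hpq (by rw [← hX]; exact ENNReal.ofReal_ne_top)
    (y := (∫⁻ x, G x ^ p) ^ (1 / p)) ?_ |>.trans_eq ?_
  · calc ∫⁻ x, ENNReal.ofReal (u x ^ q * f x)
        ≤ ∫⁻ x, ENNReal.ofReal (u x * Laplacian.laplacian f x) := by
          rw [← hX, hgreen]; exact ofReal_integral_le_lintegral_ofReal _
      _ ≤ ∫⁻ x, ENNReal.ofReal (u x * f x ^ q⁻¹) * G x := by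
          refine lintegral_mono fun x => ?_
          simp only
          by_cases hx : x ∈ O
          · have hux := (hu.pos x hx).le
            refine (ENNReal.ofReal_le_ofReal
              (mul_le_mul_of_nonneg_left (hg x) hux)).trans ?_
            rw [← mul_assoc, ENNReal.ofReal_mul (mul_nonneg hux (Real.rpow_nonneg (hf0 x) _))]
            gcongr
            exact hgG x
          · have : Laplacian.laplacian f x = 0 :=
              image_eq_zero_of_notMem_tsupport fun h => hx (hfO (tsupport_laplacian_subset f h))
            rw [this, mul_zero, ENNReal.ofReal_zero]
            exact zero_le
      _ ≤ _ := lintegral_ofReal_mul_rpow_mul_le hpq hO hu.contDiffOn.continuousOn hu.pos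
          hf.continuous hf0 hfO hG
  · rw [← ENNReal.rpow_mul, one_div_mul_cancel hpq.ne_zero, ENNReal.rpow_one]

/-- A priori bounds for positive solutions in terms of a majorant of the derivatives of the
cutoff near the singular set. -/
theorem exists_energy_bound (hn : 3 ≤ n) {m : ℝ} (hm : ((n : ℝ) + 2) / 2 ≤ m) :
    ∃ C : ℝ≥0, ∀ K : Set 𝔼[n], IsCompact K → ∀ u : 𝔼[n] → ℝ, IsPositiveSolutionOn Kᶜ u →
      ∀ φ : 𝔼[n] → ℝ, IsTestFunctionOn (ball 0 2) φ → (∀ x, 0 ≤ φ x ∧ φ x ≤ 1) →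
        (∃ V : Set 𝔼[n], IsOpen V ∧ K ⊆ V ∧ ∀ x ∈ V, φ x = 1) →
        ∀ B : 𝔼[n] → ℝ≥0∞, Measurable B →
          (∀ x, ENNReal.ofReal (hessianNorm φ x) ≤ B x ∧ ENNReal.ofReal ‖fderiv ℝ φ x‖ ≤ B x ∧
            ENNReal.ofReal (‖fderiv ℝ φ x‖ ^ 2) ≤ B x) →
          ∀ η : 𝔼[n] → ℝ, (η = fun x => (1 - φ x) ^ m) →
            ∫⁻ x, ENNReal.ofReal (u x * (‖gradient η x‖ + |Laplacian.laplacian η x|)) ≤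
              C * ∫⁻ x, B x ^ (((n : ℝ) + 2) / 4) ∧
            ∫⁻ x, ENNReal.ofReal (u x ^ (((n : ℝ) + 2) / ((n : ℝ) - 2)) * η x) ≤
              C * ∫⁻ x, B x ^ (((n : ℝ) + 2) / 4) := by
  obtain ⟨p, hp⟩ : ∃ p, p = ((n : ℝ) + 2) / 4 := ⟨_, rfl⟩
  obtain ⟨q, hq⟩ : ∃ q, q = ((n : ℝ) + 2) / ((n : ℝ) - 2) := ⟨_, rfl⟩
  have hpq : p.HolderConjugate q := hp ▸ hq ▸ holderConjugate_critical hn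
  have hmp : 2 * p ≤ m := by rw [hp]; linarith
  have hm0 : 0 < m := by linarith [hpq.pos]
  have hp0 := hpq.pos
  have hcut := fun {r δ : ℝ} => exists_superharmonic_cutoff (n := n) hn (r := r) (δ := δ)
  rw [← hp, ← hq] at hcut ⊢
  obtain ⟨A, hA⟩ : ∃ A : ℝ, A = m + m * n + m ^ 2 := ⟨_, rfl⟩
  have hA0 : 0 < A := by rw [hA]; positivity
  obtain ⟨D, hD⟩ : ∃ D : ℝ≥0, D = Real.toNNReal (A * (1 + 4 * n)) * 3 := ⟨_, rfl⟩
  refine ⟨2 ^ p * D ^ p, fun K hK u hu φ hφ h01 ⟨V, hV, hKV, hV1⟩ B hB hBφ η hη => ?_⟩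
  obtain ⟨hη2, hηb⟩ := power_cutoff_bounds hpq hmp hφ.contDiff h01
  rw [← hη] at hη2 hηb
  have hηx : ∀ x, (1 - φ x) ^ m = η x := fun x => by rw [hη]
  simp_rw [hηx] at hηb
  have hη01 : ∀ x, 0 ≤ η x ∧ η x ≤ 1 := fun x => by
    rw [← hηx]
    have := h01 x
    exact ⟨Real.rpow_nonneg (by linarith) _, Real.rpow_le_one (by linarith) (by linarith) hm0.le⟩
  have hηK : tsupport η ⊆ Kᶜ := by
    have : tsupport η ⊆ Vᶜ := by
      refine closure_minimal (fun x hx hxV => hx ?_) hV.isClosed_compl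
      rw [← hηx, hV1 x hxV, sub_self, Real.zero_rpow hm0.ne']
    exact this.trans (Set.compl_subset_compl.2 hKV)
  obtain ⟨b, hb⟩ : ∃ b : 𝔼[n] → ℝ,
      b = fun x => hessianNorm φ x + ‖fderiv ℝ φ x‖ + ‖fderiv ℝ φ x‖ ^ 2 := ⟨_, rfl⟩
  have hb0 : ∀ x, 0 ≤ b x := fun x => by
    rw [hb]; have := hessianNorm_nonneg φ x; positivity
  have hbB : ∀ x, ENNReal.ofReal (b x) ≤ 3 * B x := fun x => by
    obtain ⟨b1, b2, b3⟩ := hBφ x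
    rw [hb]
    simp only
    rw [ENNReal.ofReal_add (add_nonneg (hessianNorm_nonneg φ x) (norm_nonneg _)) (sq_nonneg _),
      ENNReal.ofReal_add (hessianNorm_nonneg φ x) (norm_nonneg _)]
    calc _ ≤ B x + B x + B x := by gcongr
      _ = _ := by ring
  have hbs : ∀ x, b x ≠ 0 → x ∈ ball (0 : 𝔼[n]) 2 := by
    intro x hx
    by_contra hx2
    have h1 : x ∉ tsupport φ := fun h => hx2 (hφ.tsupport_subset h)
    have h2 : fderiv ℝ φ x = 0 :=
      image_eq_zero_of_notMem_tsupport fun h => h1 (tsupport_fderiv_subset ℝ h)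
    have h3 : fderiv ℝ (fderiv ℝ φ) x = 0 :=
      image_eq_zero_of_notMem_tsupport fun h => h1 (tsupport_fderiv_subset ℝ
        (tsupport_fderiv_subset ℝ h))
    have h4 : hessianNorm φ x = 0 := by
      refine le_antisymm ?_ (hessianNorm_nonneg _ _)
      refine (hessianNorm_le le_rfl fun i j => ?_).trans_eq (mul_zero (n : ℝ))
      rw [secondPartial_eq_fderiv, h3]
      simp
    apply hx
    simp [hb, h2, h4]
  have hηd : ∀ x, ‖fderiv ℝ η x‖ ≤ A * (η x ^ q⁻¹ * b x) ∧
      |Laplacian.laplacian η x| ≤ A * (η x ^ q⁻¹ * b x) := by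
    intro x
    obtain ⟨h1, h2⟩ := hηb x
    have hs : 0 ≤ η x ^ q⁻¹ := Real.rpow_nonneg (hη01 x).1 _
    have hH := hessianNorm_nonneg φ x
    have hN := norm_nonneg (fderiv ℝ φ x)
    have hmA : m ≤ A := by rw [hA]; nlinarith [mul_nonneg hm0.le (Nat.cast_nonneg n : (0:ℝ) ≤ n)]
    have hmnA : m * n ≤ A := by rw [hA]; nlinarith
    have hm2A : m ^ 2 ≤ A := by
      rw [hA]; nlinarith [mul_nonneg hm0.le (Nat.cast_nonneg n : (0:ℝ) ≤ n)]
    constructor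
    · refine h1.trans ?_
      have : ‖fderiv ℝ φ x‖ ≤ b x := by rw [hb]; simp only; nlinarith [sq_nonneg ‖fderiv ℝ φ x‖]
      gcongr
    · refine h2.trans ?_
      rw [mul_left_comm]
      gcongr
      calc m * n * hessianNorm φ x + m ^ 2 * ‖fderiv ℝ φ x‖ ^ 2
          ≤ A * hessianNorm φ x + A * ‖fderiv ℝ φ x‖ ^ 2 := by gcongr
        _ ≤ A * b x := by
          rw [hb]
          simp only
          nlinarith [mul_nonneg hA0.le hN]
  have hDb : ∀ x, ENNReal.ofReal (A * (1 + 4 * n) * b x) ≤ D * B x := by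
    intro x
    rw [ENNReal.ofReal_mul (by positivity), hD, ENNReal.coe_mul, mul_assoc]
    change ENNReal.ofReal _ * _ ≤ ENNReal.ofReal _ * _
    gcongr
    exact hbB x
  have hpB : ∫⁻ x, (D * B x) ^ p = D ^ p * ∫⁻ x, B x ^ p := by
    rw [← lintegral_const_mul' _ _ (ENNReal.rpow_ne_top_of_nonneg hp0.le ENNReal.coe_ne_top)]
    exact lintegral_congr fun x => ENNReal.mul_rpow_of_nonneg _ _ hp0.le
  have hcoe : (((2 ^ p * D ^ p : ℝ≥0)) : ℝ≥0∞) = 2 ^ p * D ^ p := by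
    rw [ENNReal.coe_mul, ENNReal.coe_rpow_of_nonneg _ hp0.le, ENNReal.coe_rpow_of_nonneg _ hp0.le]
    norm_num
  -- Test with f = ηW. The constant multiplying the integral of `B` depends neither on the radius
  -- nor on the error δ at infinity.
  have hlocal : ∀ r δ : ℝ, 2 ≤ r → 0 < δ →
      ∫⁻ x in ball (0 : 𝔼[n]) r, ENNReal.ofReal (u x ^ q * η x) ≤
        2 ^ p * (ENNReal.ofReal δ + D ^ p * ∫⁻ x, B x ^ p) := by
    intro r δ hr hδ
    obtain ⟨W, Q, hW, hWc, hW01, hWr, hWd, hQm, hQ0, hWl, hQδ⟩ := hcut hr hδ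
    have hmain : ∫⁻ x, ENNReal.ofReal (u x ^ q * (η x * W x)) ≤
        ∫⁻ x, (ENNReal.ofReal (Q x) + D * B x) ^ p := by
      refine lintegral_rpow_mul_le_of_laplacian_le hpq hq hK.isClosed.isOpen_compl hu (hη2.mul hW)
        (fun x => mul_nonneg (hη01 x).1 (hW01 x).1) hWc.mul_left
        ((tsupport_mul_subset_left).trans hηK) (by fun_prop)
        (g := fun x => Q x + A * (1 + 4 * n) * b x) (fun x => ?_) fun x => ?_
      · refine laplacian_mul_le_rpow_mul hpq.symm.lt hA0.le hη2 hW (hη01 x) (hW01 x) (hQ0 x)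
          (hηd x).1 (hηd x).2 (hWl x) (hb0 x) fun h => ?_
        have := hbs x h
        exact ⟨hWr x (ball_subset_ball hr this), hWd x this⟩
      · have := hb0 x
        rw [ENNReal.ofReal_add (hQ0 x) (by positivity)]
        gcongr
        exact hDb x
    calc ∫⁻ x in ball (0 : 𝔼[n]) r, ENNReal.ofReal (u x ^ q * η x)
        ≤ ∫⁻ x in ball (0 : 𝔼[n]) r, 2 * ENNReal.ofReal (u x ^ q * (η x * W x)) := by
          refine setLIntegral_mono' measurableSet_ball fun x hx => ?_
          by_cases hxK : x ∈ Kᶜ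
          · have h2 : ENNReal.ofReal 2 = 2 := by simp
            have := Real.rpow_nonneg (hu.pos x hxK).le q
            rw [← h2, ← ENNReal.ofReal_mul (by norm_num)]
            refine ENNReal.ofReal_le_ofReal ?_
            have h3 := hWr x hx
            have h4 := mul_nonneg this (hη01 x).1
            nlinarith
          · have : η x = 0 := image_eq_zero_of_notMem_tsupport fun h => hxK (hηK h)
            rw [this, mul_zero, ENNReal.ofReal_zero]
            exact zero_le
      _ ≤ ∫⁻ x, 2 * ENNReal.ofReal (u x ^ q * (η x * W x)) := setLIntegral_le_lintegral _ _
      _ = 2 * ∫⁻ x, ENNReal.ofReal (u x ^ q * (η x * W x)) :=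
          lintegral_const_mul' _ _ (by norm_num)
      _ ≤ 2 * ∫⁻ x, 2 ^ (p - 1) * (ENNReal.ofReal (Q x) ^ p + (D * B x) ^ p) := by
          refine mul_le_mul_right (hmain.trans (lintegral_mono fun x => ?_)) 2
          exact ENNReal.rpow_add_le_mul_rpow_add_rpow _ _ hpq.lt.le
      _ = 2 * (2 ^ (p - 1) * ((∫⁻ x, ENNReal.ofReal (Q x) ^ p) + ∫⁻ x, (D * B x) ^ p)) := by
          rw [lintegral_const_mul' _ _ (ENNReal.rpow_ne_top_of_nonneg (by linarith [hpq.lt])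
            (by norm_num)), lintegral_add_left (by fun_prop)]
      _ ≤ 2 * (2 ^ (p - 1) * (ENNReal.ofReal δ + D ^ p * ∫⁻ x, B x ^ p)) := by
          rw [hpB]
          gcongr
      _ = _ := by
          rw [← mul_assoc]
          congr 1
          nth_rw 1 [← ENNReal.rpow_one 2]
          rw [← ENNReal.rpow_add _ _ (by norm_num) (by norm_num)]
          congr 1
          ring
  -- Let δ tend to 0 with the radius fixed; afterwards the balls exhaust the space.
  have hball : ∀ r : ℝ, 2 ≤ r → ∫⁻ x in ball (0 : 𝔼[n]) r, ENNReal.ofReal (u x ^ q * η x) ≤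
      2 ^ p * D ^ p * ∫⁻ x, B x ^ p := by
    intro r hr
    refine ENNReal.le_of_forall_pos_le_add fun ε hε _ => ?_
    have h2 : (2 : ℝ) ^ p * (ε / 2 ^ p) = ε := by
      have : (2 : ℝ) ^ p ≠ 0 := by positivity
      field_simp
    have h3 : (2 : ℝ≥0∞) ^ p = ENNReal.ofReal (2 ^ p) := by
      rw [← ENNReal.ofReal_rpow_of_nonneg (by norm_num) hp0.le]; norm_num
    refine (hlocal r (ε / 2 ^ p) hr (by positivity)).trans_eq ?_
    rw [mul_add, h3, ← ENNReal.ofReal_mul (by positivity), h2, ENNReal.ofReal_coe_nnreal, add_comm,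
      mul_assoc]
  have hcont : Continuous fun x => u x ^ q * η x :=
    continuous_mul_of_tsupport_subset hK.isClosed.isOpen_compl (hu.continuousOn_rpow q)
      hη2.continuous hηK
  have hglobal : ∫⁻ x, ENNReal.ofReal (u x ^ q * η x) ≤ 2 ^ p * D ^ p * ∫⁻ x, B x ^ p := by
    have hlim := (aecover_ball (μ := (volume : Measure 𝔼[n])) (x := 0)
      (Filter.tendsto_id (α := ℝ) (x := Filter.atTop))).lintegral_tendsto_of_countably_generated
      (ENNReal.measurable_ofReal.comp hcont.measurable).aemeasurable
    refine le_of_tendsto hlim ?_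
    filter_upwards [Filter.eventually_ge_atTop (2 : ℝ)] with r hr using hball r hr
  rw [hcoe]
  refine ⟨?_, hglobal⟩
  -- Discarding a factor 2^p ≥ 1 gives both Hölder factors the same base, so that their exponents
  -- add up to 1.
  have h2D : ∫⁻ x, (D * B x) ^ p ≤ 2 ^ p * D ^ p * ∫⁻ x, B x ^ p := by
    rw [hpB, mul_assoc]
    exact le_mul_of_one_le_left (zero_le) (ENNReal.one_le_rpow (by norm_num) hp0)
  calc ∫⁻ x, ENNReal.ofReal (u x * (‖gradient η x‖ + |Laplacian.laplacian η x|))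
      ≤ ∫⁻ x, ENNReal.ofReal (u x * η x ^ q⁻¹) * (D * B x) := by
        refine lintegral_mono fun x => ?_
        simp only
        rw [norm_gradient_eq]
        by_cases hx : x ∈ Kᶜ
        · have hux := (hu.pos x hx).le
          have hs : 0 ≤ η x ^ q⁻¹ := Real.rpow_nonneg (hη01 x).1 _
          refine le_trans ?_ (mul_le_mul_right (hDb x) _)
          rw [← ENNReal.ofReal_mul (mul_nonneg hux hs)]
          refine ENNReal.ofReal_le_ofReal ?_
          rw [mul_assoc]
          gcongr
          have hn3 : (3 : ℝ) ≤ n := by exact_mod_cast hn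
          have h1 : 0 ≤ A * (η x ^ q⁻¹ * b x) := mul_nonneg hA0.le (mul_nonneg hs (hb0 x))
          calc _ ≤ A * (η x ^ q⁻¹ * b x) + A * (η x ^ q⁻¹ * b x) := add_le_add (hηd x).1 (hηd x).2
            _ ≤ A * (η x ^ q⁻¹ * b x) * (1 + 4 * n) := by nlinarith
            _ = _ := by ring
        · have h1 : Laplacian.laplacian η x = 0 :=
            image_eq_zero_of_notMem_tsupport fun h => hx (hηK (tsupport_laplacian_subset η h))
          have h2 : fderiv ℝ η x = 0 :=
            image_eq_zero_of_notMem_tsupport fun h => hx (hηK (tsupport_fderiv_subset ℝ h))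
          rw [h1, h2]
          simp
    _ ≤ (∫⁻ x, ENNReal.ofReal (u x ^ q * η x)) ^ (1 / q) * (∫⁻ x, (D * B x) ^ p) ^ (1 / p) :=
        lintegral_ofReal_mul_rpow_mul_le hpq hK.isClosed.isOpen_compl hu.contDiffOn.continuousOn
          hu.pos hη2.continuous (fun x => (hη01 x).1) hηK (by fun_prop)
    _ ≤ (2 ^ p * D ^ p * ∫⁻ x, B x ^ p) ^ (1 / q) *
        (2 ^ p * D ^ p * ∫⁻ x, B x ^ p) ^ (1 / p) := by
        have := hpq.symm.pos
        gcongr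
    _ = _ := by
        rw [← ENNReal.rpow_add_of_nonneg _ _ (one_div_nonneg.2 hpq.symm.pos.le)
          (one_div_nonneg.2 hp0.le), one_div, one_div, add_comm, hpq.inv_add_inv_eq_one,
          ENNReal.rpow_one]

end Energy

/-! ### Finiteness and positivity of the capacity. -/

section Capacity

variable {n : ℕ}

local notation "𝔼[" n "]" => EuclideanSpace ℝ (Fin n)

theorem continuous_hessianNorm {f : 𝔼[n] → ℝ} (hf : ContDiff ℝ 2 f) :
    Continuous (hessianNorm f) := by
  have := hf.continuous_iteratedFDeriv (m := 2) (by norm_num)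
  unfold hessianNorm secondPartial
  fun_prop

theorem lintegral_hessianNorm_rpow_lt_top {f : 𝔼[n] → ℝ} (hf : ContDiff ℝ 2 f)
    (hc : HasCompactSupport f) {s : ℝ} (hs : 0 < s) :
    ∫⁻ x, ENNReal.ofReal (hessianNorm f x ^ s) < ⊤ := by
  refine Integrable.lintegral_lt_top (Continuous.integrable_of_hasCompactSupport
    ((continuous_hessianNorm hf).rpow_const fun x => Or.inr hs.le) ?_)
  refine HasCompactSupport.intro (hc.iteratedFDeriv (𝕜 := ℝ) 2) fun x hx => ?_
  have : hessianNorm f x = 0 := by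
    simp [hessianNorm, secondPartial, image_eq_zero_of_notMem_tsupport hx]
  rw [this, Real.zero_rpow hs.ne']

theorem besselCapacity_lt_top {K : Set 𝔼[n]} (hK : K ⊆ ball 0 1) : besselCapacity K < ⊤ := by
  obtain ⟨χ, hχ1, hχ2⟩ : ∃ χ : ContDiffBump (0 : 𝔼[n]), χ.rIn = 1 ∧ χ.rOut = 3 / 2 :=
    ⟨⟨1, 3 / 2, by norm_num, by norm_num⟩, rfl, rfl⟩
  have hχ : IsTestFunctionOn (ball 0 2) χ := by
    refine ⟨χ.contDiff, χ.hasCompactSupport, ?_⟩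
    rw [χ.tsupport_eq, hχ2]
    exact closedBall_subset_ball (by norm_num)
  refine lt_of_le_of_lt (iInf₂_le_of_le (χ : 𝔼[n] → ℝ) hχ (iInf_le _ fun x hx => ?_))
    (lintegral_hessianNorm_rpow_lt_top χ.contDiff χ.hasCompactSupport (by positivity))
  rw [χ.one_of_mem_closedBall (by rw [hχ1]; exact ball_subset_closedBall (hK hx))]

theorem exists_testFunction_lintegral_lt {K : Set 𝔼[n]} {c : ℝ≥0∞} (h : besselCapacity K < c) :
    ∃ ψ : 𝔼[n] → ℝ, IsTestFunctionOn (ball 0 2) ψ ∧ (∀ x ∈ K, 1 ≤ ψ x) ∧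
      ∫⁻ x, ENNReal.ofReal (hessianNorm ψ x ^ (((n : ℝ) + 2) / 4)) < c := by
  simp only [besselCapacity, iInf_lt_iff] at h
  obtain ⟨ψ, h1, h2, h3⟩ := h
  exact ⟨ψ, h1, h2, h3⟩

/-- The mass of a positive solution far from the singular set is positive. -/
theorem lintegral_compl_closedBall_pos (hn : 3 ≤ n) {K : Set 𝔼[n]} (hK : K ⊆ ball 0 1)
    {u : 𝔼[n] → ℝ} (hu : IsPositiveSolutionOn Kᶜ u) (s : ℝ) :
    0 < ∫⁻ x in (closedBall (0 : 𝔼[n]) 2)ᶜ, ENNReal.ofReal (u x ^ s) := by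
  have hsub : (closedBall (0 : 𝔼[n]) 2)ᶜ ⊆ Kᶜ := Set.compl_subset_compl.2
    (hK.trans (ball_subset_closedBall.trans (closedBall_subset_closedBall (by norm_num))))
  have hmeas : MeasurableSet (closedBall (0 : 𝔼[n]) 2)ᶜ := measurableSet_closedBall.compl
  have hne : (closedBall (0 : 𝔼[n]) 2)ᶜ.Nonempty := by
    refine ⟨EuclideanSpace.single ⟨0, by omega⟩ 3, ?_⟩
    rw [Set.mem_compl_iff, mem_closedBall_zero_iff]
    simp
    norm_num
  rw [pos_iff_ne_zero, Ne, lintegral_eq_zero_iff' ?_]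
  · intro h
    have h1 := (ae_restrict_iff' hmeas).1 h
    refine (isClosed_closedBall.isOpen_compl.measure_pos volume hne).ne'
      (measure_mono_null (fun x hx => ?_) h1)
    intro h2
    have := h2 hx
    simp only [Pi.zero_apply, ENNReal.ofReal_eq_zero] at this
    exact absurd this (not_le.2 (Real.rpow_pos_of_pos (hu.pos x (hsub hx)) _))
  · exact ENNReal.measurable_ofReal.comp_aemeasurable
      (((hu.continuousOn_rpow s).mono hsub).aemeasurable hmeas)

/-- Applying the energy bound to the cutoff built from an arbitrary admissible ψ bounds its energy
below by the mass of u^q outside B(0,2), where η = 1. In particular no positive solution exists when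
the capacity vanishes; empty K is such a case. -/
theorem besselCapacity_pos (hn : 3 ≤ n) {K : Set 𝔼[n]} (hKc : IsCompact K) (hK : K ⊆ ball 0 1)
    {u : 𝔼[n] → ℝ} (hu : IsPositiveSolutionOn Kᶜ u) : 0 < besselCapacity K := by
  obtain ⟨C, hC⟩ := exists_smooth_truncation hn
  obtain ⟨C', hC'⟩ := exists_energy_bound hn (le_refl (((n : ℝ) + 2) / 2))
  obtain ⟨J, hJ⟩ : ∃ J, J = ∫⁻ x in (closedBall (0 : 𝔼[n]) 2)ᶜ,
    ENNReal.ofReal (u x ^ (((n : ℝ) + 2) / ((n : ℝ) - 2))) := ⟨_, rfl⟩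
  have hJ0 : 0 < J := hJ ▸ lintegral_compl_closedBall_pos hn hK hu _
  have hlow : ∀ ψ : 𝔼[n] → ℝ, IsTestFunctionOn (ball 0 2) ψ → (∀ x ∈ K, 1 ≤ ψ x) →
      J ≤ C' * (C * ∫⁻ x, ENNReal.ofReal (hessianNorm ψ x ^ (((n : ℝ) + 2) / 4))) := by
    intro ψ hψ hψK
    obtain ⟨φ, hφ, h01, hV, B, hB, hBφ, hBψ⟩ := hC K hKc hK ψ hψ hψK
    refine le_trans ?_ ((hC' K hKc u hu φ hφ h01 hV B hB hBφ _ rfl).2.trans (by gcongr))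
    rw [hJ]
    refine le_trans (setLIntegral_mono' measurableSet_closedBall.compl fun x hx => ?_)
      (setLIntegral_le_lintegral (closedBall (0 : 𝔼[n]) 2)ᶜ _)
    have : φ x = 0 := image_eq_zero_of_notMem_tsupport fun h =>
      hx (ball_subset_closedBall (hφ.tsupport_subset h))
    rw [this, sub_zero, Real.one_rpow, mul_one]
  by_contra h
  have h0 : besselCapacity K = 0 := by simpa using h
  have hJle : J ≤ 0 := by
    refine ENNReal.le_of_forall_pos_le_add fun ε hε _ => ?_
    obtain ⟨ψ, h1, h2, h3⟩ := exists_testFunction_lintegral_lt (K := K)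
      (c := (ε / (C' * C + 1) : ℝ≥0)) (by rw [h0]; exact_mod_cast (by positivity))
    refine (hlow ψ h1 h2).trans ?_
    rw [zero_add, ← mul_assoc]
    calc _ ≤ (C' * C : ℝ≥0∞) * (ε / (C' * C + 1) : ℝ≥0) := by gcongr
      _ ≤ ε := by
        norm_cast
        rw [mul_div_assoc', div_le_iff₀ (by positivity)]
        nlinarith [mul_comm (C' * C) ε, hε.le]
  exact absurd hJle (not_le.2 hJ0)

end Capacity

/-! ### Conclusion. -/

theorem lemma1 (n : ℕ) (hn : 3 ≤ n) :
    ∃ C₀ : ℝ≥0, 0 < C₀ ∧ ∀ m : ℝ, ((n : ℝ) + 2) / 2 ≤ m →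
      ∃ C₁ : ℝ≥0, 0 < C₁ ∧
        ∀ K : Set (EuclideanSpace ℝ (Fin n)), IsCompact K → K ⊆ ball 0 1 →
        ∀ u : EuclideanSpace ℝ (Fin n) → ℝ, IsPositiveSolutionOn Kᶜ u →
          ∃ φ : EuclideanSpace ℝ (Fin n) → ℝ,
            IsTestFunctionOn (ball 0 2) φ ∧
            (∀ x, 0 ≤ φ x ∧ φ x ≤ 1) ∧
            (∃ V : Set (EuclideanSpace ℝ (Fin n)), IsOpen V ∧ K ⊆ V ∧ ∀ x ∈ V, φ x = 1) ∧
            ∫⁻ x in ball (0 : EuclideanSpace ℝ (Fin n)) 2,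
                ENNReal.ofReal (hessianNorm φ x ^ (((n : ℝ) + 2) / 4)) ≤ C₀ * besselCapacity K ∧
            ∀ η : EuclideanSpace ℝ (Fin n) → ℝ, (η = fun x => (1 - φ x) ^ m) →
              ∫⁻ x, ENNReal.ofReal (u x * (‖gradient η x‖ + |Laplacian.laplacian η x|))
                  ≤ C₁ * besselCapacity K ∧
              ∫⁻ x, ENNReal.ofReal (u x ^ (((n : ℝ) + 2) / ((n : ℝ) - 2)) * η x) ≤ C₁ * besselCapacity K := by
  obtain ⟨C, hC⟩ := exists_smooth_truncation hn
  refine ⟨2 * C + 1, by positivity, fun m hm => ?_⟩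
  obtain ⟨C', hC'⟩ := exists_energy_bound hn hm
  refine ⟨C' * (2 * C) + 1, by positivity, fun K hK hK1 u hu => ?_⟩
  have hpos := besselCapacity_pos hn hK hK1 hu
  -- The infimum need not be attained; a competitor within a factor 2 exists because the capacity is
  -- finite and positive.
  obtain ⟨ψ, hψ, hψK, hlt⟩ := exists_testFunction_lintegral_lt (K := K)
    (c := 2 * besselCapacity K) (by
      rw [two_mul]
      exact ENNReal.lt_add_right (besselCapacity_lt_top hK1).ne hpos.ne')
  obtain ⟨φ, hφ, h01, hV, B, hB, hBφ, hBψ⟩ := hC K hK hK1 ψ hψ hψK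
  have hBcap : ∫⁻ x, B x ^ (((n : ℝ) + 2) / 4) ≤ (2 * C) * besselCapacity K := by
    refine hBψ.trans ?_
    calc _ ≤ C * (2 * besselCapacity K) := by gcongr
      _ = _ := by ring
  have hp : (0 : ℝ) ≤ ((n : ℝ) + 2) / 4 := by positivity
  refine ⟨φ, hφ, h01, hV, ?_, fun η hη => ?_⟩
  · refine (setLIntegral_le_lintegral _ _).trans (le_trans (lintegral_mono fun x => ?_)
      (hBcap.trans ?_))
    · rw [← ENNReal.ofReal_rpow_of_nonneg (hessianNorm_nonneg _ _) hp]
      exact ENNReal.rpow_le_rpow (hBφ x).1 hp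
    · gcongr
      push_cast
      exact le_self_add
  · have hle : C' * ∫⁻ x, B x ^ (((n : ℝ) + 2) / 4) ≤
        (C' * (2 * C) + 1 : ℝ≥0) * besselCapacity K := by
      calc _ ≤ C' * ((2 * C) * besselCapacity K) := by gcongr
        _ = (C' * (2 * C)) * besselCapacity K := by ring
        _ ≤ _ := by
          gcongr
          push_cast
          exact le_self_add
    obtain ⟨h1, h2⟩ := hC' K hK u hu φ hφ h01 hV B hB hBφ η hη
    exact ⟨h1.trans hle, h2.trans hle⟩
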